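/- **Setting.** On $\mathbb R$ consider $$\partial_t\rho+\partial_x(\rho u)=0,\qquad \partial_t u+u\,\partial_x u=\int_{\mathbb R}\psi(x-y)\bigl(u(y,t)-u(x,t)\bigr)\rho(y,t)\,dy-K'\star\rho ,\qquad (\rho,u)|_{t=0}=(\rho_0,u_0).$$ Here $\psi\in W^{1,\infty}(\mathbb R)$ is even and $\psi\ge0$; $K\in\dot W^{2,\infty}(\mathbb R)$ is even (that is, $K$ is $C^1$ and $K'$ is Lipschitz). The initial density $\rho_0$ is a bounded continuous probability density, $u_0\in C^1(\mathbb R)$ with $u_0'$ bounded, and the nonlocal terms make sense initially: $\int|u_0|\rho_0\,dx<\infty$ and $\iint|K'(x-y)|\rho_0(x)\rho_0(y)\,dx\,dy<\infty$ (for example, $\rho_0$ has a finite first moment). **Solutions.** A solution on $[0,T)$, $0<T\le\infty$, is a pair $(\rho,u)$ with the given initial data such that: $\rho(\cdot,t)$ is a probability density; $\rho,u,\partial_xu$ are continuous on $[0,T)\times\mathbb R$; $u$ is $C^1$ on $(0,T)\times\mathbb R$; $u\rho(\cdot,t)$ and $K'(x-\cdot)\rho(\cdot,t)$ are integrable; $\rho$,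 $\partial_xu$ and $\int|u|\rho\,dx$ are bounded uniformly in $x$ and locally uniformly in $t\in[0,T)$; the momentum equation holds at every point of $(0,T)\times\mathbb R$; and the mass equation holds in the form $\frac{d}{dt}\int_a^b\rho\,dx=(\rho u)(a,t)-(\rho u)(b,t)$ for all $a,b$ and $0<t<T$. A solution on $[0,T)$ is called *maximal* if every solution on any $[0,T')$ has $T'\le T$ and coincides with it on $[0,T')$, and if moreover, whenever $\rho_0\in C^1$, $\rho_0'\in L^1$, $u_0\in C^2$ and $u_0''\in L^\infty$, the density $\rho$ is $C^1$ on $(0,T)\times\mathbb R$ and $\partial_t\rho+\partial_x(\rho u)=0$ holds there pointwise. *There is a global classical solution* means that there is a maximal solution with $T=\infty$. *The solution blows up in finite time* means that there is a maximal solution with $0<T<\infty$, and $\inf_x\partial_xu(x,t)\to-\infty$ as $t\uparrow T$. **Theorem 1.3.** 1. Attractive case, $K''\ge0$ a.e. If $\partial_xu_0(x)<-\psi\star\rho_0(x)$ for some $x\in\mathbb R$, then the solution blows up in finite time. 2. Repulsive case, $K''\le0$ a.e. - If $\partial_xu_0(x)\ge-\psi\star\rho_0(x)$ for all $x\in\mathbb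 R$, then there is a global classical solution. - If $\partial_xu_0(x)<-\psi\star\rho_0(x)-\sqrt{\|K''\|_{L^\infty}}$ for some $x\in\mathbb R$, then the solution blows up in finite time. -/

import Mathlib

open MeasureTheory Filter Topology Set

namespace EulerAlign

/-- The convolution `(f ⋆ g)(x) = ∫ f (x - y) g y dy` on the real line. -/
noncomputable def conv (f g : ℝ → ℝ) (x : ℝ) : ℝ := ∫ y, f (x - y) * g y

/-- An influence function: `ψ ∈ W^{1,∞}(ℝ)`, even, nonnegative and bounded. A `W^{1,∞}` function is
a bounded Lipschitz function. -/
structure IsInfluence (ψ : ℝ → ℝ) : Prop where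
  even : ∀ x, ψ (-x) = ψ x
  nonneg : ∀ x, 0 ≤ ψ x
  bounded : ∃ C, ∀ x, ψ x ≤ C
  lipschitz : ∃ L, LipschitzWith L ψ

/-- An interaction potential: even, in the homogeneous space `W^{2,∞}(ℝ)`, that is, `K` is
differentiable with Lipschitz derivative. Then `K'' = deriv (deriv K)` exists almost everywhere, is
bounded, and is the weak second derivative of `K`. -/
structure IsPotential (K : ℝ → ℝ) : Prop where
  even : ∀ x, K (-x) = K x
  differentiable : Differentiable ℝ K
  lipschitz : ∃ L, LipschitzWith L (deriv K)

/-- The essential supremum norm of `K''`. -/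
noncomputable def supNormSecondDeriv (K : ℝ → ℝ) : ℝ :=
  (eLpNorm (deriv (deriv K)) ⊤ volume).toReal

/-- Initial data: `ρ₀` is a bounded continuous probability density, `u₀` is `C¹` with bounded
derivative, and the total momentum and the total interaction force are absolutely convergent
integrals. The last two hold whenever `ρ₀` has a finite first moment, and also whenever
`u₀` and `K'` are bounded. -/
structure IsInitialData (K ρ₀ u₀ : ℝ → ℝ) : Prop where
  rho_continuous : Continuous ρ₀
  rho_nonneg : ∀ x, 0 ≤ ρ₀ x
  rho_bounded : ∃ C, ∀ x, ρ₀ x ≤ C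
  rho_integrable : Integrable ρ₀
  mass_one : ∫ x, ρ₀ x = 1
  u_contDiff : ContDiff ℝ 1 u₀
  deriv_u_bounded : ∃ C, ∀ x, |deriv u₀ x| ≤ C
  momentum : Integrable fun x => u₀ x * ρ₀ x
  force : Integrable fun p : ℝ × ℝ => deriv K (p.1 - p.2) * (ρ₀ p.1 * ρ₀ p.2)

/-- Additional smoothness of the initial data: `ρ₀` is `C¹` with `ρ₀'` integrable, and `u₀` is `C²`
with bounded second derivative. -/
structure IsSmoothData (ρ₀ u₀ : ℝ → ℝ) : Prop where
  rho_contDiff : ContDiff ℝ 1 ρ₀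
  deriv_rho_integrable : Integrable (deriv ρ₀)
  u_contDiff : ContDiff ℝ 2 u₀
  deriv_deriv_u_bounded : ∃ C, ∀ x, |deriv (deriv u₀) x| ≤ C

/-- The space-time slab `[0,T) × ℝ`; the lifespan `T` may be `⊤`, for the half-plane. -/
def slab (T : EReal) : Set (ℝ × ℝ) := {p | 0 ≤ p.1 ∧ (p.1 : EReal) < T}

/-- The open space-time slab `(0,T) × ℝ`. -/
def openSlab (T : EReal) : Set (ℝ × ℝ) := {p | 0 < p.1 ∧ (p.1 : EReal) < T}

/-- `(ρ, u)` solves on `[0,T)` the system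
`∂ₜ ρ + ∂ₓ(ρ u) = 0`,
`∂ₜ u + u ∂ₓ u = ∫ ψ (x - y) (u y - u x) ρ y dy - K' ⋆ ρ`
with initial data `(ρ₀, u₀)`. Here `ρ t x` and `u t x` are the values at time `t` and place `x`.
The density `ρ` is continuous and the velocity `u` is `C¹`. The momentum equation
holds pointwise, the mass equation in its integral form on every interval. The quantities
`ρ`, `∂ₓ u` and `∫ |u| ρ` are bounded, uniformly in `x` and locally uniformly in `t`. -/
structure IsSolution (ψ K ρ₀ u₀ : ℝ → ℝ) (T : EReal) (ρ u : ℝ → ℝ → ℝ) : Prop where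
  init_rho : ρ 0 = ρ₀
  init_u : u 0 = u₀
  rho_continuousOn : ContinuousOn (fun p : ℝ × ℝ => ρ p.1 p.2) (slab T)
  u_continuousOn : ContinuousOn (fun p : ℝ × ℝ => u p.1 p.2) (slab T)
  deriv_u_continuousOn : ContinuousOn (fun p : ℝ × ℝ => deriv (u p.1) p.2) (slab T)
  u_contDiffOn : ContDiffOn ℝ 1 (fun p : ℝ × ℝ => u p.1 p.2) (openSlab T)
  rho_nonneg : ∀ t : ℝ, 0 ≤ t → (t : EReal) < T → ∀ x, 0 ≤ ρ t x
  rho_integrable : ∀ t : ℝ, 0 ≤ t → (t : EReal) < T → Integrable (ρ t)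
  mass_one : ∀ t : ℝ, 0 ≤ t → (t : EReal) < T → ∫ x, ρ t x = 1
  momentum_integrable : ∀ t : ℝ, 0 ≤ t → (t : EReal) < T → Integrable fun x => u t x * ρ t x
  force_integrable : ∀ t : ℝ, 0 ≤ t → (t : EReal) < T → ∀ x,
    Integrable fun y => deriv K (x - y) * ρ t y
  locally_bounded : ∀ τ : ℝ, 0 ≤ τ → (τ : EReal) < T → ∃ C : ℝ, ∀ t ∈ Icc 0 τ,
    (∀ x, ρ t x ≤ C) ∧ (∀ x, |deriv (u t) x| ≤ C) ∧ ∫ x, |u t x| * ρ t x ≤ C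
  mass_eq : ∀ t : ℝ, 0 < t → (t : EReal) < T → ∀ a b : ℝ,
    HasDerivAt (fun s => ∫ x in a..b, ρ s x) (ρ t a * u t a - ρ t b * u t b) t
  momentum_eq : ∀ t : ℝ, 0 < t → (t : EReal) < T → ∀ x : ℝ,
    deriv (fun s => u s x) t + u t x * deriv (u t) x
      = (∫ y, ψ (x - y) * (u t y - u t x) * ρ t y) - conv (deriv K) (ρ t) x

/-- The density is `C¹` on `(0,T) × ℝ` and `∂ₜ ρ + ∂ₓ(ρ u) = 0` holds at every point. -/
structure IsMassClassical (T : EReal) (ρ u : ℝ → ℝ → ℝ) : Prop where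
  rho_contDiffOn : ContDiffOn ℝ 1 (fun p : ℝ × ℝ => ρ p.1 p.2) (openSlab T)
  mass_eq : ∀ t : ℝ, 0 < t → (t : EReal) < T → ∀ x : ℝ,
    deriv (fun s => ρ s x) t + deriv (fun y => ρ t y * u t y) x = 0

/-- `(ρ, u)` is the maximal solution and its lifespan is `T`: it solves the system on `[0,T)`, with
`ρ` of class `C¹` if the data are smooth, and every solution on some `[0,T')` has
`T' ≤ T` and coincides with `(ρ, u)` on `[0,T')`. -/
structure IsMaximalSolution (ψ K ρ₀ u₀ : ℝ → ℝ) (T : EReal) (ρ u : ℝ → ℝ → ℝ) : Prop where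
  isSolution : IsSolution ψ K ρ₀ u₀ T ρ u
  classical : IsSmoothData ρ₀ u₀ → IsMassClassical T ρ u
  maximal : ∀ (T' : EReal) (ρ' u' : ℝ → ℝ → ℝ), IsSolution ψ K ρ₀ u₀ T' ρ' u' →
    T' ≤ T ∧ ∀ t : ℝ, 0 ≤ t → (t : EReal) < T' → ρ' t = ρ t ∧ u' t = u t

/-- There is a (unique) global classical solution. -/
def HasGlobalSolution (ψ K ρ₀ u₀ : ℝ → ℝ) : Prop :=
  ∃ ρ u : ℝ → ℝ → ℝ, IsMaximalSolution ψ K ρ₀ u₀ ⊤ ρ u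

/-- The (unique, maximal) classical solution has a finite lifespan `T > 0`, and
`inf_x ∂ₓ u(t,x) → -∞` as `t ↑ T`. -/
def BlowsUpInFiniteTime (ψ K ρ₀ u₀ : ℝ → ℝ) : Prop :=
  ∃ T : ℝ, 0 < T ∧ ∃ ρ u : ℝ → ℝ → ℝ, IsMaximalSolution ψ K ρ₀ u₀ (T : EReal) ρ u ∧
    ∀ M : ℝ, ∀ᶠ t in 𝓝[<] T, ∃ x, deriv (u t) x < -M

end EulerAlign

namespace EulerAlign

open scoped NNReal

/-! ### Ordinary differential equations and Grönwall inequalities -/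

section Ode
variable {E : Type*} [NormedAddCommGroup E] [NormedSpace ℝ E]

/-! In Lagrangian coordinates the system becomes an ordinary differential equation that never blows
up. Let Ψ be a primitive of ψ and X the particle map, so that ρ = X_# ρ₀. Along particles, d/dt (Ψ ⋆
ρ)(X) is minus the alignment force. Hence G = u ∘ X + (Ψ ⋆ ρ) ∘ X satisfies X' = G - (Ψ ⋆ ρ) ∘ X, G'
= -(K' ⋆ ρ) ∘ X, a closed system for (X, G). Since Ψ and K' are Lipschitz, its right side is
globally Lipschitz in the sup norm with weight 1/θ, where θ = 1 + |u₀| + |K' ⋆ ρ₀| is integrable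
against ρ₀. The flow therefore exists for all times, even if particles collide (`Data.exists_flow`).

Blow-up is thus the degeneration of X. While X(t) expands distances by at least a positive factor,
uniformly on [0, b] (`Good`), it is invertible, and pushing forward gives a solution
(`IsFlow.isSolution`). Conversely, ∂ₓu is bounded for any solution, so its characteristics separate
at a controlled rate. They carry ρ₀ to ρ and coincide with the flow (`IsChar.eq_flow`). So solutions
are unique and none outlives `Good` (`IsSolution.good`): the maximal lifespan is the first time at
which `Good` fails.

Write J = ∂ₓX and g = ∂ₓG. At each label, J' = g - aJ, g' = -cJ, J(0) = 1, g(0) = u₀' + ψ ⋆ ρ₀, with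
a = (ψ ⋆ ρ)(X) in [0, L] and c = (K'' ⋆ ρ)(X). If K'' ≤ 0 and g(0) ≥ 0, then g stays nonnegative and
J ≥ exp(-Lt), so `Good` holds forever (`good_of_subcritical`). If K'' ≥ -q² and g(0) < -q at some
label, then -(g + qJ) cannot decrease while J ≥ 0. So g ≤ g(0) + q < 0, and J ≤ 1 + (g(0) + q)t must
vanish in finite time (`exists_not_good`). The attractive case is q = 0, the repulsive one q =
√‖K''‖. Finally ∂ₓu = g/J - a. If ∂ₓu ≥ -M at a time close enough to T, a Riccati comparison keeps J
bounded below up to T (`good_of_le_deriv`), so T is not the lifespan. This forces inf ∂ₓu → -∞.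

Two devices carry the regularity. The function K'' is only bounded and defined almost everywhere,
but `Good` makes X antilipschitz, so null sets pull back to null sets and convolutions with ρ depend
continuously on time. Spatial derivatives of the flow come from a linear equation for divided
differences (`exists_spatial_deriv`), which is used once for J and again for ∂ₓJ when the data are
smooth. -/

/-- Integration gains a factor 1/l on functions growing like exp(l|t|). This is what makes the
Picard map contract in an exponentially weighted norm. -/
theorem norm_integral_le_exp_abs {g : ℝ → E} {B l : ℝ} (hl : 0 < l)
    (hg : ∀ s, ‖g s‖ ≤ B * Real.exp (l * |s|)) (t : ℝ) :
    ‖∫ s in (0 : ℝ)..t, g s‖ ≤ B / l * Real.exp (l * |t|) := by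
  have hB : 0 ≤ B := by
    have := (norm_nonneg _).trans (hg 0)
    simpa using this
  have key : ∀ (g : ℝ → E), (∀ s, ‖g s‖ ≤ B * Real.exp (l * |s|)) → ∀ t, 0 ≤ t →
      ‖∫ s in (0 : ℝ)..t, g s‖ ≤ B / l * Real.exp (l * |t|) := by
    intro g hg t ht
    have h1 : ‖∫ s in (0 : ℝ)..t, g s‖ ≤ ∫ s in (0 : ℝ)..t, B * Real.exp (l * s) := by
      apply intervalIntegral.norm_integral_le_of_norm_le ht
      · refine Eventually.of_forall fun s hs => ?_
        have := hg s
        rwa [abs_of_pos hs.1] at this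
      · exact (by fun_prop : Continuous fun s => B * Real.exp (l * s)).intervalIntegrable _ _
    have h2 : ∫ s in (0 : ℝ)..t, B * Real.exp (l * s) = B / l * Real.exp (l * t) - B / l := by
      rw [intervalIntegral.integral_eq_sub_of_hasDerivAt (f := fun s => B / l * Real.exp (l * s))]
      · simp
      · intro s _
        have := (((hasDerivAt_id s).const_mul l).exp).const_mul (B / l)
        convert! this using 1
        simp only [id]
        field_simp
      · exact (by fun_prop : Continuous fun s => B * Real.exp (l * s)).intervalIntegrable _ _
    rw [abs_of_nonneg ht]
    have : 0 ≤ B / l := by positivity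
    linarith
  rcases le_total 0 t with ht | ht
  · exact key g hg t ht
  · have h := key (fun s => g (-s)) (fun s => by simpa using hg (-s)) (-t) (by linarith)
    rw [intervalIntegral.integral_comp_neg] at h
    rw [intervalIntegral.integral_symm, norm_neg]
    simpa using h

/-- Picard iteration on the whole line at once: write γ = w • a with w = exp(l|t|) and a bounded and
continuous. In the sup norm of a the Picard map has Lipschitz constant K / l, so no gluing of local
solutions is needed. -/
theorem exists_global_solution [CompleteSpace E] {f : ℝ → E → E} {K : ℝ≥0} {C : ℝ}
    (hf : Continuous (Function.uncurry f)) (hL : ∀ t, LipschitzWith K (f t))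
    (hC : ∀ t, ‖f t 0‖ ≤ C) (x₀ : E) :
    ∃ γ : ℝ → E, γ 0 = x₀ ∧ ∀ t, HasDerivAt γ (f t (γ t)) t := by
  -- This rate is positive even for K = 0 and gives K / l ≤ 1/2.
  set l : ℝ := 2 * (K + 1) with hl_def
  have hl : 0 < l := by positivity
  have hC0 : 0 ≤ C := (norm_nonneg _).trans (hC 0)
  let w : ℝ → ℝ := fun t => Real.exp (l * |t|)
  have hw : Continuous w := by fun_prop
  have hwpos : ∀ t, 0 < w t := fun t => Real.exp_pos _
  have hw1 : ∀ t, 1 ≤ w t := fun t => Real.one_le_exp (by positivity)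
  have hgrow : ∀ t y, ‖f t y‖ ≤ C + K * ‖y‖ := by
    intro t y
    have h1 := (hL t).norm_sub_le y 0
    have h2 := norm_le_norm_add_norm_sub' (f t y) (f t 0)
    rw [sub_zero] at h1
    linarith [hC t]
  have hcont : ∀ a : BoundedContinuousFunction ℝ E, Continuous fun s => f s (w s • a s) :=
    fun a => hf.comp (continuous_id.prodMk (hw.smul a.continuous))
  let P : BoundedContinuousFunction ℝ E → BoundedContinuousFunction ℝ E := fun a =>
    BoundedContinuousFunction.ofNormedAddCommGroup
      (fun t => (w t)⁻¹ • (x₀ + ∫ s in (0 : ℝ)..t, f s (w s • a s)))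
      ((hw.inv₀ fun t => (hwpos t).ne').smul (continuous_const.add
        (intervalIntegral.continuous_primitive (fun _ _ => (hcont a).intervalIntegrable _ _) 0)))
      (‖x₀‖ + (C + K * ‖a‖) / l) (by
        intro t
        have h1 : ‖∫ s in (0 : ℝ)..t, f s (w s • a s)‖ ≤ (C + K * ‖a‖) / l * w t := by
          apply norm_integral_le_exp_abs hl
          intro s
          calc ‖f s (w s • a s)‖ ≤ C + K * ‖w s • a s‖ := hgrow _ _
            _ ≤ C * w s + K * (w s * ‖a‖) := by
              rw [norm_smul, Real.norm_of_nonneg (hwpos s).le]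
              have := hw1 s
              have := a.norm_coe_le_norm s
              have := (hwpos s).le
              gcongr
              nlinarith
            _ = _ := by ring
        rw [norm_smul, norm_inv, Real.norm_of_nonneg (hwpos t).le, inv_mul_le_iff₀ (hwpos t)]
        calc ‖x₀ + ∫ s in (0 : ℝ)..t, f s (w s • a s)‖
            ≤ ‖x₀‖ + (C + K * ‖a‖) / l * w t := (norm_add_le _ _).trans (by gcongr)
          _ ≤ w t * (‖x₀‖ + (C + K * ‖a‖) / l) := by
            nlinarith [norm_nonneg x₀, hw1 t])
  have hP : ContractingWith (1 / 2) P := by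
    refine ⟨by rw [← NNReal.coe_lt_coe]; norm_num, LipschitzWith.of_dist_le_mul fun a c => ?_⟩
    rw [BoundedContinuousFunction.dist_le (by positivity)]
    intro t
    change dist ((w t)⁻¹ • (x₀ + ∫ s in (0 : ℝ)..t, f s (w s • a s)))
      ((w t)⁻¹ • (x₀ + ∫ s in (0 : ℝ)..t, f s (w s • c s))) ≤ _
    rw [dist_eq_norm, ← smul_sub, add_sub_add_left_eq_sub, ← intervalIntegral.integral_sub
      ((hcont a).intervalIntegrable _ _) ((hcont c).intervalIntegrable _ _), norm_smul, norm_inv,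
      Real.norm_of_nonneg (hwpos t).le, inv_mul_le_iff₀ (hwpos t)]
    have h1 : ‖∫ s in (0 : ℝ)..t, (f s (w s • a s) - f s (w s • c s))‖
        ≤ (K * dist a c) / l * w t := by
      apply norm_integral_le_exp_abs hl
      intro s
      calc ‖f s (w s • a s) - f s (w s • c s)‖ ≤ K * ‖w s • a s - w s • c s‖ :=
            (hL s).norm_sub_le _ _
        _ = K * (w s * dist (a s) (c s)) := by
            rw [← smul_sub, norm_smul, Real.norm_of_nonneg (hwpos s).le, dist_eq_norm]
        _ ≤ K * (w s * dist a c) := by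
            have := BoundedContinuousFunction.dist_coe_le_dist (f := a) (g := c) s
            have := (hwpos s).le
            gcongr
        _ = _ := by ring
    refine h1.trans ?_
    rw [mul_comm]
    refine mul_le_mul_of_nonneg_left ?_ (hwpos t).le
    rw [div_le_iff₀ hl, hl_def]
    have := dist_nonneg (x := a) (y := c)
    push_cast
    nlinarith
  obtain ⟨a, ha⟩ : ∃ a, P a = a := ⟨_, hP.fixedPoint_isFixedPt⟩
  have hfix : ∀ t, w t • a t = x₀ + ∫ s in (0 : ℝ)..t, f s (w s • a s) := by
    intro t
    have h : (w t)⁻¹ • (x₀ + ∫ s in (0 : ℝ)..t, f s (w s • a s)) = a t :=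
      congrArg (fun b : BoundedContinuousFunction ℝ E => b t) ha
    rw [← h, smul_inv_smul₀ (hwpos t).ne']
  refine ⟨fun t => w t • a t, by simpa using hfix 0, fun t => ?_⟩
  have h1 := (intervalIntegral.integral_hasDerivAt_right ((hcont a).intervalIntegrable 0 t)
    ((hcont a).stronglyMeasurableAtFilter _ _) (hcont a).continuousAt).const_add x₀
  exact h1.congr_of_eventuallyEq (Eventually.of_forall hfix)

/-- Derivatives are known only on the open interval, while Grönwall wants one at the initial time.
The remedy is to start at s > 0 and let s tend to 0. -/
theorem le_of_forall_Ioo_le {E : Type*} [NormedAddCommGroup E] {f : ℝ → E} {t : ℝ} (ht : 0 < t)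
    (hf : ContinuousOn f (Icc 0 t))
    {F : ℝ → ℝ → ℝ} (hF : Continuous fun p : ℝ × ℝ => F p.1 p.2)
    (h : ∀ s ∈ Ioo 0 t, ‖f t‖ ≤ F ‖f s‖ s) : ‖f t‖ ≤ F ‖f 0‖ 0 := by
  have h0 : Tendsto f (𝓝[>] 0) (𝓝 (f 0)) := by
    have := (hf 0 (left_mem_Icc.2 ht.le)).mono (Ioo_subset_Icc_self)
    rwa [ContinuousWithinAt, nhdsWithin_Ioo_eq_nhdsGT ht] at this
  have h1 : Tendsto (fun s => F ‖f s‖ s) (𝓝[>] 0) (𝓝 (F ‖f 0‖ 0)) :=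
    (hF.tendsto (‖f 0‖, 0)).comp (h0.norm.prodMk_nhds (tendsto_id.mono_left nhdsWithin_le_nhds))
  refine ge_of_tendsto h1 ?_
  filter_upwards [Ioo_mem_nhdsGT ht] with s hs using h s hs

theorem norm_le_gronwallBound_of_hasDerivAt {f f' : ℝ → E} {K ε b : ℝ}
    (hf : ContinuousOn f (Icc 0 b)) (hf' : ∀ t ∈ Ioo 0 b, HasDerivAt f (f' t) t)
    (bound : ∀ t ∈ Ioo 0 b, ‖f' t‖ ≤ K * ‖f t‖ + ε) :
    ∀ t ∈ Icc 0 b, ‖f t‖ ≤ gronwallBound ‖f 0‖ K ε t := by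
  intro t ht
  rcases ht.1.eq_or_lt with h0 | h0
  · rw [← h0, gronwallBound_x0]
  have hcont : Continuous fun p : ℝ × ℝ => gronwallBound p.1 K ε (t - p.2) := by
    by_cases hK : K = 0
    · subst hK; simp only [gronwallBound_K0]; fun_prop
    · simp only [gronwallBound_of_K_ne_0 hK]; fun_prop
  have := le_of_forall_Ioo_le h0 (hf.mono (Icc_subset_Icc_right ht.2))
    (F := fun d s => gronwallBound d K ε (t - s)) hcont ?_
  · simpa using this
  intro s hs
  refine norm_le_gronwallBound_of_norm_deriv_right_le (f' := f')
    (hf.mono (Icc_subset_Icc hs.1.le ht.2)) (fun x hx => ?_) le_rfl (fun x hx => ?_) t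
    (right_mem_Icc.2 hs.2.le)
  · exact (hf' x ⟨hs.1.trans_le hx.1, hx.2.trans_le ht.2⟩).hasDerivWithinAt
  · exact bound x ⟨hs.1.trans_le hx.1, hx.2.trans_le ht.2⟩

theorem eq_zero_of_norm_deriv_le {f f' : ℝ → E} {K b : ℝ}
    (hf : ContinuousOn f (Icc 0 b)) (hf' : ∀ t ∈ Ioo 0 b, HasDerivAt f (f' t) t)
    (bound : ∀ t ∈ Ioo 0 b, ‖f' t‖ ≤ K * ‖f t‖) (h0 : f 0 = 0) :
    ∀ t ∈ Icc 0 b, f t = 0 := by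
  intro t ht
  have := norm_le_gronwallBound_of_hasDerivAt (K := K) (ε := 0) hf hf' (by simpa using bound) t ht
  rw [h0, norm_zero, gronwallBound_ε0_δ0] at this
  simpa using this

/-- The factor 1/l in front of the exponential is what allows an a priori bound to be halved in
`le_of_halving`. -/
theorem norm_le_of_norm_deriv_le_exp {f f' : ℝ → E} {A B l b : ℝ} (hl : 0 < l)
    (hf : ContinuousOn f (Icc 0 b)) (hf' : ∀ t ∈ Ioo 0 b, HasDerivAt f (f' t) t)
    (bound : ∀ t ∈ Ioo 0 b, ‖f' t‖ ≤ A + B * Real.exp (l * t)) (hB : 0 ≤ B) :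
    ∀ t ∈ Icc 0 b, ‖f t‖ ≤ ‖f 0‖ + A * t + B / l * Real.exp (l * t) := by
  intro t ht
  rcases ht.1.eq_or_lt with h0 | h0
  · rw [← h0]
    have : 0 ≤ B / l * Real.exp (l * 0) := by positivity
    linarith
  have := le_of_forall_Ioo_le h0 (hf.mono (Icc_subset_Icc_right ht.2))
    (F := fun d s => d + A * (t - s) + B / l * (Real.exp (l * t) - Real.exp (l * s)))
    (by fun_prop) ?_
  · refine this.trans ?_
    have : 0 ≤ B / l := by positivity
    simp only [mul_zero, Real.exp_zero, sub_zero]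
    linarith
  intro s hs
  refine image_norm_le_of_norm_deriv_right_le_deriv_boundary (f := f) (f' := f') (a := s) (b := t)
    (B := fun r => ‖f s‖ + A * (r - s) + B / l * (Real.exp (l * r) - Real.exp (l * s)))
    (B' := fun r => A + B * Real.exp (l * r))
    (hf.mono (Icc_subset_Icc hs.1.le ht.2)) (fun x hx => ?_) (by simp) (fun x => ?_) (fun x hx => ?_)
    (right_mem_Icc.2 hs.2.le)
  · exact (hf' x ⟨hs.1.trans_le hx.1, hx.2.trans_le ht.2⟩).hasDerivWithinAt
  · have h1 := ((((hasDerivAt_id x).const_mul l).exp).sub_const (Real.exp (l * s))).const_mul (B / l)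
    have h2 := ((((hasDerivAt_id x).sub_const s).const_mul A).const_add ‖f s‖).add h1
    convert! h2 using 1
    simp only [id]
    field_simp
  · exact bound x ⟨hs.1.trans_le hx.1, hx.2.trans_le ht.2⟩

end Ode

/-! ### Functions with continuous partial derivatives -/

section Partial

theorem hasStrictFDerivAt_of_partial {f f₁ f₂ : ℝ → ℝ → ℝ} {U : Set (ℝ × ℝ)} (hU : IsOpen U)
    (h₁ : ∀ p ∈ U, HasDerivAt (fun t => f t p.2) (f₁ p.1 p.2) p.1)
    (h₂ : ∀ p ∈ U, HasDerivAt (fun x => f p.1 x) (f₂ p.1 p.2) p.2)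
    (c₁ : ContinuousOn (fun p : ℝ × ℝ => f₁ p.1 p.2) U)
    (c₂ : ContinuousOn (fun p : ℝ × ℝ => f₂ p.1 p.2) U) {p : ℝ × ℝ} (hp : p ∈ U) :
    HasStrictFDerivAt (fun q : ℝ × ℝ => f q.1 q.2)
      ((ContinuousLinearMap.toSpanSingleton ℝ (f₁ p.1 p.2)).coprod
        (ContinuousLinearMap.toSpanSingleton ℝ (f₂ p.1 p.2))) p := by
  have hcl : Continuous fun c : ℝ => ContinuousLinearMap.toSpanSingleton ℝ c :=
    (ContinuousLinearMap.toSpanSingletonCLE (𝕜 := ℝ) (E := ℝ)).continuous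
  have hn := hU.mem_nhds hp
  exact hasStrictFDerivAt_uncurry_coprod (𝕜 := ℝ) (f := f)
    (f₁ := fun t x => ContinuousLinearMap.toSpanSingleton ℝ (f₁ t x))
    (f₂ := fun t x => ContinuousLinearMap.toSpanSingleton ℝ (f₂ t x))
    (by filter_upwards [hn] with v hv using (h₁ v hv).hasFDerivAt)
    (by filter_upwards [hn] with v hv using (h₂ v hv).hasFDerivAt)
    (hcl.continuousAt.comp (f := fun p : ℝ × ℝ => f₁ p.1 p.2) (c₁.continuousAt hn))
    (hcl.continuousAt.comp (f := fun p : ℝ × ℝ => f₂ p.1 p.2) (c₂.continuousAt hn))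

theorem contDiffOn_one_of_partial {f f₁ f₂ : ℝ → ℝ → ℝ} {U : Set (ℝ × ℝ)} (hU : IsOpen U)
    (h₁ : ∀ p ∈ U, HasDerivAt (fun t => f t p.2) (f₁ p.1 p.2) p.1)
    (h₂ : ∀ p ∈ U, HasDerivAt (fun x => f p.1 x) (f₂ p.1 p.2) p.2)
    (c₁ : ContinuousOn (fun p : ℝ × ℝ => f₁ p.1 p.2) U)
    (c₂ : ContinuousOn (fun p : ℝ × ℝ => f₂ p.1 p.2) U) :
    ContDiffOn ℝ 1 (fun p : ℝ × ℝ => f p.1 p.2) U := by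
  have hcl : Continuous fun c : ℝ => ContinuousLinearMap.toSpanSingleton ℝ c :=
    (ContinuousLinearMap.toSpanSingletonCLE (𝕜 := ℝ) (E := ℝ)).continuous
  have h := fun p (hp : p ∈ U) =>
    (hasStrictFDerivAt_of_partial hU h₁ h₂ c₁ c₂ hp).hasFDerivAt
  rw [← zero_add (1 : WithTop ℕ∞), contDiffOn_succ_iff_fderiv_of_isOpen hU]
  refine ⟨fun p hp => (h p hp).differentiableAt.differentiableWithinAt, by simp, ?_⟩
  rw [contDiffOn_zero]
  refine ContinuousOn.congr ?_ fun p hp => (h p hp).fderiv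
  have := ((hcl.comp_continuousOn c₁).prodMk (hcl.comp_continuousOn c₂))
  exact (ContinuousLinearMap.coprodEquivL
    (S := ℝ) (𝕜 := ℝ) (E := ℝ) (F := ℝ) (G := ℝ)).continuous.comp_continuousOn this

theorem hasDerivAt_comp_of_partial {f f₁ f₂ : ℝ → ℝ → ℝ} {U : Set (ℝ × ℝ)} (hU : IsOpen U)
    (h₁ : ∀ p ∈ U, HasDerivAt (fun t => f t p.2) (f₁ p.1 p.2) p.1)
    (h₂ : ∀ p ∈ U, HasDerivAt (fun x => f p.1 x) (f₂ p.1 p.2) p.2)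
    (c₁ : ContinuousOn (fun p : ℝ × ℝ => f₁ p.1 p.2) U)
    (c₂ : ContinuousOn (fun p : ℝ × ℝ => f₂ p.1 p.2) U) {γ : ℝ → ℝ} {γ' t : ℝ}
    (hγ : HasDerivAt γ γ' t) (hp : (t, γ t) ∈ U) :
    HasDerivAt (fun s => f s (γ s)) (f₁ t (γ t) + f₂ t (γ t) * γ') t := by
  have h := (hasStrictFDerivAt_of_partial hU h₁ h₂ c₁ c₂ hp).hasFDerivAt
  have := HasFDerivAt.comp_hasDerivAt (f := fun s => (s, γ s)) t h ((hasDerivAt_id t).prodMk hγ)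
  convert! this using 1
  simp [mul_comm]

end Partial

/-! ### Divided differences -/

/-- The average of `f` over the segment from `y` to `x`. -/
noncomputable def segAvg (f : ℝ → ℝ) (x y : ℝ) : ℝ := ∫ s in (0 : ℝ)..1, f (y + s * (x - y))

theorem segAvg_self (f : ℝ → ℝ) (x : ℝ) : segAvg f x x = f x := by simp [segAvg]

/-- Hadamard's lemma: the difference quotient extends across the diagonal as an average of the
derivative, and is then continuous in all variables. -/
theorem sub_eq_segAvg_mul {F f : ℝ → ℝ} (hF : ∀ z, HasDerivAt F (f z) z) (hf : Continuous f)
    (x y : ℝ) : F x - F y = segAvg f x y * (x - y) := by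
  have h := intervalIntegral.integral_eq_sub_of_hasDerivAt (a := 0) (b := 1)
    (f := fun s => F (y + s * (x - y))) (f' := fun s => f (y + s * (x - y)) * (x - y))
    (fun s _ => by
      have h1 : HasDerivAt (fun s => y + s * (x - y)) (x - y) s := by
        simpa using ((hasDerivAt_id s).mul_const (x - y)).const_add y
      exact (hF _).comp s h1) (Continuous.intervalIntegrable (by fun_prop) _ _)
  rw [intervalIntegral.integral_mul_const] at h
  rw [segAvg, h]
  simp

theorem continuous_segAvg {Z : Type*} [TopologicalSpace Z] {f : Z → ℝ → ℝ}
    (hf : Continuous fun p : Z × ℝ => f p.1 p.2) {g h : Z → ℝ} (hg : Continuous g)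
    (hh : Continuous h) : Continuous fun z => segAvg (f z) (g z) (h z) := by
  unfold segAvg
  have h0 : Continuous fun p : Z × ℝ => (p.1, h p.1 + p.2 * (g p.1 - h p.1)) := by fun_prop
  have h1 : Continuous (Function.uncurry fun (z : Z) (s : ℝ) => f z (h z + s * (g z - h z))) :=
    hf.comp h0
  exact intervalIntegral.continuous_parametric_intervalIntegral_of_continuous h1
    (s := fun _ => 1) continuous_const

/-! ### Linear systems and differentiation in a parameter -/

section Linear

/-- Clamping of time to `[0, b]`. -/
noncomputable def clamp (b t : ℝ) : ℝ := max 0 (min b t)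

theorem continuous_clamp (b : ℝ) : Continuous (clamp b) := by unfold clamp; fun_prop

theorem clamp_mem {b : ℝ} (hb : 0 ≤ b) (t : ℝ) : clamp b t ∈ Icc 0 b :=
  ⟨le_max_left _ _, max_le hb (min_le_left _ _)⟩

theorem clamp_eq {b t : ℝ} (ht : t ∈ Icc 0 b) : clamp b t = t := by
  rw [clamp, min_eq_right ht.2, max_eq_right ht.1]

/-- The system is posed in C(K, ℝ) × C(K, ℝ), so joint continuity in time and parameter comes for
free. Clamping time makes the coefficients bounded on the whole line, as the global existence
theorem requires. -/
theorem exists_continuous_linear_system {K : Type*} [TopologicalSpace K] [CompactSpace K]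
    {b : ℝ} (hb : 0 ≤ b) {α β σ η : ℝ → K → ℝ} (hα : Continuous fun p : ℝ × K => α p.1 p.2)
    (hβ : Continuous fun p : ℝ × K => β p.1 p.2) (hσ : Continuous fun p : ℝ × K => σ p.1 p.2)
    (hη : Continuous fun p : ℝ × K => η p.1 p.2) {p₀ q₀ : K → ℝ} (hp₀ : Continuous p₀)
    (hq₀ : Continuous q₀) :
    ∃ p q : ℝ → K → ℝ, (Continuous fun z : ℝ × K => p z.1 z.2) ∧
      (Continuous fun z : ℝ × K => q z.1 z.2) ∧ p 0 = p₀ ∧ q 0 = q₀ ∧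
      ∀ t ∈ Icc 0 b, ∀ k,
        HasDerivAt (fun s => p s k) (q t k - α t k * p t k - σ t k) t ∧
        HasDerivAt (fun s => q s k) (-(β t k * p t k) - η t k) t := by
  have hcl : Continuous fun z : ℝ × K => (clamp b z.1, z.2) :=
    ((continuous_clamp b).comp continuous_fst).prodMk continuous_snd
  let cur : (f : ℝ → K → ℝ) → (Continuous fun p : ℝ × K => f p.1 p.2) → C(ℝ, C(K, ℝ)) :=
    fun f hf => ContinuousMap.curry ⟨fun z : ℝ × K => f (clamp b z.1) z.2, hf.comp hcl⟩
  have hcur : ∀ f hf t k, cur f hf t k = f (clamp b t) k := fun f hf t k => rfl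
  have hbd : ∀ f hf, ∃ M : ℝ≥0, ∀ t, ‖cur f hf t‖ ≤ M := by
    intro f hf
    obtain ⟨M, hM⟩ := (isCompact_Icc (a := (0 : ℝ)) (b := b)).exists_bound_of_continuousOn
      (cur f hf).continuous.continuousOn
    refine ⟨M.toNNReal, fun t => ?_⟩
    have h1 : cur f hf t = cur f hf (clamp b t) := by
      ext k; rw [hcur f hf, hcur f hf, clamp_eq (clamp_mem hb t)]
    rw [h1]
    exact (hM _ (clamp_mem hb t)).trans (Real.le_coe_toNNReal M)
  obtain ⟨A, hA⟩ := hbd α hα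
  obtain ⟨B, hB⟩ := hbd β hβ
  obtain ⟨S, hS⟩ := hbd σ hσ
  obtain ⟨H, hH⟩ := hbd η hη
  let f : ℝ → C(K, ℝ) × C(K, ℝ) → C(K, ℝ) × C(K, ℝ) := fun t z =>
    (z.2 - cur α hα t * z.1 - cur σ hσ t, -(cur β hβ t * z.1) - cur η hη t)
  have hfc : Continuous (Function.uncurry f) := by
    have h1 := (cur α hα).continuous
    have h2 := (cur β hβ).continuous
    have h3 := (cur σ hσ).continuous
    have h4 := (cur η hη).continuous
    change Continuous fun w : ℝ × (C(K, ℝ) × C(K, ℝ)) =>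
      (w.2.2 - cur α hα w.1 * w.2.1 - cur σ hσ w.1, -(cur β hβ w.1 * w.2.1) - cur η hη w.1)
    fun_prop
  have hfL : ∀ t, LipschitzWith (1 + A + B) (f t) := by
    intro t
    refine LipschitzWith.of_dist_le_mul fun z w => ?_
    rw [dist_eq_norm, dist_eq_norm]
    have e : f t z - f t w = ((z - w).2 - cur α hα t * (z - w).1, -(cur β hβ t * (z - w).1)) := by
      ext k <;> simp [f] <;> ring
    rw [e]
    generalize z - w = v
    have hv1 := norm_fst_le v
    have hv2 := norm_snd_le v
    have h1 : ‖cur α hα t * v.1‖ ≤ A * ‖v‖ := (norm_mul_le _ _).trans (by gcongr; exact hA t)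
    have h2 : ‖cur β hβ t * v.1‖ ≤ B * ‖v‖ := (norm_mul_le _ _).trans (by gcongr; exact hB t)
    refine norm_prod_le_iff.2 ⟨(norm_sub_le _ _).trans ?_, ?_⟩
    · push_cast
      nlinarith [norm_nonneg v, B.coe_nonneg]
    · simp only [norm_neg]
      push_cast
      nlinarith [norm_nonneg v, A.coe_nonneg]
  have hf0 : ∀ t, ‖f t 0‖ ≤ S + H := by
    intro t
    have e : f t 0 = (-cur σ hσ t, -cur η hη t) := by ext k <;> simp [f]
    rw [e]
    refine norm_prod_le_iff.2 ⟨?_, ?_⟩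
    · simp only [norm_neg]; linarith [hS t, H.coe_nonneg]
    · simp only [norm_neg]; linarith [hH t, S.coe_nonneg]
  obtain ⟨γ, hγ0, hγ⟩ := exists_global_solution hfc hfL hf0 (⟨p₀, hp₀⟩, ⟨q₀, hq₀⟩)
  have hγc : Continuous γ := continuous_iff_continuousAt.2 fun t => (hγ t).continuousAt
  refine ⟨fun t k => (γ t).1 k, fun t k => (γ t).2 k, ?_, ?_, ?_, ?_, ?_⟩
  · exact (hγc.fst.comp continuous_fst).eval continuous_snd
  · exact (hγc.snd.comp continuous_fst).eval continuous_snd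
  · funext k; simp only [hγ0]; rfl
  · funext k; simp only [hγ0]; rfl
  · intro t ht k
    have h1 := ((ContinuousMap.evalCLM ℝ k).comp
      (ContinuousLinearMap.fst ℝ C(K, ℝ) C(K, ℝ))).hasFDerivAt.comp_hasDerivAt t (hγ t)
    have h2 := ((ContinuousMap.evalCLM ℝ k).comp
      (ContinuousLinearMap.snd ℝ C(K, ℝ) C(K, ℝ))).hasFDerivAt.comp_hasDerivAt t (hγ t)
    refine ⟨?_, ?_⟩
    · convert! h1 using 1
      simp [f, hcur, clamp_eq ht]
    · convert! h2 using 1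
      simp [f, hcur, clamp_eq ht]

/-- The differences of P and Q solve a linear system whose coefficients are continuous in (x, y).
The same system, started from the divided differences of the initial data, has a solution (p, q)
continuous up to the diagonal. Uniqueness gives P x - P y = p (x - y), and on the diagonal p is the
derivative. Nothing needs to be known in advance about differentiability of P and Q at positive
times. -/
theorem exists_spatial_deriv {b : ℝ} (hb : 0 ≤ b) {P Q : ℝ → ℝ → ℝ} {α β σ η : ℝ → ℝ × ℝ → ℝ}
    (hα : Continuous fun p : ℝ × ℝ × ℝ => α p.1 p.2)
    (hβ : Continuous fun p : ℝ × ℝ × ℝ => β p.1 p.2)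
    (hσ : Continuous fun p : ℝ × ℝ × ℝ => σ p.1 p.2)
    (hη : Continuous fun p : ℝ × ℝ × ℝ => η p.1 p.2)
    (hPc : ∀ x, ContinuousOn (fun t => P t x) (Icc 0 b))
    (hQc : ∀ x, ContinuousOn (fun t => Q t x) (Icc 0 b))
    (hP : ∀ t ∈ Ioo 0 b, ∀ x y, HasDerivAt (fun s => P s x - P s y)
      ((Q t x - Q t y) - α t (x, y) * (P t x - P t y) - σ t (x, y) * (x - y)) t)
    (hQ : ∀ t ∈ Ioo 0 b, ∀ x y, HasDerivAt (fun s => Q s x - Q s y)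
      (-(β t (x, y) * (P t x - P t y)) - η t (x, y) * (x - y)) t)
    (hP0 : ContDiff ℝ 1 (P 0)) (hQ0 : ContDiff ℝ 1 (Q 0)) :
    ∃ p q : ℝ → ℝ → ℝ, ContinuousOn (fun z : ℝ × ℝ => p z.1 z.2) (Icc 0 b ×ˢ univ) ∧
      ContinuousOn (fun z : ℝ × ℝ => q z.1 z.2) (Icc 0 b ×ˢ univ) ∧
      (∀ t ∈ Icc 0 b, ∀ x, HasDerivAt (P t) (p t x) x ∧ HasDerivAt (Q t) (q t x) x) ∧
      ∀ t ∈ Ioo 0 b, ∀ x,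
        HasDerivAt (fun s => p s x) (q t x - α t (x, x) * p t x - σ t (x, x)) t ∧
        HasDerivAt (fun s => q s x) (-(β t (x, x) * p t x) - η t (x, x)) t := by
  -- The linear system needs a compact parameter space: squares [-R, R]² are used, and the results
  -- are patched together at the end.
  have key : ∀ R : ℝ, ∃ p q : ℝ → ℝ → ℝ,
      ContinuousOn (fun z : ℝ × ℝ => p z.1 z.2) (univ ×ˢ Ioo (-R) R) ∧
      ContinuousOn (fun z : ℝ × ℝ => q z.1 z.2) (univ ×ˢ Ioo (-R) R) ∧
      (∀ t ∈ Icc 0 b, ∀ x ∈ Ioo (-R) R, HasDerivAt (P t) (p t x) x ∧ HasDerivAt (Q t) (q t x) x) ∧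
      ∀ t ∈ Icc 0 b, ∀ x ∈ Ioo (-R) R,
        HasDerivAt (fun s => p s x) (q t x - α t (x, x) * p t x - σ t (x, x)) t ∧
        HasDerivAt (fun s => q s x) (-(β t (x, x) * p t x) - η t (x, x)) t := by
    intro R
    let K := (Icc (-R) R ×ˢ Icc (-R) R : Set (ℝ × ℝ))
    have hK : IsCompact K := isCompact_Icc.prod isCompact_Icc
    have : CompactSpace K := isCompact_iff_compactSpace.1 hK
    have hval : Continuous fun z : ℝ × K => (z.1, (z.2 : ℝ × ℝ)) := by fun_prop
    have hdP := hP0.continuous_deriv le_rfl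
    have hdQ := hQ0.continuous_deriv le_rfl
    have hP0' : ∀ x y, P 0 x - P 0 y = segAvg (deriv (P 0)) x y * (x - y) :=
      sub_eq_segAvg_mul (fun z => ((hP0.differentiable one_ne_zero) z).hasDerivAt) hdP
    have hQ0' : ∀ x y, Q 0 x - Q 0 y = segAvg (deriv (Q 0)) x y * (x - y) :=
      sub_eq_segAvg_mul (fun z => ((hQ0.differentiable one_ne_zero) z).hasDerivAt) hdQ
    obtain ⟨p, q, hpc, hqc, hp0, hq0, hpq⟩ := exists_continuous_linear_system (K := K) hb
      (α := fun t k => α t k) (β := fun t k => β t k) (σ := fun t k => σ t k)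
      (η := fun t k => η t k) (hα.comp hval) (hβ.comp hval) (hσ.comp hval) (hη.comp hval)
      (p₀ := fun k => segAvg (deriv (P 0)) k.1.1 k.1.2)
      (q₀ := fun k => segAvg (deriv (Q 0)) k.1.1 k.1.2)
      (continuous_segAvg (hdP.comp continuous_snd) (by fun_prop) (by fun_prop))
      (continuous_segAvg (hdQ.comp continuous_snd) (by fun_prop) (by fun_prop))
    -- The difference minus p (x - y) solves the homogeneous linear system with zero initial value.
    have hid : ∀ (k : K), ∀ t ∈ Icc 0 b,
        (P t k.1.1 - P t k.1.2 = p t k * (k.1.1 - k.1.2)) ∧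
        (Q t k.1.1 - Q t k.1.2 = q t k * (k.1.1 - k.1.2)) := by
      intro k
      obtain ⟨⟨x, y⟩, hk⟩ := k
      set k : K := ⟨(x, y), hk⟩ with hk_def
      obtain ⟨M, hM⟩ := (isCompact_Icc (a := (0 : ℝ)) (b := b)).exists_bound_of_continuousOn
        (f := fun t => (α t (x, y), β t (x, y)))
        (Continuous.continuousOn (by fun_prop))
      let F : ℝ → ℝ × ℝ := fun t =>
        (P t x - P t y - p t k * (x - y), Q t x - Q t y - q t k * (x - y))
      let F' : ℝ → ℝ × ℝ := fun t => ((F t).2 - α t (x, y) * (F t).1, -(β t (x, y) * (F t).1))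
      have hpk : Continuous fun t => p t k := hpc.comp (continuous_id.prodMk continuous_const)
      have hqk : Continuous fun t => q t k := hqc.comp (continuous_id.prodMk continuous_const)
      have hz := eq_zero_of_norm_deriv_le (f := F) (f' := F') (K := 1 + M) (b := b) ?_ ?_ ?_ ?_
      · intro t ht
        have := hz t ht
        have h1 : P t x - P t y - p t k * (x - y) = 0 := congrArg Prod.fst this
        have h2 : Q t x - Q t y - q t k * (x - y) = 0 := congrArg Prod.snd this
        exact ⟨by linarith, by linarith⟩
      · exact (((hPc x).sub (hPc y)).sub (by fun_prop)).prodMk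
          (((hQc x).sub (hQc y)).sub (by fun_prop))
      · intro t ht
        have h1 := (hP t ht x y).sub (((hpq t (Ioo_subset_Icc_self ht) k).1).mul_const (x - y))
        have h2 := (hQ t ht x y).sub (((hpq t (Ioo_subset_Icc_self ht) k).2).mul_const (x - y))
        refine (h1.prodMk h2).congr_deriv ?_
        simp only [F', F, hk_def]
        ext <;> simp <;> ring
      · intro t ht
        have h3 := norm_prod_le_iff.1 (hM t (Ioo_subset_Icc_self ht))
        have h1 := norm_fst_le (F t)
        have h2 := norm_snd_le (F t)
        have hM0 : 0 ≤ M := (norm_nonneg _).trans h3.1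
        have h4 : ‖α t (x, y) * (F t).1‖ ≤ M * ‖F t‖ := by
          rw [norm_mul]; gcongr; exact h3.1
        have h5 : ‖β t (x, y) * (F t).1‖ ≤ M * ‖F t‖ := by
          rw [norm_mul]; gcongr; exact h3.2
        refine norm_prod_le_iff.2 ⟨(norm_sub_le _ _).trans ?_, ?_⟩
        · linarith
        · simp only [F', norm_neg]; nlinarith [norm_nonneg (F t)]
      · simp only [F, hp0, hq0, hk_def, hP0', hQ0', sub_self]
        rfl
    have hmem : ∀ {x}, x ∈ Ioo (-R) R → (x, x) ∈ K := fun hx =>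
      ⟨Ioo_subset_Icc_self hx, Ioo_subset_Icc_self hx⟩
    classical
    let p' : ℝ → ℝ → ℝ := fun t x => if hx : x ∈ Ioo (-R) R then p t ⟨(x, x), hmem hx⟩ else 0
    let q' : ℝ → ℝ → ℝ := fun t x => if hx : x ∈ Ioo (-R) R then q t ⟨(x, x), hmem hx⟩ else 0
    have hp' : ∀ t x (hx : x ∈ Ioo (-R) R), p' t x = p t ⟨(x, x), hmem hx⟩ :=
      fun t x hx => dif_pos hx
    have hq' : ∀ t x (hx : x ∈ Ioo (-R) R), q' t x = q t ⟨(x, x), hmem hx⟩ :=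
      fun t x hx => dif_pos hx
    have hdiag : Continuous fun z : (univ ×ˢ Ioo (-R) R : Set (ℝ × ℝ)) =>
        ((z.1.1, ⟨(z.1.2, z.1.2), hmem z.2.2⟩) : ℝ × K) := by fun_prop
    -- The slope of f between x and z is exactly g (z, x), which tends to g (x, x) by continuity.
    have hder : ∀ {f : ℝ → ℝ} {g : K → ℝ}, Continuous g →
        (∀ k : K, f k.1.1 - f k.1.2 = g k * (k.1.1 - k.1.2)) → ∀ x (hx : x ∈ Ioo (-R) R),
        HasDerivAt f (g ⟨(x, x), hmem hx⟩) x := by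
      intro f g hg hfg x hx
      rw [hasDerivAt_iff_tendsto_slope]
      have hx' := Ioo_mem_nhds hx.1 hx.2
      have hcont : ContinuousAt (fun z : Ioo (-R) R =>
          g ⟨(z.1, x), ⟨Ioo_subset_Icc_self z.2, Ioo_subset_Icc_self hx⟩⟩) ⟨x, hx⟩ :=
        (hg.comp (by fun_prop)).continuousAt
      have h1 := hcont.tendsto
      rw [nhds_subtype_eq_comap_nhdsWithin] at h1
      have h2 : Tendsto (slope f x) (𝓝[≠] x) (𝓝 (g ⟨(x, x), hmem hx⟩)) := by
        rw [tendsto_iff_eventually]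
        intro S hS
        have h3 := tendsto_iff_eventually.1 h1 hS
        rw [eventually_comap] at h3
        rw [nhdsWithin_eq_nhds.2 hx'] at h3
        filter_upwards [mem_nhdsWithin_of_mem_nhds h3, mem_nhdsWithin_of_mem_nhds hx',
          self_mem_nhdsWithin] with z hz hzR hne
        have := hz ⟨z, hzR⟩ rfl
        rw [slope_def_field, hfg ⟨(z, x), ⟨Ioo_subset_Icc_self hzR, Ioo_subset_Icc_self hx⟩⟩,
          mul_div_cancel_right₀ _ (sub_ne_zero.2 hne)]
        exact this
      exact h2
    refine ⟨p', q', ?_, ?_, ?_, ?_⟩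
    · rw [continuousOn_iff_continuous_domRestrict]
      refine (hpc.comp hdiag).congr fun z => ?_
      exact (hp' z.1.1 z.1.2 z.2.2).symm
    · rw [continuousOn_iff_continuous_domRestrict]
      refine (hqc.comp hdiag).congr fun z => ?_
      exact (hq' z.1.1 z.1.2 z.2.2).symm
    · intro t ht x hx
      rw [hp' t x hx, hq' t x hx]
      exact ⟨hder (hpc.comp (continuous_const.prodMk continuous_id)) (fun k => (hid k t ht).1) x hx,
        hder (hqc.comp (continuous_const.prodMk continuous_id)) (fun k => (hid k t ht).2) x hx⟩
    · intro t ht x hx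
      simp only [hp' _ x hx, hq' _ x hx]
      exact hpq t ht _
  -- Choosing `deriv` avoids patching: it agrees with each local p and q.
  refine ⟨fun t => deriv (P t), fun t => deriv (Q t), ?_, ?_, ?_, ?_⟩
  · rintro ⟨t, x⟩ hz
    obtain ⟨p, q, hpc, hqc, hd, -⟩ := key (|x| + 1)
    have hx : x ∈ Ioo (-(|x| + 1)) (|x| + 1) := by rw [mem_Ioo, ← abs_lt]; linarith
    have hU : (univ ×ˢ Ioo (-(|x| + 1)) (|x| + 1) : Set (ℝ × ℝ)) ∈ 𝓝 (t, x) :=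
      (isOpen_univ.prod isOpen_Ioo).mem_nhds ⟨trivial, hx⟩
    refine ((hpc.continuousAt hU).continuousWithinAt).congr_of_eventuallyEq ?_ ?_
    · filter_upwards [mem_nhdsWithin_of_mem_nhds hU, self_mem_nhdsWithin] with w hw hw'
      exact (hd w.1 hw'.1 w.2 hw.2).1.deriv
    · exact (hd t hz.1 x hx).1.deriv
  · rintro ⟨t, x⟩ hz
    obtain ⟨p, q, hpc, hqc, hd, -⟩ := key (|x| + 1)
    have hx : x ∈ Ioo (-(|x| + 1)) (|x| + 1) := by rw [mem_Ioo, ← abs_lt]; linarith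
    have hU : (univ ×ˢ Ioo (-(|x| + 1)) (|x| + 1) : Set (ℝ × ℝ)) ∈ 𝓝 (t, x) :=
      (isOpen_univ.prod isOpen_Ioo).mem_nhds ⟨trivial, hx⟩
    refine ((hqc.continuousAt hU).continuousWithinAt).congr_of_eventuallyEq ?_ ?_
    · filter_upwards [mem_nhdsWithin_of_mem_nhds hU, self_mem_nhdsWithin] with w hw hw'
      exact (hd w.1 hw'.1 w.2 hw.2).2.deriv
    · exact (hd t hz.1 x hx).2.deriv
  · intro t ht x
    obtain ⟨p, q, hpc, hqc, hd, -⟩ := key (|x| + 1)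
    have hx : x ∈ Ioo (-(|x| + 1)) (|x| + 1) := by rw [mem_Ioo, ← abs_lt]; linarith
    exact ⟨(hd t ht x hx).1.differentiableAt.hasDerivAt, (hd t ht x hx).2.differentiableAt.hasDerivAt⟩
  · intro t ht x
    obtain ⟨p, q, hpc, hqc, hd, he⟩ := key (|x| + 1)
    have hx : x ∈ Ioo (-(|x| + 1)) (|x| + 1) := by rw [mem_Ioo, ← abs_lt]; linarith
    have ht' := Ioo_subset_Icc_self ht
    have hn := Ioo_mem_nhds ht.1 ht.2
    simp only
    rw [(hd t ht' x hx).1.deriv, (hd t ht' x hx).2.deriv]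
    refine ⟨(he t ht' x hx).1.congr_of_eventuallyEq ?_, (he t ht' x hx).2.congr_of_eventuallyEq ?_⟩
    · filter_upwards [hn] with s hs using (hd s (Ioo_subset_Icc_self hs) x hx).1.deriv
    · filter_upwards [hn] with s hs using (hd s (Ioo_subset_Icc_self hs) x hx).2.deriv

end Linear

/-! ### Composition of rough functions with antilipschitz maps -/

section Composition

/-- Lebesgue measure on the line is one-dimensional Hausdorff measure, for which antilipschitz maps
control preimages. -/
theorem volume_preimage_le {K : ℝ≥0} {S : ℝ → ℝ} (hS : AntilipschitzWith K S) (s : Set ℝ) :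
    volume (S ⁻¹' s) ≤ K * volume s := by
  have := hS.hausdorffMeasure_preimage_le zero_le_one s
  simpa [hausdorffMeasure_real] using this

/-- This gives K''(z - X y) a meaning for almost every label y, although K'' exists only almost
everywhere. -/
theorem ae_comp_of_antilipschitz {K : ℝ≥0} {S : ℝ → ℝ} (hS : AntilipschitzWith K S) {p : ℝ → Prop}
    (hp : ∀ᵐ x, p x) : ∀ᵐ y, p (S y) := by
  have h := volume_preimage_le hS {x | ¬ p x}
  rw [ae_iff] at hp ⊢
  rw [hp, mul_zero] at h
  exact le_antisymm h bot_le

theorem map_le_of_antilipschitz {K : ℝ≥0} {S : ℝ → ℝ} (hS : AntilipschitzWith K S)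
    (hSm : Measurable S) : Measure.map S volume ≤ (K : ENNReal) • volume := by
  rw [Measure.le_iff]
  intro s hs
  rw [Measure.map_apply hSm hs]
  exact volume_preimage_le hS s

theorem integrable_comp_of_antilipschitz {K : ℝ≥0} {S : ℝ → ℝ} (hS : AntilipschitzWith K S)
    (hSm : Measurable S) {f : ℝ → ℝ} (hf : Integrable f) : Integrable fun y => f (S y) := by
  have h1 : Integrable f (Measure.map S volume) :=
    (hf.smul_measure ENNReal.coe_ne_top).mono_measure (map_le_of_antilipschitz hS hSm)
  exact h1.comp_measurable hSm

theorem integral_norm_comp_le {K : ℝ≥0} {S : ℝ → ℝ} (hS : AntilipschitzWith K S)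
    (hSm : Measurable S) {f : ℝ → ℝ} (hf : Integrable f) :
    ∫ y, ‖f (S y)‖ ≤ K * ∫ x, ‖f x‖ := by
  have h2 : Integrable f ((K : ENNReal) • volume) := hf.smul_measure ENNReal.coe_ne_top
  have h1 : Integrable f (Measure.map S volume) :=
    h2.mono_measure (map_le_of_antilipschitz hS hSm)
  have h3 := integral_mono_measure (map_le_of_antilipschitz hS hSm)
    (Eventually.of_forall fun x => norm_nonneg (f x)) h2.norm
  rw [integral_map hSm.aemeasurable h1.norm.aestronglyMeasurable, integral_smul_measure] at h3
  simpa using h3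

theorem norm_integral_mul_le {f g : ℝ → ℝ} {M : ℝ} (hM : ∀ x, ‖f x‖ ≤ M) (hg : Integrable g) :
    ‖∫ x, f x * g x‖ ≤ M * ∫ x, ‖g x‖ := by
  rw [← integral_const_mul]
  refine norm_integral_le_of_norm_le (hg.norm.const_mul M) (Eventually.of_forall fun x => ?_)
  rw [norm_mul]
  exact mul_le_mul_of_nonneg_right (hM x) (norm_nonneg _)

theorem integrable_bdd_mul {f g : ℝ → ℝ} {M : ℝ} (hf : AEStronglyMeasurable f volume)
    (hM : ∀ x, ‖f x‖ ≤ M) (hg : Integrable g) : Integrable fun x => f x * g x :=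
  hg.bdd_mul hf (Eventually.of_forall hM)

variable {Z : Type*} [TopologicalSpace Z] [FirstCountableTopology Z]

/-- Replace g by a continuous compactly supported h close to it in L¹. The antilipschitz bound makes
the error uniform in z, and for h dominated convergence applies. -/
theorem continuous_integral_comp_mul_of_bdd {K : ℝ≥0} {S : Z → ℝ → ℝ}
    (hS : ∀ z, AntilipschitzWith K (S z)) (hSc : ∀ z, Continuous (S z))
    (hSz : ∀ y, Continuous fun z => S z y) {g w : ℝ → ℝ} (hg : Integrable g)
    (hw : Integrable w) {R : ℝ} (hR : ∀ y, ‖w y‖ ≤ R) :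
    Continuous fun z => ∫ y, g (S z y) * w y := by
  have hR0 : 0 ≤ R := (norm_nonneg _).trans (hR 0)
  have happ : ∀ ε > 0, ∃ h : ℝ → ℝ, Continuous h ∧ (∃ M, ∀ x, ‖h x‖ ≤ M) ∧ Integrable h ∧
      ∀ z, ‖(∫ y, g (S z y) * w y) - ∫ y, h (S z y) * w y‖ ≤ ε := by
    intro ε hε
    obtain ⟨h, hcs, hgh, hc, hint⟩ :=
      hg.exists_hasCompactSupport_integral_sub_le (ε := ε / (R * K + 1)) (by positivity)
    refine ⟨h, hc, hc.bounded_above_of_compact_support hcs, hint, fun z => ?_⟩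
    have i0 := (integrable_comp_of_antilipschitz (hS z) (hSc z).measurable (hg.sub hint))
    have i1 : ∀ f : ℝ → ℝ, Integrable f → Integrable fun y => f (S z y) * w y := fun f hf =>
      (integrable_comp_of_antilipschitz (hS z) (hSc z).measurable hf).mul_bdd (c := R)
        hw.aestronglyMeasurable (Eventually.of_forall hR)
    rw [← integral_sub (i1 g hg) (i1 h hint)]
    have e : ∀ y, g (S z y) * w y - h (S z y) * w y = w y * (g - h) (S z y) := fun y => by
      simp; ring
    simp_rw [e]
    refine (norm_integral_mul_le hR i0).trans ?_
    have h2 := integral_norm_comp_le (hS z) (hSc z).measurable (hg.sub hint)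
    calc R * ∫ y, ‖(g - h) (S z y)‖ ≤ R * (K * (ε / (R * K + 1))) := by
          gcongr
          exact h2.trans (by gcongr; exact hgh)
      _ = (R * K) / (R * K + 1) * ε := by ring
      _ ≤ 1 * ε := by
          gcongr
          rw [div_le_one (by positivity)]
          linarith
      _ = ε := one_mul ε
  rw [continuous_iff_continuousAt]
  intro z₀
  rw [ContinuousAt, Metric.tendsto_nhds]
  intro ε hε
  obtain ⟨h, hc, ⟨M, hM⟩, hint, hle⟩ := happ (ε / 3) (by positivity)
  have hcont : Continuous fun z => ∫ y, h (S z y) * w y := by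
    refine continuous_of_dominated (bound := fun y => M * ‖w y‖) ?_ ?_ (hw.norm.const_mul M) ?_
    · exact fun z => ((hc.comp (hSc z)).aestronglyMeasurable).mul hw.aestronglyMeasurable
    · refine fun z => Eventually.of_forall fun y => ?_
      rw [norm_mul]
      exact mul_le_mul_of_nonneg_right (hM _) (norm_nonneg _)
    · exact Eventually.of_forall fun y => (hc.comp (hSz y)).mul continuous_const
  filter_upwards [Metric.tendsto_nhds.1 hcont.continuousAt.tendsto (ε / 3) (by positivity)] with z hz
  have h1 := hle z
  have h2 := hle z₀
  rw [dist_eq_norm] at hz ⊢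
  calc ‖(∫ y, g (S z y) * w y) - ∫ y, g (S z₀ y) * w y‖
      = ‖((∫ y, g (S z y) * w y) - ∫ y, h (S z y) * w y)
        + ((∫ y, h (S z y) * w y) - ∫ y, h (S z₀ y) * w y)
        - ((∫ y, g (S z₀ y) * w y) - ∫ y, h (S z₀ y) * w y)‖ := by congr 1; ring
    _ ≤ _ := norm_sub_le _ _
    _ < ε := by
      have := norm_add_le ((∫ y, g (S z y) * w y) - ∫ y, h (S z y) * w y)
        ((∫ y, h (S z y) * w y) - ∫ y, h (S z₀ y) * w y)
      linarith

/-- Here φ is only bounded and measurable, hence not integrable. Replacing the weight by a compactly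
supported v confines S z y to a fixed interval, where φ can be truncated to an integrable function.
-/
theorem continuous_integral_comp_mul {K L : ℝ≥0} {S : Z → ℝ → ℝ}
    (hS : ∀ z, AntilipschitzWith K (S z)) (hSL : ∀ z, LipschitzWith L (S z))
    (hSz : ∀ y, Continuous fun z => S z y) {φ : ℝ → ℝ} (hφ : Measurable φ) {M : ℝ}
    (hM : ∀ x, ‖φ x‖ ≤ M) {w : Z → ℝ → ℝ} (hw : ∀ z, Integrable (w z))
    (hwc : ∀ z₀, Tendsto (fun z => ∫ y, ‖w z y - w z₀ y‖) (𝓝 z₀) (𝓝 0)) :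
    Continuous fun z => ∫ y, φ (S z y) * w z y := by
  have hM0 : 0 ≤ M := (norm_nonneg _).trans (hM 0)
  have hφS : ∀ z, AEStronglyMeasurable (fun y => φ (S z y)) volume := fun z =>
    (hφ.comp (hSL z).continuous.measurable).aestronglyMeasurable
  rw [continuous_iff_continuousAt]
  intro z₀
  rw [ContinuousAt, Metric.tendsto_nhds]
  intro ε hε
  obtain ⟨v, hcs, hwv, hvc, hvi⟩ :=
    (hw z₀).exists_hasCompactSupport_integral_sub_le (ε := ε / (6 * (M + 1))) (by positivity)
  obtain ⟨R, hR⟩ := hvc.bounded_above_of_compact_support hcs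
  obtain ⟨N, hN⟩ := hcs.isCompact.isBounded.exists_norm_le
  -- For z near z₀ the map S z sends the support of v into [-B, B]: 1 allows for the motion of S z
  -- 0, and L N for the distance of y from 0.
  set B : ℝ := |S z₀ 0| + 1 + L * N with hB
  let g : ℝ → ℝ := (Icc (-B) B).indicator φ
  have hg : Integrable g := by
    refine (integrable_indicator_iff measurableSet_Icc).2 ?_
    exact Integrable.of_bound hφ.aestronglyMeasurable M (Eventually.of_forall hM)
  have hgc := continuous_integral_comp_mul_of_bdd hS (fun z => (hSL z).continuous) hSz hg hvi hR
  have hloc : ∀ᶠ z in 𝓝 z₀, ∫ y, g (S z y) * v y = ∫ y, φ (S z y) * v y := by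
    have h1 : ∀ᶠ z in 𝓝 z₀, dist (S z 0) (S z₀ 0) < 1 :=
      Metric.tendsto_nhds.1 (hSz 0).continuousAt.tendsto 1 one_pos
    filter_upwards [h1] with z hz
    refine integral_congr_ae (Eventually.of_forall fun y => ?_)
    by_cases hy : y ∈ tsupport v
    · have h2 : |S z y| ≤ B := by
        have h3 := (hSL z).norm_sub_le y 0
        have h4 := hN y hy
        rw [sub_zero] at h3
        rw [Real.norm_eq_abs] at h3
        rw [Real.dist_eq] at hz
        have h5 : |S z y| ≤ |S z y - S z 0| + |S z 0 - S z₀ 0| + |S z₀ 0| := by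
          have := abs_add_three (S z y - S z 0) (S z 0 - S z₀ 0) (S z₀ 0)
          simpa using this
        have h6 : (L : ℝ) * ‖y‖ ≤ L * N := by gcongr
        rw [hB]
        linarith
      simp only [g]
      have h2' : S z y ∈ Icc (-B) B := abs_le.1 h2
      rw [indicator_of_mem h2']
    · simp [image_eq_zero_of_notMem_tsupport hy]
  have hd : ∀ z, ‖(∫ y, φ (S z y) * w z y) - ∫ y, φ (S z y) * v y‖ ≤
      M * ((∫ y, ‖w z y - w z₀ y‖) + ε / (6 * (M + 1))) := by
    intro z
    rw [← integral_sub (integrable_bdd_mul (hφS z) (fun _ => hM _) (hw z))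
      (integrable_bdd_mul (hφS z) (fun _ => hM _) hvi)]
    simp_rw [← mul_sub]
    refine (norm_integral_mul_le (fun _ => hM _) ((hw z).sub hvi)).trans ?_
    gcongr
    calc ∫ y, ‖w z y - v y‖ ≤ ∫ y, (‖w z y - w z₀ y‖ + ‖w z₀ y - v y‖) := by
          refine integral_mono ((hw z).sub hvi).norm
            ((((hw z).sub (hw z₀)).norm).add ((hw z₀).sub hvi).norm) fun y => ?_
          have := norm_add_le (w z y - w z₀ y) (w z₀ y - v y)
          simpa using this
      _ ≤ _ := by
          rw [integral_add (f := fun y => ‖w z y - w z₀ y‖) (g := fun y => ‖w z₀ y - v y‖)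
            ((hw z).sub (hw z₀)).norm ((hw z₀).sub hvi).norm]
          gcongr
  have hsmall : M * (ε / (6 * (M + 1))) ≤ ε / 6 := by
    rw [mul_div_assoc', div_le_div_iff₀ (by positivity) (by positivity)]
    nlinarith
  have hw' := Metric.tendsto_nhds.1 (hwc z₀) (ε / (6 * (M + 1))) (by positivity)
  filter_upwards [hloc, Metric.tendsto_nhds.1 hgc.continuousAt.tendsto (ε / 3) (by positivity), hw']
    with z hz1 hz2 hz3
  rw [hz1, hloc.self_of_nhds] at hz2
  rw [dist_zero_right, Real.norm_of_nonneg (integral_nonneg fun _ => norm_nonneg _)] at hz3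
  have h1 := hd z
  have h2 := hd z₀
  simp only [sub_self, norm_zero, integral_zero, zero_add] at h2
  rw [dist_eq_norm] at hz2 ⊢
  have h3 : M * ((∫ y, ‖w z y - w z₀ y‖) + ε / (6 * (M + 1))) ≤ ε / 3 := by
    calc _ ≤ M * (ε / (6 * (M + 1)) + ε / (6 * (M + 1))) := by gcongr
      _ ≤ ε / 3 := by linarith
  calc ‖(∫ y, φ (S z y) * w z y) - ∫ y, φ (S z₀ y) * w z₀ y‖
      = ‖((∫ y, φ (S z y) * w z y) - ∫ y, φ (S z y) * v y)
        + ((∫ y, φ (S z y) * v y) - ∫ y, φ (S z₀ y) * v y)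
        - ((∫ y, φ (S z₀ y) * w z₀ y) - ∫ y, φ (S z₀ y) * v y)‖ := by congr 1; ring
    _ ≤ _ := norm_sub_le _ _
    _ < ε := by
      have := norm_add_le ((∫ y, φ (S z y) * w z y) - ∫ y, φ (S z y) * v y)
        ((∫ y, φ (S z y) * v y) - ∫ y, φ (S z₀ y) * v y)
      linarith

/-- Differentiation under the integral sign for a function that is only Lipschitz: the labels y at
which Φ fails to be differentiable at z - X y form a null set, and the Lipschitz constant dominates.
-/
theorem hasDerivAt_integral_shift {K L : ℝ≥0} {Φ X w c : ℝ → ℝ} (hΦ : LipschitzWith L Φ)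
    (hX : AntilipschitzWith K X) (hXc : Continuous X) (hw : Integrable w)
    (hi : ∀ z, Integrable fun y => (Φ (z - X y) - c y) * w y) (z : ℝ) :
    HasDerivAt (fun z => ∫ y, (Φ (z - X y) - c y) * w y) (∫ y, deriv Φ (z - X y) * w y) z := by
  have hanti : AntilipschitzWith K fun y => z - X y := by
    refine AntilipschitzWith.of_le_mul_dist fun x y => ?_
    have := hX.le_mul_dist x y
    rwa [Real.dist_eq, Real.dist_eq, sub_sub_sub_cancel_left, abs_sub_comm (X y), ← Real.dist_eq,
      ← Real.dist_eq]
  refine (hasDerivAt_integral_of_dominated_loc_of_lip (s := univ) (bound := fun y => L * ‖w y‖)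
    univ_mem (Eventually.of_forall fun z => (hi z).aestronglyMeasurable) (hi z) ?_ ?_
    (hw.norm.const_mul _) ?_).2
  · exact ((measurable_deriv Φ).comp (measurable_const.sub hXc.measurable)).aestronglyMeasurable.mul
      hw.aestronglyMeasurable
  · refine Eventually.of_forall fun y => ?_
    rw [lipschitzOnWith_univ]
    refine LipschitzWith.of_dist_le_mul fun a b => ?_
    rw [Real.dist_eq, Real.dist_eq, ← sub_mul, abs_mul]
    have h1 := hΦ.dist_le_mul (a - X y) (b - X y)
    rw [Real.dist_eq, Real.dist_eq, sub_sub_sub_cancel_right] at h1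
    rw [sub_sub_sub_cancel_right, Real.norm_eq_abs, Real.coe_nnabs,
      abs_of_nonneg (by positivity : 0 ≤ (L : ℝ) * |w y|)]
    nlinarith [abs_nonneg (w y)]
  · filter_upwards [ae_comp_of_antilipschitz hanti hΦ.ae_differentiableAt] with y hy
    have h1 : HasDerivAt (fun z => z - X y) 1 z := (hasDerivAt_id z).sub_const _
    have h2 := (((hy.hasDerivAt).comp z h1).sub_const (c y)).mul_const (w y)
    simpa using h2

end Composition

/-! ### Standing assumptions and nonlocal potentials -/

/-- The standing assumptions in Lagrangian form: `Ψ` is a primitive of the influence function `ψ`,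
`k` is the interaction force, and `θ` is a weight, integrable against `ρ₀`, which dominates the
initial velocity and the initial force. -/
structure Data (L : ℝ≥0) (ψ Ψ k ρ₀ u₀ θ : ℝ → ℝ) : Prop where
  hasDerivAt_Ψ : ∀ z, HasDerivAt Ψ (ψ z) z
  ψ_continuous : Continuous ψ
  ψ_nonneg : ∀ z, 0 ≤ ψ z
  Ψ_lip : LipschitzWith L Ψ
  k_lip : LipschitzWith L k
  ρ_continuous : Continuous ρ₀
  ρ_nonneg : ∀ x, 0 ≤ ρ₀ x
  ρ_bounded : ∃ C, ∀ x, ρ₀ x ≤ C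
  ρ_integrable : Integrable ρ₀
  mass_one : ∫ x, ρ₀ x = 1
  u_contDiff : ContDiff ℝ 1 u₀
  u_lip : LipschitzWith L u₀
  θ_continuous : Continuous θ
  one_le_θ : ∀ x, 1 ≤ θ x
  θ_integrable : Integrable fun x => θ x * ρ₀ x
  k_integrable : Integrable fun y => k (-y) * ρ₀ y
  u_le : ∀ x, |u₀ x| ≤ θ x
  k_le : ∀ x, |∫ y, k (x - y) * ρ₀ y| ≤ θ x

/-- `Φ ⋆ X_# ρ₀`, normalized by subtracting the value of `Φ ⋆ ρ₀` at the origin, so that it is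
finite for every Lipschitz function `Φ`. -/
noncomputable def pot (Φ ρ₀ X : ℝ → ℝ) (z : ℝ) : ℝ := ∫ y, (Φ (z - X y) - Φ (-y)) * ρ₀ y

/-- The map `X` is at a bounded distance from the identity, relative to the weight `θ`. -/
def NearId (θ X : ℝ → ℝ) : Prop := Continuous X ∧ ∃ C, ∀ y, |X y - y| ≤ C * θ y

section Pot

variable {L : ℝ≥0} {ψ Ψ k ρ₀ u₀ θ : ℝ → ℝ}

theorem Data.θ_pos (h : Data L ψ Ψ k ρ₀ u₀ θ) (x : ℝ) : 0 < θ x := one_pos.trans_le (h.one_le_θ x)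

theorem nearId_id (θ : ℝ → ℝ) : NearId θ id :=
  ⟨continuous_id, 0, fun y => by simp⟩

theorem Data.integrable_of_le (h : Data L ψ Ψ k ρ₀ u₀ θ) {f : ℝ → ℝ}
    (hf : AEStronglyMeasurable f volume) {C : ℝ} (hC : ∀ y, |f y| ≤ C * θ y) :
    Integrable fun y => f y * ρ₀ y := by
  refine (h.θ_integrable.const_mul C).mono' (hf.mul h.ρ_continuous.aestronglyMeasurable)
    (Eventually.of_forall fun y => ?_)
  rw [Real.norm_eq_abs, abs_mul, abs_of_nonneg (h.ρ_nonneg y), ← mul_assoc]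
  exact mul_le_mul_of_nonneg_right (hC y) (h.ρ_nonneg y)

theorem Data.pot_integrable (h : Data L ψ Ψ k ρ₀ u₀ θ) {Φ X : ℝ → ℝ} (hΦ : LipschitzWith L Φ)
    (hX : NearId θ X) (z : ℝ) : Integrable fun y => (Φ (z - X y) - Φ (-y)) * ρ₀ y := by
  obtain ⟨hc, C, hC⟩ := hX
  refine h.integrable_of_le (C := L * (|z| + C)) ?_ fun y => ?_
  · exact ((hΦ.continuous.comp (continuous_const.sub hc)).sub
      (hΦ.continuous.comp continuous_neg)).aestronglyMeasurable
  · have h1 := hΦ.dist_le_mul (z - X y) (-y)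
    rw [Real.dist_eq, Real.dist_eq] at h1
    have h2 : |z - X y - -y| ≤ |z| + |X y - y| := by
      rw [show z - X y - -y = z - (X y - y) by ring]
      exact abs_sub _ _
    have h3 : |z| ≤ |z| * θ y := le_mul_of_one_le_right (abs_nonneg _) (h.one_le_θ y)
    calc _ ≤ L * |z - X y - -y| := h1
      _ ≤ L * (|z| * θ y + C * θ y) := by
        gcongr
        linarith [hC y]
      _ = _ := by ring

/-- The normalizing term Φ(-y) cancels in the difference, and ρ₀ has mass one. -/
theorem Data.pot_sub_le (h : Data L ψ Ψ k ρ₀ u₀ θ) {Φ X X' : ℝ → ℝ} (hΦ : LipschitzWith L Φ)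
    (hX : NearId θ X) (hX' : NearId θ X') (z z' : ℝ) :
    |pot Φ ρ₀ X z - pot Φ ρ₀ X' z'| ≤ L * (|z - z'| + ∫ y, |X y - X' y| * ρ₀ y) := by
  have hi : Integrable fun y => |X y - X' y| * ρ₀ y := by
    obtain ⟨hc, C, hC⟩ := hX
    obtain ⟨hc', C', hC'⟩ := hX'
    refine h.integrable_of_le (C := C + C') (hc.sub hc').abs.aestronglyMeasurable fun y => ?_
    rw [abs_abs]
    have := abs_sub_le (X y) y (X' y)
    rw [abs_sub_comm y] at this
    linarith [hC y, hC' y]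
  unfold pot
  rw [← integral_sub (h.pot_integrable hΦ hX z) (h.pot_integrable hΦ hX' z')]
  have hr : L * (|z - z'| + ∫ y, |X y - X' y| * ρ₀ y)
      = ∫ y, L * (|z - z'| * ρ₀ y + |X y - X' y| * ρ₀ y) := by
    rw [integral_const_mul, integral_add (h.ρ_integrable.const_mul _) hi, integral_const_mul,
      h.mass_one, mul_one]
  rw [hr, ← Real.norm_eq_abs]
  refine norm_integral_le_of_norm_le (((h.ρ_integrable.const_mul _).add hi).const_mul _)
    (Eventually.of_forall fun y => ?_)
  have e : (Φ (z - X y) - Φ (-y)) * ρ₀ y - (Φ (z' - X' y) - Φ (-y)) * ρ₀ y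
      = (Φ (z - X y) - Φ (z' - X' y)) * ρ₀ y := by ring
  rw [e, norm_mul, Real.norm_of_nonneg (h.ρ_nonneg y), ← add_mul, ← mul_assoc]
  refine mul_le_mul_of_nonneg_right ?_ (h.ρ_nonneg y)
  refine (hΦ.norm_sub_le _ _).trans ?_
  gcongr
  rw [Real.norm_eq_abs, show z - X y - (z' - X' y) = (z - z') - (X y - X' y) by ring]
  exact abs_sub _ _

theorem Data.pot_lipschitz (h : Data L ψ Ψ k ρ₀ u₀ θ) {Φ X : ℝ → ℝ} (hΦ : LipschitzWith L Φ)
    (hX : NearId θ X) (z z' : ℝ) : |pot Φ ρ₀ X z - pot Φ ρ₀ X z'| ≤ L * |z - z'| := by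
  simpa using h.pot_sub_le hΦ hX hX z z'

theorem Data.pot_continuous (h : Data L ψ Ψ k ρ₀ u₀ θ) {Φ X : ℝ → ℝ} (hΦ : LipschitzWith L Φ)
    (hX : NearId θ X) : Continuous (pot Φ ρ₀ X) :=
  (LipschitzWith.of_dist_le_mul (K := L) fun z z' => h.pot_lipschitz hΦ hX z z').continuous

theorem Data.integral_θ_nonneg (h : Data L ψ Ψ k ρ₀ u₀ θ) : 0 ≤ ∫ y, θ y * ρ₀ y :=
  integral_nonneg fun y => mul_nonneg (h.θ_pos y).le (h.ρ_nonneg y)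

theorem Data.integral_le_of_le (h : Data L ψ Ψ k ρ₀ u₀ θ) {X X' : ℝ → ℝ} {D : ℝ}
    (hD : ∀ y, |X y - X' y| ≤ D * θ y) :
    ∫ y, |X y - X' y| * ρ₀ y ≤ D * ∫ y, θ y * ρ₀ y := by
  rw [← integral_const_mul]
  refine integral_mono_of_nonneg (Eventually.of_forall fun y => ?_) (h.θ_integrable.const_mul D)
    (Eventually.of_forall fun y => ?_)
  · exact mul_nonneg (abs_nonneg _) (h.ρ_nonneg y)
  · simp only
    rw [← mul_assoc]
    exact mul_le_mul_of_nonneg_right (hD y) (h.ρ_nonneg y)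

/-- The Lipschitz estimate behind global existence and uniqueness: in the norm with weight 1/θ, the
map X ↦ pot(X) ∘ X is globally Lipschitz, because ∫ θ ρ₀ is finite and 1 ≤ θ. -/
theorem Data.pot_comp_sub_le (h : Data L ψ Ψ k ρ₀ u₀ θ) {Φ X X' : ℝ → ℝ} (hΦ : LipschitzWith L Φ)
    (hX : NearId θ X) (hX' : NearId θ X') {D : ℝ} (hD : ∀ y, |X y - X' y| ≤ D * θ y) (x : ℝ) :
    |pot Φ ρ₀ X (X x) - pot Φ ρ₀ X' (X' x)| ≤ L * (1 + ∫ y, θ y * ρ₀ y) * D * θ x := by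
  have hD0 : 0 ≤ D := by
    have h1 := (abs_nonneg _).trans (hD 0)
    exact nonneg_of_mul_nonneg_left h1 (h.θ_pos 0)
  refine (h.pot_sub_le hΦ hX hX' _ _).trans ?_
  calc _ ≤ L * (D * θ x + D * ∫ y, θ y * ρ₀ y) := by
        gcongr
        · exact hD x
        · exact h.integral_le_of_le hD
    _ ≤ L * (D * θ x + (D * ∫ y, θ y * ρ₀ y) * θ x) := by
        have := le_mul_of_one_le_right (mul_nonneg hD0 h.integral_θ_nonneg) (h.one_le_θ x)
        exact mul_le_mul_of_nonneg_left (by linarith) L.coe_nonneg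
    _ = _ := by ring

theorem Data.force_integrable (h : Data L ψ Ψ k ρ₀ u₀ θ) {X : ℝ → ℝ} (hX : NearId θ X) (z : ℝ) :
    Integrable fun y => k (z - X y) * ρ₀ y := by
  refine ((h.pot_integrable h.k_lip hX z).add h.k_integrable).congr
    (Eventually.of_forall fun y => ?_)
  simp only [Pi.add_apply]
  ring

theorem Data.force_eq (h : Data L ψ Ψ k ρ₀ u₀ θ) {X : ℝ → ℝ} (hX : NearId θ X) (z : ℝ) :
    ∫ y, k (z - X y) * ρ₀ y = pot k ρ₀ X z + ∫ y, k (-y) * ρ₀ y := by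
  rw [pot, ← integral_add (h.pot_integrable h.k_lip hX z) h.k_integrable]
  refine integral_congr_ae (Eventually.of_forall fun y => ?_)
  simp only
  ring

end Pot

/-- The Lagrangian flow: `X t x` is the position at time `t` of the particle which starts at `x`,
and `G t x - Ψ ⋆ ρ` is its velocity. -/
structure IsFlow (Ψ k ρ₀ u₀ θ : ℝ → ℝ) (X G : ℝ → ℝ → ℝ) : Prop where
  X_zero : ∀ x, X 0 x = x
  G_zero : ∀ x, G 0 x = u₀ x + pot Ψ ρ₀ id x
  hasDerivAt_X : ∀ t x, HasDerivAt (fun s => X s x) (G t x - pot Ψ ρ₀ (X t) (X t x)) t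
  hasDerivAt_G : ∀ t x, HasDerivAt (fun s => G s x) (-∫ y, k (X t x - X t y) * ρ₀ y) t
  bound : ∀ b, ∃ C, ∀ t ∈ Icc 0 b, ∀ x, |X t x - x| ≤ C * θ x ∧ |G t x - G 0 x| ≤ C * θ x
  continuous_X : Continuous fun p : ℝ × ℝ => X p.1 p.2
  continuous_G : Continuous fun p : ℝ × ℝ => G p.1 p.2
  nearId : ∀ t, NearId θ (X t)

/-! ### Global existence of the Lagrangian flow -/

section Existence

variable {L : ℝ≥0} {ψ Ψ k ρ₀ u₀ θ : ℝ → ℝ}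

-- With X = id + θ a and G = G₀ + θ c, the flow equations become an autonomous equation for (a, c)
-- in a space of bounded continuous functions. Its right side is globally Lipschitz, so there is no
-- obstruction to solving for all times.
open BoundedContinuousFunction in
theorem Data.exists_flow (h : Data L ψ Ψ k ρ₀ u₀ θ) : ∃ X G, IsFlow Ψ k ρ₀ u₀ θ X G := by
  set m := ∫ y, θ y * ρ₀ y with hm
  have hm0 : 0 ≤ m := h.integral_θ_nonneg
  let Xa : BoundedContinuousFunction ℝ ℝ → ℝ → ℝ := fun a x => x + θ x * a x
  have hsub : ∀ a a' y, |Xa a y - Xa a' y| ≤ ‖a - a'‖ * θ y := by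
    intro a a' y
    have h1 := (a - a').norm_coe_le_norm y
    have e : Xa a y - Xa a' y = θ y * (a - a') y := by simp [Xa]; ring
    rw [e, abs_mul, abs_of_pos (h.θ_pos y), mul_comm]
    exact mul_le_mul_of_nonneg_right h1 (h.θ_pos y).le
  have hXa0 : Xa 0 = id := by funext x; simp [Xa]
  have hnear : ∀ a, NearId θ (Xa a) := fun a =>
    ⟨continuous_id.add (h.θ_continuous.mul a.continuous), ‖a‖, fun y => by
      have := hsub a 0 y
      rwa [hXa0, sub_zero, id] at this⟩
  have hθinv : Continuous fun x => (θ x)⁻¹ := h.θ_continuous.inv₀ fun x => (h.θ_pos x).ne'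
  have hdiv : ∀ {c C x : ℝ}, |c| ≤ C * θ x → ‖(θ x)⁻¹ * c‖ ≤ C := by
    intro c C x hc
    rw [norm_mul, norm_inv, Real.norm_of_nonneg (h.θ_pos x).le, inv_mul_le_iff₀ (h.θ_pos x),
      mul_comm]
    exact hc
  -- The nonlinear part is normalized to vanish at a = 0, so that it is bounded. The remainder at a
  -- = 0 is collected in `e₁` and `e₂`, which are bounded by 1 because θ dominates u₀ and the
  -- initial force.
  let N : (Φ : ℝ → ℝ) → LipschitzWith L Φ → BoundedContinuousFunction ℝ ℝ →
      BoundedContinuousFunction ℝ ℝ := fun Φ hΦ a =>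
    BoundedContinuousFunction.ofNormedAddCommGroup
      (fun x => (θ x)⁻¹ * (pot Φ ρ₀ (Xa a) (Xa a x) - pot Φ ρ₀ id x))
      (hθinv.mul (((h.pot_continuous hΦ (hnear a)).comp (hnear a).1).sub
        (h.pot_continuous hΦ (nearId_id θ))))
      (L * (1 + m) * ‖a‖) (fun x => hdiv (by
        have := h.pot_comp_sub_le hΦ (hnear a) (hnear 0) (hsub a 0) x
        rwa [hXa0, sub_zero, id] at this))
  have hN : ∀ Φ hΦ a x, N Φ hΦ a x = (θ x)⁻¹ * (pot Φ ρ₀ (Xa a) (Xa a x) - pot Φ ρ₀ id x) :=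
    fun Φ hΦ a x => rfl
  have hNL : ∀ Φ hΦ a a', ‖N Φ hΦ a - N Φ hΦ a'‖ ≤ L * (1 + m) * ‖a - a'‖ := by
    intro Φ hΦ a a'
    rw [BoundedContinuousFunction.norm_le (by positivity)]
    intro x
    rw [BoundedContinuousFunction.sub_apply, hN Φ hΦ, hN Φ hΦ, ← mul_sub, sub_sub_sub_cancel_right]
    exact hdiv (h.pot_comp_sub_le hΦ (hnear a) (hnear a') (hsub a a') x)
  let e₁ : BoundedContinuousFunction ℝ ℝ := BoundedContinuousFunction.ofNormedAddCommGroup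
    (fun x => (θ x)⁻¹ * u₀ x) (hθinv.mul h.u_contDiff.continuous) 1
    (fun x => hdiv (by rw [one_mul]; exact h.u_le x))
  have hk0 : Continuous fun x => ∫ y, k (x - y) * ρ₀ y := by
    have : ∀ x, ∫ y, k (x - y) * ρ₀ y = pot k ρ₀ id x + ∫ y, k (-y) * ρ₀ y := h.force_eq (nearId_id θ)
    simp_rw [this]
    exact (h.pot_continuous h.k_lip (nearId_id θ)).add continuous_const
  let e₂ : BoundedContinuousFunction ℝ ℝ := BoundedContinuousFunction.ofNormedAddCommGroup
    (fun x => (θ x)⁻¹ * ∫ y, k (x - y) * ρ₀ y) (hθinv.mul hk0) 1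
    (fun x => hdiv (by rw [one_mul]; exact h.k_le x))
  let F : BoundedContinuousFunction ℝ ℝ × BoundedContinuousFunction ℝ ℝ →
      BoundedContinuousFunction ℝ ℝ × BoundedContinuousFunction ℝ ℝ := fun z =>
    (e₁ + z.2 - N Ψ h.Ψ_lip z.1, -(e₂ + N k h.k_lip z.1))
  have hF : LipschitzWith (1 + L * (1 + ⟨m, hm0⟩)) F := by
    refine LipschitzWith.of_dist_le_mul fun z w => ?_
    rw [dist_eq_norm, dist_eq_norm]
    have h1 := norm_fst_le (z - w)
    have h2 := norm_snd_le (z - w)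
    have h3 : ∀ Φ hΦ, ‖N Φ hΦ z.1 - N Φ hΦ w.1‖ ≤ L * (1 + m) * ‖z - w‖ := fun Φ hΦ =>
      (hNL Φ hΦ _ _).trans (by gcongr; exact h1)
    have hc : (((1 + L * (1 + ⟨m, hm0⟩) : ℝ≥0)) : ℝ) = 1 + L * (1 + m) := by push_cast; rfl
    rw [hc, add_mul, one_mul]
    refine norm_prod_le_iff.2 ⟨?_, ?_⟩
    · have e : (F z - F w).1 = (z - w).2 - (N Ψ h.Ψ_lip z.1 - N Ψ h.Ψ_lip w.1) := by
        simp only [F, Prod.fst_sub, Prod.snd_sub]; abel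
      rw [e]
      exact (norm_sub_le _ _).trans (add_le_add h2 (h3 Ψ h.Ψ_lip))
    · have e : (F z - F w).2 = -(N k h.k_lip z.1 - N k h.k_lip w.1) := by
        simp only [F, Prod.snd_sub]; abel
      rw [e, norm_neg]
      exact (h3 k h.k_lip).trans (le_add_of_nonneg_left (norm_nonneg _))
  obtain ⟨γ, hγ0, hγ⟩ := exists_global_solution (f := fun _ => F) (C := ‖F 0‖)
    (hF.continuous.comp continuous_snd) (fun _ => hF) (fun _ => le_rfl) 0
  have hγc : Continuous γ := continuous_iff_continuousAt.2 fun t => (hγ t).continuousAt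
  have hev₁ : ∀ x : ℝ, ∀ t, HasDerivAt (fun s => (γ s).1 x) ((F (γ t)).1 x) t := fun x t =>
    ((BoundedContinuousFunction.evalCLM ℝ x).comp (ContinuousLinearMap.fst ℝ
      (BoundedContinuousFunction ℝ ℝ)
      (BoundedContinuousFunction ℝ ℝ))).hasFDerivAt.comp_hasDerivAt t (hγ t)
  have hev₂ : ∀ x : ℝ, ∀ t, HasDerivAt (fun s => (γ s).2 x) ((F (γ t)).2 x) t := fun x t =>
    ((BoundedContinuousFunction.evalCLM ℝ x).comp (ContinuousLinearMap.snd ℝ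
      (BoundedContinuousFunction ℝ ℝ)
      (BoundedContinuousFunction ℝ ℝ))).hasFDerivAt.comp_hasDerivAt t (hγ t)
  have hevc : Continuous fun p : BoundedContinuousFunction ℝ ℝ × ℝ => p.1 p.2 :=
    continuous_eval
  refine ⟨fun t => Xa (γ t).1, fun t x => u₀ x + pot Ψ ρ₀ id x + θ x * (γ t).2 x,
    ⟨?_, ?_, ?_, ?_, ?_, ?_, ?_, fun t => hnear _⟩⟩
  · intro x
    simp [hγ0, hXa0]
  · intro x
    simp [hγ0]
  · intro t x
    have h1 := ((hev₁ x t).const_mul (θ x)).const_add x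
    refine h1.congr_deriv ?_
    have e : (F (γ t)).1 x = (θ x)⁻¹ * u₀ x + (γ t).2 x
      - (θ x)⁻¹ * (pot Ψ ρ₀ (Xa (γ t).1) (Xa (γ t).1 x) - pot Ψ ρ₀ id x) := rfl
    rw [e]
    have := (h.θ_pos x).ne'
    field_simp
    ring
  · intro t x
    have h1 := ((hev₂ x t).const_mul (θ x)).const_add (u₀ x + pot Ψ ρ₀ id x)
    refine h1.congr_deriv ?_
    have e : (F (γ t)).2 x = -((θ x)⁻¹ * (∫ y, k (x - y) * ρ₀ y)
      + (θ x)⁻¹ * (pot k ρ₀ (Xa (γ t).1) (Xa (γ t).1 x) - pot k ρ₀ id x)) := rfl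
    have e2 : ∫ y, k (x - y) * ρ₀ y = pot k ρ₀ id x + ∫ y, k (-y) * ρ₀ y := h.force_eq (nearId_id θ) x
    rw [e, h.force_eq (hnear _), e2]
    have := (h.θ_pos x).ne'
    field_simp
    ring
  · intro b
    obtain ⟨C, hC⟩ := (isCompact_Icc (a := (0 : ℝ)) (b := b)).exists_bound_of_continuousOn
      hγc.continuousOn
    refine ⟨C, fun t ht x => ?_⟩
    have h1 := norm_prod_le_iff.1 (hC t ht)
    have hθ := h.θ_pos x
    have h2 := ((γ t).1.norm_coe_le_norm x).trans h1.1
    have h3 := ((γ t).2.norm_coe_le_norm x).trans h1.2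
    rw [Real.norm_eq_abs] at h2 h3
    constructor
    · simp only [Xa, add_sub_cancel_left, abs_mul, abs_of_pos hθ]
      rw [mul_comm]
      gcongr
    · simp only [hγ0, Prod.snd_zero, BoundedContinuousFunction.coe_zero, Pi.zero_apply, mul_zero,
        add_zero, add_sub_cancel_left, abs_mul, abs_of_pos hθ]
      rw [mul_comm]
      gcongr
  · exact continuous_snd.add ((h.θ_continuous.comp continuous_snd).mul
      (hevc.comp ((hγc.fst.comp continuous_fst).prodMk continuous_snd)))
  · exact ((h.u_contDiff.continuous.add (h.pot_continuous h.Ψ_lip (nearId_id θ))).comp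
      continuous_snd).add ((h.θ_continuous.comp continuous_snd).mul
      (hevc.comp ((hγc.snd.comp continuous_fst).prodMk continuous_snd)))

end Existence

/-! ### Spatial regularity of the flow -/

/-- `φ ⋆ X_# ρ₀`. -/
noncomputable def pconv (φ ρ₀ X : ℝ → ℝ) (z : ℝ) : ℝ := ∫ y, φ (z - X y) * ρ₀ y

/-- On `[0, b]` the maps `X t` are uniformly expanding up to a positive factor. -/
def Good (X : ℝ → ℝ → ℝ) (b : ℝ) : Prop :=
  ∃ c > 0, ∀ t ∈ Icc 0 b, ∀ x y, y ≤ x → c * (x - y) ≤ X t x - X t y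

section Regularity

variable {L : ℝ≥0} {ψ Ψ k ρ₀ u₀ θ : ℝ → ℝ} {X G : ℝ → ℝ → ℝ}

theorem IsFlow.continuous_X_left (hf : IsFlow Ψ k ρ₀ u₀ θ X G) (x : ℝ) :
    Continuous fun t => X t x := hf.continuous_X.comp (continuous_id.prodMk continuous_const)

theorem IsFlow.continuous_G_left (hf : IsFlow Ψ k ρ₀ u₀ θ X G) (x : ℝ) :
    Continuous fun t => G t x := hf.continuous_G.comp (continuous_id.prodMk continuous_const)

theorem IsFlow.X_zero_eq (hf : IsFlow Ψ k ρ₀ u₀ θ X G) : X 0 = id := funext hf.X_zero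

theorem IsFlow.G_zero_lipschitz (h : Data L ψ Ψ k ρ₀ u₀ θ) (hf : IsFlow Ψ k ρ₀ u₀ θ X G) (x y : ℝ) :
    |G 0 x - G 0 y| ≤ 2 * L * |x - y| := by
  rw [hf.G_zero, hf.G_zero]
  have h1 := h.pot_lipschitz h.Ψ_lip (nearId_id θ) x y
  have h2 := h.u_lip.dist_le_mul x y
  rw [Real.dist_eq, Real.dist_eq] at h2
  rw [add_sub_add_comm]
  refine (abs_add_le _ _).trans ?_
  linarith

/-- Grönwall for the difference of two trajectories. Only the upper bound on separation holds for
all times; the lower bound is `Good`, and it can fail. -/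
theorem IsFlow.lipschitz (h : Data L ψ Ψ k ρ₀ u₀ θ) (hf : IsFlow Ψ k ρ₀ u₀ θ X G) (b : ℝ) :
    ∃ M : ℝ≥0, ∀ t ∈ Icc 0 b, ∀ x y,
      |X t x - X t y| ≤ M * |x - y| ∧ |G t x - G t y| ≤ M * |x - y| := by
  refine ⟨⟨(1 + 2 * L) * Real.exp ((1 + L) * |b|), by positivity⟩, fun t ht x y => ?_⟩
  let F : ℝ → ℝ × ℝ := fun t => (X t x - X t y, G t x - G t y)
  have hFc : Continuous F := ((hf.continuous_X_left x).sub (hf.continuous_X_left y)).prodMk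
    ((hf.continuous_G_left x).sub (hf.continuous_G_left y))
  have hF := norm_le_gronwallBound_of_hasDerivAt (f := F) (K := 1 + L) (ε := 0) (b := b)
    hFc.continuousOn
    (fun t _ => ((hf.hasDerivAt_X t x).sub (hf.hasDerivAt_X t y)).prodMk
      ((hf.hasDerivAt_G t x).sub (hf.hasDerivAt_G t y))) ?_ t ht
  · rw [gronwallBound_ε0] at hF
    have h0 : ‖F 0‖ ≤ (1 + 2 * L) * |x - y| := by
      refine norm_prod_le_iff.2 ⟨?_, ?_⟩
      · simp only [F, hf.X_zero, Real.norm_eq_abs]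
        nlinarith [abs_nonneg (x - y), L.coe_nonneg]
      · refine (hf.G_zero_lipschitz h x y).trans ?_
        nlinarith [abs_nonneg (x - y), L.coe_nonneg]
    have h1 : ‖F t‖ ≤ (1 + 2 * L) * Real.exp ((1 + L) * |b|) * |x - y| := by
      calc ‖F t‖ ≤ ‖F 0‖ * Real.exp ((1 + L) * t) := hF
        _ ≤ ((1 + 2 * L) * |x - y|) * Real.exp ((1 + L) * |b|) := by
          gcongr
          exact ht.2.trans (le_abs_self b)
        _ = _ := by ring
    exact norm_prod_le_iff.1 h1
  · intro t _
    have h1 := h.pot_lipschitz h.Ψ_lip (hf.nearId t) (X t x) (X t y)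
    have h2 := h.pot_lipschitz h.k_lip (hf.nearId t) (X t x) (X t y)
    have h3 : |X t x - X t y| ≤ ‖F t‖ := norm_fst_le (F t)
    have h4 : |G t x - G t y| ≤ ‖F t‖ := norm_snd_le (F t)
    have hL := L.coe_nonneg
    rw [add_zero, add_mul, one_mul]
    refine norm_prod_le_iff.2 ⟨?_, ?_⟩
    · simp only [Real.norm_eq_abs]
      rw [sub_sub_sub_comm]
      refine (abs_sub _ _).trans (add_le_add h4 (h1.trans ?_))
      gcongr
    · simp only [Real.norm_eq_abs]
      rw [h.force_eq (hf.nearId t), h.force_eq (hf.nearId t), neg_sub_neg, add_sub_add_right_eq_sub,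
        abs_sub_comm]
      refine h2.trans ((mul_le_mul_of_nonneg_left h3 hL).trans ?_)
      exact le_add_of_nonneg_left (norm_nonneg _)

theorem Good.mono {b b' : ℝ} (hg : Good X b) (hb : b' ≤ b) : Good X b' := by
  obtain ⟨c, hc, h⟩ := hg
  exact ⟨c, hc, fun t ht => h t ⟨ht.1, ht.2.trans hb⟩⟩

theorem Good.exists_antilipschitz {b : ℝ} (hg : Good X b) :
    ∃ K : ℝ≥0, ∀ t ∈ Icc 0 b, AntilipschitzWith K (X t) := by
  obtain ⟨c, hc, h⟩ := hg
  refine ⟨c⁻¹.toNNReal, fun t ht => AntilipschitzWith.of_le_mul_dist fun x y => ?_⟩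
  have key : ∀ x y, y ≤ x → c * |x - y| ≤ |X t x - X t y| := fun x y hxy => by
    rw [abs_of_nonneg (sub_nonneg.2 hxy)]
    exact (h t ht x y hxy).trans (le_abs_self _)
  rw [Real.dist_eq, Real.dist_eq, Real.coe_toNNReal _ (inv_pos.2 hc).le, ← div_eq_inv_mul, le_div_iff₀ hc,
    mul_comm]
  rcases le_total y x with hxy | hxy
  · exact key x y hxy
  · rw [abs_sub_comm, abs_sub_comm (X t x)]
    exact key y x hxy

/-- `Good` bounds the antilipschitz constants of X uniformly on [0, b]. This gives joint continuity
in (t, z) for merely bounded measurable φ, in particular for K''. -/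
theorem continuous_pconv_mul (h : Data L ψ Ψ k ρ₀ u₀ θ) (hf : IsFlow Ψ k ρ₀ u₀ θ X G) {b : ℝ}
    (hb : 0 ≤ b) (hg : Good X b) {φ : ℝ → ℝ} (hφ : Measurable φ) {M : ℝ} (hM : ∀ x, ‖φ x‖ ≤ M)
    {w : ℝ → ℝ → ℝ} (hw : ∀ t, Integrable (w t))
    (hwc : ∀ t₀, Tendsto (fun t => ∫ y, ‖w t y - w t₀ y‖) (𝓝 t₀) (𝓝 0)) :
    Continuous fun p : ℝ × ℝ => ∫ y, φ (p.2 - X (clamp b p.1) y) * w p.1 y := by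
  obtain ⟨K, hK⟩ := hg.exists_antilipschitz
  obtain ⟨M', hM'⟩ := hf.lipschitz h b
  refine continuous_integral_comp_mul (K := K) (L := M') (fun p => ?_) (fun p => ?_) (fun y => ?_)
    hφ hM (fun p => hw p.1) (fun p₀ => (hwc p₀.1).comp continuous_fst.continuousAt.tendsto)
  · refine AntilipschitzWith.of_le_mul_dist fun x y => ?_
    have := (hK _ (clamp_mem hb p.1)).le_mul_dist x y
    rwa [Real.dist_eq, Real.dist_eq, sub_sub_sub_cancel_left, abs_sub_comm (X _ y), ← Real.dist_eq,
      ← Real.dist_eq]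
  · refine LipschitzWith.of_dist_le_mul fun x y => ?_
    have := (hM' _ (clamp_mem hb p.1) x y).1
    rwa [Real.dist_eq, Real.dist_eq, sub_sub_sub_cancel_left, abs_sub_comm (X _ y)]
  · exact continuous_snd.sub
      (hf.continuous_X.comp (((continuous_clamp b).comp continuous_fst).prodMk continuous_const))

theorem continuous_pconv (h : Data L ψ Ψ k ρ₀ u₀ θ) (hf : IsFlow Ψ k ρ₀ u₀ θ X G) {b : ℝ}
    (hb : 0 ≤ b) (hg : Good X b) {φ : ℝ → ℝ} (hφ : Measurable φ) {M : ℝ} (hM : ∀ x, ‖φ x‖ ≤ M) :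
    Continuous fun p : ℝ × ℝ => pconv φ ρ₀ (X (clamp b p.1)) p.2 :=
  continuous_pconv_mul h hf hb hg hφ hM (fun _ => h.ρ_integrable) (fun _ => by simp)

theorem hasDerivAt_pot (h : Data L ψ Ψ k ρ₀ u₀ θ) (hf : IsFlow Ψ k ρ₀ u₀ θ X G) {b : ℝ}
    (hg : Good X b) {Φ : ℝ → ℝ} (hΦ : LipschitzWith L Φ) {t : ℝ} (ht : t ∈ Icc 0 b) (z : ℝ) :
    HasDerivAt (pot Φ ρ₀ (X t)) (pconv (deriv Φ) ρ₀ (X t) z) z := by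
  obtain ⟨K, hK⟩ := hg.exists_antilipschitz
  exact hasDerivAt_integral_shift hΦ (hK t ht) (hf.nearId t).1 h.ρ_integrable
    (h.pot_integrable hΦ (hf.nearId t)) z

theorem Data.deriv_Ψ (h : Data L ψ Ψ k ρ₀ u₀ θ) : deriv Ψ = ψ := funext fun z =>
  (h.hasDerivAt_Ψ z).deriv

theorem Data.norm_ψ_le (h : Data L ψ Ψ k ρ₀ u₀ θ) (x : ℝ) : ‖ψ x‖ ≤ L := by
  rw [← h.deriv_Ψ]
  exact norm_deriv_le_of_lipschitz h.Ψ_lip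

theorem contDiff_pot_id (h : Data L ψ Ψ k ρ₀ u₀ θ) (hf : IsFlow Ψ k ρ₀ u₀ θ X G) :
    ContDiff ℝ 1 (pot Ψ ρ₀ id) := by
  have hg : Good X 0 := ⟨1, one_pos, fun t ht x y _ => by
    rw [show t = 0 from le_antisymm ht.2 ht.1, hf.X_zero, hf.X_zero, one_mul]⟩
  have hd := fun z => hasDerivAt_pot h hf hg h.Ψ_lip (left_mem_Icc.2 le_rfl) z
  rw [hf.X_zero_eq, h.deriv_Ψ] at hd
  rw [contDiff_one_iff_deriv]
  refine ⟨fun z => (hd z).differentiableAt, ?_⟩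
  rw [funext fun z => (hd z).deriv]
  have hc := (continuous_pconv h hf le_rfl hg h.ψ_continuous.measurable h.norm_ψ_le).comp
    (continuous_const (y := (0 : ℝ)).prodMk continuous_id)
  have e : clamp 0 0 = 0 := clamp_eq (left_mem_Icc.2 le_rfl)
  simpa [Function.comp_def, e, hf.X_zero_eq] using hc

theorem IsFlow.G_zero_contDiff (h : Data L ψ Ψ k ρ₀ u₀ θ) (hf : IsFlow Ψ k ρ₀ u₀ θ X G) :
    ContDiff ℝ 1 (G 0) := by
  rw [funext hf.G_zero]
  exact h.u_contDiff.add (contDiff_pot_id h hf)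

theorem pot_sub_eq (h : Data L ψ Ψ k ρ₀ u₀ θ) (hf : IsFlow Ψ k ρ₀ u₀ θ X G) {b : ℝ}
    (hb : 0 ≤ b) (hg : Good X b) {Φ : ℝ → ℝ} (hΦ : LipschitzWith L Φ) {t : ℝ} (ht : t ∈ Icc 0 b)
    (x y : ℝ) : pot Φ ρ₀ (X t) x - pot Φ ρ₀ (X t) y
      = segAvg (pconv (deriv Φ) ρ₀ (X t)) x y * (x - y) := by
  refine sub_eq_segAvg_mul (hasDerivAt_pot h hf hg hΦ ht) ?_ x y
  have hc := (continuous_pconv h hf hb hg (measurable_deriv Φ)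
    (fun x => norm_deriv_le_of_lipschitz hΦ)).comp (continuous_const (y := t).prodMk continuous_id)
  simpa [Function.comp_def, clamp_eq ht] using hc

/-- The spatial derivatives of the flow up to time `b`. -/
structure HasJacobian (ψ k ρ₀ : ℝ → ℝ) (X G : ℝ → ℝ → ℝ) (b : ℝ) : Prop where
  continuousOn_J : ContinuousOn (fun p : ℝ × ℝ => deriv (X p.1) p.2) (Icc 0 b ×ˢ univ)
  continuousOn_g : ContinuousOn (fun p : ℝ × ℝ => deriv (G p.1) p.2) (Icc 0 b ×ˢ univ)
  hasDerivAt_X : ∀ t ∈ Icc 0 b, ∀ x, HasDerivAt (X t) (deriv (X t) x) x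
  hasDerivAt_G : ∀ t ∈ Icc 0 b, ∀ x, HasDerivAt (G t) (deriv (G t) x) x
  hasDerivAt_J : ∀ t ∈ Ioo 0 b, ∀ x, HasDerivAt (fun s => deriv (X s) x)
    (deriv (G t) x - pconv ψ ρ₀ (X t) (X t x) * deriv (X t) x) t
  hasDerivAt_g : ∀ t ∈ Ioo 0 b, ∀ x, HasDerivAt (fun s => deriv (G s) x)
    (-(pconv (deriv k) ρ₀ (X t) (X t x) * deriv (X t) x)) t

theorem IsFlow.continuous_clamp (hf : IsFlow Ψ k ρ₀ u₀ θ X G) (b : ℝ) {Z : Type*}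
    [TopologicalSpace Z] {f g : Z → ℝ} (hfc : Continuous f) (hgc : Continuous g) :
    Continuous fun z => X (clamp b (f z)) (g z) :=
  hf.continuous_X.comp (((EulerAlign.continuous_clamp b).comp hfc).prodMk hgc)

/-- The difference of the potentials at X t x and X t y is a continuous coefficient times X t x - X
t y, so the differences of X and G obey the linear system of `exists_spatial_deriv` without source
terms. -/
theorem IsFlow.hasJacobian (h : Data L ψ Ψ k ρ₀ u₀ θ) (hf : IsFlow Ψ k ρ₀ u₀ θ X G) {b : ℝ}
    (hb : 0 ≤ b) (hg : Good X b) : HasJacobian ψ k ρ₀ X G b := by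
  have hcont : ∀ Φ, LipschitzWith L Φ → Continuous fun p : ℝ × ℝ × ℝ =>
      segAvg (pconv (deriv Φ) ρ₀ (X (clamp b p.1))) (X (clamp b p.1) p.2.1)
        (X (clamp b p.1) p.2.2) := by
    intro Φ hΦ
    refine continuous_segAvg ?_ (hf.continuous_clamp b continuous_fst (by fun_prop))
      (hf.continuous_clamp b continuous_fst (by fun_prop))
    have hc := continuous_pconv h hf hb hg (measurable_deriv Φ)
      (fun x => norm_deriv_le_of_lipschitz hΦ)
    exact hc.comp (continuous_fst.fst.prodMk continuous_snd)
  obtain ⟨p, q, hp, hq, hd, ht⟩ := exists_spatial_deriv (P := X) (Q := G) hb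
    (α := fun t z => segAvg (pconv (deriv Ψ) ρ₀ (X (clamp b t))) (X (clamp b t) z.1)
        (X (clamp b t) z.2))
    (β := fun t z => segAvg (pconv (deriv k) ρ₀ (X (clamp b t))) (X (clamp b t) z.1)
        (X (clamp b t) z.2))
    (σ := fun _ _ => 0) (η := fun _ _ => 0)
    (hcont Ψ h.Ψ_lip) (hcont k h.k_lip) continuous_const continuous_const
    (fun x => (hf.continuous_X_left x).continuousOn) (fun x => (hf.continuous_G_left x).continuousOn)
    (fun t ht x y => by
      have ht' := Ioo_subset_Icc_self ht
      refine ((hf.hasDerivAt_X t x).sub (hf.hasDerivAt_X t y)).congr_deriv ?_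
      simp only [clamp_eq ht']
      rw [← pot_sub_eq h hf hb hg h.Ψ_lip ht']
      ring)
    (fun t ht x y => by
      have ht' := Ioo_subset_Icc_self ht
      refine ((hf.hasDerivAt_G t x).sub (hf.hasDerivAt_G t y)).congr_deriv ?_
      simp only [clamp_eq ht']
      rw [← pot_sub_eq h hf hb hg h.k_lip ht', h.force_eq (hf.nearId t), h.force_eq (hf.nearId t)]
      ring)
    (by rw [hf.X_zero_eq]; exact contDiff_id) (hf.G_zero_contDiff h)
  have hX := fun t (ht : t ∈ Icc 0 b) x => (hd t ht x).1.deriv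
  have hG := fun t (ht : t ∈ Icc 0 b) x => (hd t ht x).2.deriv
  refine ⟨hp.congr fun z hz => hX _ hz.1 _, hq.congr fun z hz => hG _ hz.1 _,
    fun t ht x => (hd t ht x).1.differentiableAt.hasDerivAt,
    fun t ht x => (hd t ht x).2.differentiableAt.hasDerivAt, fun t h' x => ?_, fun t h' x => ?_⟩
  all_goals
    have ht' := Ioo_subset_Icc_self h'
    have hn := Ioo_mem_nhds h'.1 h'.2
    rw [hX t ht' x]
  · rw [hG t ht' x]
    have := (ht t h' x).1
    simp only [clamp_eq ht', segAvg_self, h.deriv_Ψ, sub_zero] at this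
    refine this.congr_of_eventuallyEq ?_
    filter_upwards [hn] with s hs using hX s (Ioo_subset_Icc_self hs) x
  · have := (ht t h' x).2
    simp only [clamp_eq ht', segAvg_self, sub_zero] at this
    refine this.congr_of_eventuallyEq ?_
    filter_upwards [hn] with s hs using hG s (Ioo_subset_Icc_self hs) x

end Regularity

/-! ### Transport of measures -/

section Push

/-- `X` maps the measure `ρ₀ dx` to `ρ dx`. -/
structure IsPush (X ρ₀ ρ : ℝ → ℝ) : Prop where
  integrable_iff : ∀ f : ℝ → ℝ,
    Integrable (fun z => f z * ρ z) ↔ Integrable (fun y => f (X y) * ρ₀ y)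
  integral_eq : ∀ f : ℝ → ℝ, ∫ z, f z * ρ z = ∫ y, f (X y) * ρ₀ y

theorem lintegral_Ioc_ofReal {f : ℝ → ℝ} (hf : Continuous f) (h0 : ∀ x, 0 ≤ f x) {a b : ℝ}
    (hab : a ≤ b) : ∫⁻ x in Ioc a b, ENNReal.ofReal (f x) = ENNReal.ofReal (∫ x in a..b, f x) := by
  rw [intervalIntegral.integral_of_le hab, ofReal_integral_eq_lintegral_ofReal
    hf.integrableOn_Ioc (Eventually.of_forall h0)]

/-- Two measures that agree on half-open intervals coincide. As X is a homeomorphism, hence a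
measurable embedding, the change of variables holds for every f, measurable or not. -/
theorem isPush_of_intervalIntegral {X ρ₀ ρ : ℝ → ℝ} (hm : StrictMono X)
    (hs : Function.Surjective X) (hρ₀ : Continuous ρ₀) (h0 : ∀ x, 0 ≤ ρ₀ x) (hρ : Continuous ρ)
    (h1 : ∀ x, 0 ≤ ρ x) (h : ∀ a b, a ≤ b → ∫ z in X a..X b, ρ z = ∫ y in a..b, ρ₀ y) :
    IsPush X ρ₀ ρ := by
  have hemb : MeasurableEmbedding X :=
    (hm.orderIsoOfSurjective X hs).toHomeomorph.measurableEmbedding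
  have hmeas : ∀ {f : ℝ → ℝ}, Continuous f → Measurable fun x => ENNReal.ofReal (f x) :=
    fun hf => hf.measurable.ennreal_ofReal
  have hμ : Measure.map X (volume.withDensity fun x => ENNReal.ofReal (ρ₀ x))
      = volume.withDensity fun x => ENNReal.ofReal (ρ x) := by
    have hloc : IsLocallyFiniteMeasure (volume.withDensity fun x => ENNReal.ofReal (ρ x)) :=
      IsLocallyFiniteMeasure.withDensity_ofReal hρ
    refine (Measure.ext_of_Ioc _ _ fun a b hab => ?_).symm
    obtain ⟨a', rfl⟩ := hs a
    obtain ⟨b', rfl⟩ := hs b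
    have hab' : a' < b' := hm.lt_iff_lt.1 hab
    have hpre : X ⁻¹' Ioc (X a') (X b') = Ioc a' b' := by
      ext x
      simp [hm.lt_iff_lt, hm.le_iff_le]
    rw [hemb.map_apply, hpre, withDensity_apply _ measurableSet_Ioc,
      withDensity_apply _ measurableSet_Ioc, lintegral_Ioc_ofReal hρ h1 hab.le,
      lintegral_Ioc_ofReal hρ₀ h0 hab'.le, h _ _ hab'.le]
  have hi : ∀ {r : ℝ → ℝ}, Continuous r → (∀ x, 0 ≤ r x) → ∀ f : ℝ → ℝ,
      (Integrable f (volume.withDensity fun x => ENNReal.ofReal (r x)) ↔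
        Integrable fun x => f x * r x) ∧
      ∫ x, f x ∂(volume.withDensity fun x => ENNReal.ofReal (r x)) = ∫ x, f x * r x := by
    intro r hr hr0 f
    have hfin : ∀ᵐ x, ENNReal.ofReal (r x) < ⊤ := Eventually.of_forall fun x => ENNReal.ofReal_lt_top
    rw [integrable_withDensity_iff_integrable_smul' (hmeas hr) hfin,
      integral_withDensity_eq_integral_toReal_smul (hmeas hr) hfin]
    simp only [ENNReal.toReal_ofReal (hr0 _), smul_eq_mul, mul_comm (r _), and_self]
  refine ⟨fun f => ?_, fun f => ?_⟩
  · rw [← (hi hρ h1 f).1, ← hμ, hemb.integrable_map_iff]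
    exact (hi hρ₀ h0 (f ∘ X)).1
  · rw [← (hi hρ h1 f).2, ← hμ, hemb.integral_map]
    exact (hi hρ₀ h0 (f ∘ X)).2

theorem strictMono_of_expanding {X : ℝ → ℝ} {c : ℝ} (hc : 0 < c)
    (h : ∀ x y, y ≤ x → c * (x - y) ≤ X x - X y) : StrictMono X := by
  intro x y hxy
  have h1 := h y x hxy.le
  have h2 : 0 < c * (y - x) := mul_pos hc (sub_pos.2 hxy)
  linarith

theorem surjective_of_expanding {X : ℝ → ℝ} {c : ℝ} (hc : 0 < c) (hX : Continuous X)
    (h : ∀ x y, y ≤ x → c * (x - y) ≤ X x - X y) : Function.Surjective X := by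
  refine hX.surjective ?_ ?_
  · refine tendsto_atTop_mono' _ (f₁ := fun x => c * x + X 0) ?_
      (tendsto_atTop_add_const_right _ _ (tendsto_id.const_mul_atTop hc))
    filter_upwards [eventually_ge_atTop 0] with x hx
    have := h x 0 hx
    linarith
  · refine tendsto_atBot_mono' _ (f₁ := fun x => c * x + X 0) ?_
      (tendsto_atBot_add_const_right _ _ (tendsto_id.const_mul_atBot hc))
    filter_upwards [eventually_le_atBot 0] with x hx
    have := h 0 x hx
    linarith

end Push

/-! ### Velocity and acceleration of particles -/

section Velocity

variable {L : ℝ≥0} {ψ Ψ k ρ₀ u₀ θ : ℝ → ℝ}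

/-- Differentiating Ψ ⋆ ρ along trajectories produces the alignment force with the opposite sign.
This is why adding Ψ ⋆ ρ to the velocity removes alignment from the equation for G. The weight θ
dominates the integrand. -/
theorem hasDerivAt_pot_comp (h : Data L ψ Ψ k ρ₀ u₀ θ) {X V : ℝ → ℝ → ℝ} {s : Set ℝ} {t₀ : ℝ}
    (hs : s ∈ 𝓝 t₀) (hX : ∀ t ∈ s, ∀ y, HasDerivAt (fun t => X t y) (V t y) t)
    (hn : ∀ t ∈ s, NearId θ (X t)) (hVc : Continuous (V t₀)) {C : ℝ}
    (hV : ∀ t ∈ s, ∀ y, |V t y| ≤ C * θ y) (x : ℝ) :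
    HasDerivAt (fun t => pot Ψ ρ₀ (X t) (X t x))
      (∫ y, ψ (X t₀ x - X t₀ y) * (V t₀ x - V t₀ y) * ρ₀ y) t₀ := by
  have hC0 : 0 ≤ C := by
    have h1 := (abs_nonneg _).trans (hV t₀ (mem_of_mem_nhds hs) 0)
    exact nonneg_of_mul_nonneg_left h1 (h.θ_pos 0)
  refine (hasDerivAt_integral_of_dominated_loc_of_deriv_le hs
    (F' := fun t y => ψ (X t x - X t y) * (V t x - V t y) * ρ₀ y)
    (bound := fun y => L * (C * (θ x * ρ₀ y) + C * (θ y * ρ₀ y))) ?_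
    (h.pot_integrable h.Ψ_lip (hn t₀ (mem_of_mem_nhds hs)) _) ?_ ?_ ?_ ?_).2
  · filter_upwards [hs] with t ht
    exact (h.pot_integrable h.Ψ_lip (hn t ht) _).aestronglyMeasurable
  · have := h.ψ_continuous
    have := (hn t₀ (mem_of_mem_nhds hs)).1
    have := h.ρ_continuous
    exact (Continuous.aestronglyMeasurable (by fun_prop))
  · refine Eventually.of_forall fun y t ht => ?_
    rw [norm_mul, norm_mul, Real.norm_of_nonneg (h.ρ_nonneg y)]
    have h1 := h.norm_ψ_le (X t x - X t y)
    have h2 : ‖V t x - V t y‖ ≤ C * θ x + C * θ y :=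
      (norm_sub_le _ _).trans (add_le_add (hV t ht x) (hV t ht y))
    calc ‖ψ (X t x - X t y)‖ * ‖V t x - V t y‖ * ρ₀ y
        ≤ L * (C * θ x + C * θ y) * ρ₀ y := by
          have := h.ρ_nonneg y
          gcongr
      _ = _ := by ring
  · exact ((((h.ρ_integrable.const_mul _).const_mul _).add (h.θ_integrable.const_mul _)).const_mul _)
  · refine Eventually.of_forall fun y t ht => ?_
    have h1 := (h.hasDerivAt_Ψ (X t x - X t y)).comp t ((hX t ht x).sub (hX t ht y))
    exact (h1.sub_const _).mul_const _

/-- The velocity of the particle which starts at `x`. -/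
noncomputable def vel (Ψ ρ₀ : ℝ → ℝ) (X G : ℝ → ℝ → ℝ) (t x : ℝ) : ℝ :=
  G t x - pot Ψ ρ₀ (X t) (X t x)

/-- The acceleration of the particle which starts at `x`. -/
noncomputable def acc (ψ Ψ k ρ₀ : ℝ → ℝ) (X G : ℝ → ℝ → ℝ) (t x : ℝ) : ℝ :=
  (∫ y, ψ (X t x - X t y) * (vel Ψ ρ₀ X G t y - vel Ψ ρ₀ X G t x) * ρ₀ y)
    - ∫ y, k (X t x - X t y) * ρ₀ y

variable {X G : ℝ → ℝ → ℝ}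

theorem Data.continuous_pot (h : Data L ψ Ψ k ρ₀ u₀ θ) {X : ℝ → ℝ → ℝ}
    (hXc : ∀ y, Continuous fun t => X t y) (hn : ∀ t, NearId θ (X t)) {C : ℝ}
    (hC : ∀ t y, |X t y - y| ≤ C * θ y) {Φ : ℝ → ℝ} (hΦ : LipschitzWith L Φ) :
    Continuous fun p : ℝ × ℝ => pot Φ ρ₀ (X p.1) p.2 := by
  refine continuous_prod_of_continuous_lipschitzWith' _ L (fun t => ?_) (fun z => ?_)
  · exact LipschitzWith.of_dist_le_mul fun z z' => h.pot_lipschitz hΦ (hn _) z z'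
  · refine continuous_of_dominated (bound := fun y => L * (|z| * ρ₀ y + C * (θ y * ρ₀ y)))
      (fun t => (h.pot_integrable hΦ (hn _) z).aestronglyMeasurable)
      (fun t => Eventually.of_forall fun y => ?_)
      (((h.ρ_integrable.const_mul _).add (h.θ_integrable.const_mul _)).const_mul _)
      (Eventually.of_forall fun y => ?_)
    · rw [norm_mul, Real.norm_of_nonneg (h.ρ_nonneg y)]
      have h1 := hΦ.norm_sub_le (z - X t y) (-y)
      have h2 : ‖z - X t y - -y‖ ≤ |z| + C * θ y := by
        rw [show z - X t y - -y = z - (X t y - y) by ring]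
        exact (norm_sub_le _ _).trans (add_le_add le_rfl (hC t y))
      calc _ ≤ (L * (|z| + C * θ y)) * ρ₀ y := by
            have := h.ρ_nonneg y
            gcongr
            exact h1.trans (by gcongr)
        _ = _ := by ring
    · exact ((hΦ.continuous.comp (continuous_const.sub (hXc y))).sub
        continuous_const).mul continuous_const

theorem IsFlow.continuous_pot (h : Data L ψ Ψ k ρ₀ u₀ θ) (hf : IsFlow Ψ k ρ₀ u₀ θ X G) {b : ℝ}
    (hb : 0 ≤ b) {Φ : ℝ → ℝ} (hΦ : LipschitzWith L Φ) :
    Continuous fun p : ℝ × ℝ => pot Φ ρ₀ (X (clamp b p.1)) p.2 := by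
  obtain ⟨C, hC⟩ := hf.bound b
  exact h.continuous_pot (X := fun t => X (clamp b t))
    (fun y => hf.continuous_clamp b continuous_id continuous_const) (fun t => hf.nearId _)
    (fun t y => (hC _ (clamp_mem hb t) y).1) hΦ

theorem IsFlow.continuous_vel (h : Data L ψ Ψ k ρ₀ u₀ θ) (hf : IsFlow Ψ k ρ₀ u₀ θ X G) {b : ℝ}
    (hb : 0 ≤ b) : Continuous fun p : ℝ × ℝ => vel Ψ ρ₀ X G (clamp b p.1) p.2 := by
  refine (hf.continuous_G.comp (((EulerAlign.continuous_clamp b).comp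
    continuous_fst).prodMk continuous_snd)).sub ?_
  exact (hf.continuous_pot h hb h.Ψ_lip).comp (continuous_fst.prodMk
    (hf.continuous_clamp b continuous_fst continuous_snd))

theorem IsFlow.vel_bound (h : Data L ψ Ψ k ρ₀ u₀ θ) (hf : IsFlow Ψ k ρ₀ u₀ θ X G) (b : ℝ) :
    ∃ C, ∀ t ∈ Icc 0 b, ∀ x, |vel Ψ ρ₀ X G t x| ≤ C * θ x := by
  obtain ⟨C, hC⟩ := hf.bound b
  refine ⟨C + 1 + L * (1 + ∫ y, θ y * ρ₀ y) * C, fun t ht x => ?_⟩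
  have h1 := (hC t ht x).2
  have h2 := h.u_le x
  have h3 := h.pot_comp_sub_le h.Ψ_lip (hf.nearId t) (nearId_id θ) (fun y => (hC t ht y).1) x
  have e : vel Ψ ρ₀ X G t x = (G t x - G 0 x) + u₀ x
      - (pot Ψ ρ₀ (X t) (X t x) - pot Ψ ρ₀ id (id x)) := by
    rw [hf.G_zero, vel, id]; ring
  rw [e]
  refine (abs_sub _ _).trans ((add_le_add (abs_add_le _ _) le_rfl).trans ?_)
  linarith

theorem IsFlow.hasDerivAt_vel (h : Data L ψ Ψ k ρ₀ u₀ θ) (hf : IsFlow Ψ k ρ₀ u₀ θ X G) {t : ℝ}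
    (ht : 0 < t) (x : ℝ) :
    HasDerivAt (fun s => vel Ψ ρ₀ X G s x) (acc ψ Ψ k ρ₀ X G t x) t := by
  obtain ⟨C, hC⟩ := hf.vel_bound h (t + 1)
  have hn : Icc 0 (t + 1) ∈ 𝓝 t := Icc_mem_nhds ht (by linarith)
  have hc := (hf.continuous_vel h ht.le).comp (continuous_const (y := t).prodMk continuous_id)
  simp only [Function.comp_def, id, clamp_eq (right_mem_Icc.2 ht.le)] at hc
  have h1 := hasDerivAt_pot_comp h hn (fun t _ y => hf.hasDerivAt_X t y) (fun t _ => hf.nearId t)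
    hc hC x
  refine ((hf.hasDerivAt_G t x).sub h1).congr_deriv ?_
  have e : ∫ y, ψ (X t x - X t y) * (vel Ψ ρ₀ X G t y - vel Ψ ρ₀ X G t x) * ρ₀ y
      = -∫ y, ψ (X t x - X t y) * ((G t x - pot Ψ ρ₀ (X t) (X t x))
        - (G t y - pot Ψ ρ₀ (X t) (X t y))) * ρ₀ y := by
    rw [← integral_neg]
    refine integral_congr_ae (Eventually.of_forall fun y => ?_)
    simp only [vel]
    ring
  rw [acc, e]
  ring

/-- The factor vel t x grows with x, so the alignment term is split into ∫ ψ vel ρ₀ and vel t x ∫ ψ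
ρ₀, each integral being dominated uniformly in (t, x). -/
theorem IsFlow.continuous_acc (h : Data L ψ Ψ k ρ₀ u₀ θ) (hf : IsFlow Ψ k ρ₀ u₀ θ X G) {b : ℝ}
    (hb : 0 ≤ b) : Continuous fun p : ℝ × ℝ => acc ψ Ψ k ρ₀ X G (clamp b p.1) p.2 := by
  obtain ⟨C, hC⟩ := hf.vel_bound h b
  have hv := hf.continuous_vel h hb
  have hX := hf.continuous_clamp b (Z := ℝ × ℝ) continuous_fst continuous_snd
  have hvy : ∀ y, Continuous fun p : ℝ × ℝ => vel Ψ ρ₀ X G (clamp b p.1) y := fun y =>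
    hv.comp (continuous_fst.prodMk continuous_const)
  have hXy : ∀ y, Continuous fun p : ℝ × ℝ => X (clamp b p.1) y := fun y =>
    hf.continuous_clamp b continuous_fst continuous_const
  have hv2 : ∀ t, Continuous fun y => vel Ψ ρ₀ X G (clamp b t) y := fun t =>
    hv.comp (continuous_const.prodMk continuous_id)
  have hX2 : ∀ t, Continuous (X (clamp b t)) := fun t => (hf.nearId _).1
  have hψ := h.ψ_continuous
  have hρ := h.ρ_continuous
  have i1 : ∀ p : ℝ × ℝ, Integrable fun y => (ψ (X (clamp b p.1) p.2 - X (clamp b p.1) y)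
      * vel Ψ ρ₀ X G (clamp b p.1) y) * ρ₀ y := by
    intro p
    refine h.integrable_of_le (C := L * C) ?_ fun y => ?_
    · have := hv2 p.1
      have := hX2 p.1
      exact Continuous.aestronglyMeasurable (by fun_prop)
    · rw [abs_mul, mul_assoc]
      exact mul_le_mul (h.norm_ψ_le _) (hC _ (clamp_mem hb _) y) (abs_nonneg _) L.coe_nonneg
  have i2 : ∀ p : ℝ × ℝ, Integrable fun y => ψ (X (clamp b p.1) p.2 - X (clamp b p.1) y)
      * ρ₀ y := by
    intro p
    refine h.integrable_of_le (C := L) ?_ fun y => ?_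
    · have := hX2 p.1
      exact Continuous.aestronglyMeasurable (by fun_prop)
    · exact (h.norm_ψ_le _).trans (le_mul_of_one_le_right L.coe_nonneg (h.one_le_θ y))
  have c1 : Continuous fun p : ℝ × ℝ => ∫ y, (ψ (X (clamp b p.1) p.2 - X (clamp b p.1) y)
      * vel Ψ ρ₀ X G (clamp b p.1) y) * ρ₀ y := by
    refine continuous_of_dominated (bound := fun y => L * C * (θ y * ρ₀ y))
      (fun p => (i1 p).aestronglyMeasurable) (fun p => Eventually.of_forall fun y => ?_)
      (h.θ_integrable.const_mul _) (Eventually.of_forall fun y => ?_)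
    · rw [norm_mul, norm_mul, Real.norm_of_nonneg (h.ρ_nonneg y), ← mul_assoc, mul_assoc (L : ℝ)]
      exact mul_le_mul_of_nonneg_right (mul_le_mul (h.norm_ψ_le _) (hC _ (clamp_mem hb _) y)
        (norm_nonneg _) L.coe_nonneg) (h.ρ_nonneg y)
    · exact ((hψ.comp (hX.sub (hXy y))).mul (hvy y)).mul continuous_const
  have c2 : Continuous fun p : ℝ × ℝ => ∫ y, ψ (X (clamp b p.1) p.2 - X (clamp b p.1) y)
      * ρ₀ y := by
    refine continuous_of_dominated (bound := fun y => L * ρ₀ y)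
      (fun p => (i2 p).aestronglyMeasurable) (fun p => Eventually.of_forall fun y => ?_)
      (h.ρ_integrable.const_mul _) (Eventually.of_forall fun y => ?_)
    · rw [norm_mul, Real.norm_of_nonneg (h.ρ_nonneg y)]
      exact mul_le_mul_of_nonneg_right (h.norm_ψ_le _) (h.ρ_nonneg y)
    · exact (hψ.comp (hX.sub (hXy y))).mul continuous_const
  have c3 : Continuous fun p : ℝ × ℝ => ∫ y, k (X (clamp b p.1) p.2 - X (clamp b p.1) y) * ρ₀ y := by
    have : ∀ p : ℝ × ℝ, ∫ y, k (X (clamp b p.1) p.2 - X (clamp b p.1) y) * ρ₀ y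
        = pot k ρ₀ (X (clamp b p.1)) (X (clamp b p.1) p.2) + ∫ y, k (-y) * ρ₀ y := fun p =>
      h.force_eq (hf.nearId _) _
    simp_rw [this]
    exact ((hf.continuous_pot h hb h.k_lip).comp (continuous_fst.prodMk hX)).add continuous_const
  refine ((c1.sub (hv.mul c2)).sub c3).congr fun p => ?_
  simp only [Pi.sub_apply, Pi.mul_apply]
  rw [acc, ← integral_const_mul, ← integral_sub (i1 p) ((i2 p).const_mul _)]
  congr 1
  refine integral_congr_ae (Eventually.of_forall fun y => ?_)
  simp only
  ring

theorem IsFlow.hasDerivAt_vel_space (h : Data L ψ Ψ k ρ₀ u₀ θ) (hf : IsFlow Ψ k ρ₀ u₀ θ X G)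
    {b : ℝ} (hb : 0 ≤ b) (hg : Good X b) {t : ℝ} (ht : t ∈ Icc 0 b) (x : ℝ) :
    HasDerivAt (vel Ψ ρ₀ X G t)
      (deriv (G t) x - pconv ψ ρ₀ (X t) (X t x) * deriv (X t) x) x := by
  have hj := hf.hasJacobian h hb hg
  have h1 := (hasDerivAt_pot h hf hg h.Ψ_lip ht (X t x)).comp x (hj.hasDerivAt_X t ht x)
  rw [h.deriv_Ψ] at h1
  exact (hj.hasDerivAt_G t ht x).sub h1

end Velocity

/-! ### Eulerian fields of the flow -/

/-- The label of the particle which at time `t` is at `z`. -/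
noncomputable def label (X : ℝ → ℝ → ℝ) (t : ℝ) : ℝ → ℝ := Function.invFun (X t)

/-- The Eulerian density transported by the flow. -/
noncomputable def eulerRho (ρ₀ : ℝ → ℝ) (X : ℝ → ℝ → ℝ) (t z : ℝ) : ℝ :=
  ρ₀ (label X t z) / deriv (X t) (label X t z)

/-- The Eulerian velocity of the flow. -/
noncomputable def eulerU (Ψ ρ₀ : ℝ → ℝ) (X G : ℝ → ℝ → ℝ) (t z : ℝ) : ℝ :=
  vel Ψ ρ₀ X G t (label X t z)

section Euler

variable {L : ℝ≥0} {ψ Ψ k ρ₀ u₀ θ : ℝ → ℝ} {X G : ℝ → ℝ → ℝ} {b : ℝ}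

theorem label_X (hg : Good X b) {t : ℝ} (ht : t ∈ Icc 0 b) (x : ℝ) : label X t (X t x) = x := by
  obtain ⟨c, hc, h⟩ := hg
  exact Function.leftInverse_invFun (strictMono_of_expanding hc (h t ht)).injective x

theorem X_label (hf : IsFlow Ψ k ρ₀ u₀ θ X G) (hg : Good X b) {t : ℝ} (ht : t ∈ Icc 0 b) (z : ℝ) :
    X t (label X t z) = z := by
  obtain ⟨c, hc, h⟩ := hg
  exact Function.rightInverse_invFun (surjective_of_expanding hc (hf.nearId t).1 (h t ht)) z

theorem Good.exists_le_deriv (h : Data L ψ Ψ k ρ₀ u₀ θ) (hf : IsFlow Ψ k ρ₀ u₀ θ X G) (hb : 0 ≤ b)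
    (hg : Good X b) : ∃ c > 0, ∀ t ∈ Icc 0 b, ∀ x, c ≤ deriv (X t) x := by
  have hj := hf.hasJacobian h hb hg
  obtain ⟨c, hc, hX⟩ := hg
  refine ⟨c, hc, fun t ht x => ?_⟩
  have hm : Monotone fun x => X t x - c * x := by
    intro y x hyx
    have := hX t ht x y hyx
    simp only
    linarith
  have h1 := hm.deriv_nonneg (x := x)
  have h2 : HasDerivAt (fun x => X t x - c * x) (deriv (X t) x - c) x := by
    exact ((hj.hasDerivAt_X t ht x).sub ((hasDerivAt_id x).const_mul c)).congr_deriv (by simp)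
  rw [h2.deriv] at h1
  linarith

/-- By the uniform antilipschitz bound, the distance between label t z and y₀ = label t₀ z₀ is at
most a constant times |z - X t y₀|, which vanishes at (t₀, z₀). -/
theorem continuousOn_label (hf : IsFlow Ψ k ρ₀ u₀ θ X G) (hg : Good X b) :
    ContinuousOn (fun p : ℝ × ℝ => label X p.1 p.2) (Icc 0 b ×ˢ univ) := by
  have hl := fun {t} (ht : t ∈ Icc 0 b) z => X_label hf hg ht z
  obtain ⟨K, hK⟩ := hg.exists_antilipschitz
  rintro ⟨t₀, z₀⟩ ⟨ht₀, -⟩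
  rw [ContinuousWithinAt, tendsto_iff_dist_tendsto_zero]
  have h1 : Tendsto (fun p : ℝ × ℝ => K * dist p.2 (X p.1 (label X t₀ z₀)))
      (𝓝[Icc 0 b ×ˢ univ] (t₀, z₀)) (𝓝 0) := by
    have hc : Continuous fun p : ℝ × ℝ => K * dist p.2 (X p.1 (label X t₀ z₀)) :=
      continuous_const.mul (continuous_snd.dist
        ((hf.continuous_X_left _).comp continuous_fst))
    have := (hc.tendsto (t₀, z₀)).mono_left (nhdsWithin_le_nhds (s := Icc 0 b ×ˢ univ))
    simpa [hl ht₀] using this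
  refine squeeze_zero' (Eventually.of_forall fun _ => dist_nonneg) ?_ h1
  filter_upwards [self_mem_nhdsWithin] with p hp
  have := (hK p.1 hp.1).le_mul_dist (label X p.1 p.2) (label X t₀ z₀)
  rwa [hl hp.1] at this

theorem continuousOn_comp_label (hf : IsFlow Ψ k ρ₀ u₀ θ X G) (hg : Good X b) {F : ℝ → ℝ → ℝ}
    (hF : ContinuousOn (fun p : ℝ × ℝ => F p.1 p.2) (Icc 0 b ×ˢ univ)) :
    ContinuousOn (fun p : ℝ × ℝ => F p.1 (label X p.1 p.2)) (Icc 0 b ×ˢ univ) :=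
  hF.comp (continuousOn_fst.prodMk (continuousOn_label hf hg)) fun _ hp => ⟨hp.1, trivial⟩

theorem continuousOn_of_clamp {F : ℝ → ℝ → ℝ}
    (hF : Continuous fun p : ℝ × ℝ => F (clamp b p.1) p.2) :
    ContinuousOn (fun p : ℝ × ℝ => F p.1 p.2) (Icc 0 b ×ˢ univ) :=
  hF.continuousOn.congr fun p hp => by simp only [clamp_eq hp.1]

theorem continuousOn_pconv_X (h : Data L ψ Ψ k ρ₀ u₀ θ) (hf : IsFlow Ψ k ρ₀ u₀ θ X G)
    (hb : 0 ≤ b) (hg : Good X b) {φ : ℝ → ℝ} (hφ : Measurable φ) {M : ℝ} (hM : ∀ x, ‖φ x‖ ≤ M) :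
    ContinuousOn (fun p : ℝ × ℝ => pconv φ ρ₀ (X p.1) (X p.1 p.2)) (Icc 0 b ×ˢ univ) :=
  continuousOn_of_clamp (F := fun t x => pconv φ ρ₀ (X t) (X t x))
    ((continuous_pconv h hf hb hg hφ hM).comp
      (continuous_fst.prodMk (hf.continuous_clamp b continuous_fst continuous_snd)))

theorem hasDerivAt_label_space (h : Data L ψ Ψ k ρ₀ u₀ θ) (hf : IsFlow Ψ k ρ₀ u₀ θ X G)
    (hb : 0 ≤ b) (hg : Good X b) {t : ℝ} (ht : t ∈ Icc 0 b) (z : ℝ) :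
    HasDerivAt (label X t) (deriv (X t) (label X t z))⁻¹ z := by
  obtain ⟨c, hc, hJ⟩ := hg.exists_le_deriv h hf hb
  have hcont : Continuous (label X t) := by
    have := (continuousOn_label hf hg).comp (f := fun z : ℝ => (t, z)) (s := univ)
      (by fun_prop) fun z _ => ⟨ht, trivial⟩
    exact continuousOn_univ.1 this
  exact ((hf.hasJacobian h hb hg).hasDerivAt_X t ht _).of_local_left_inverse hcont.continuousAt
    (hc.trans_le (hJ t ht _)).ne' (Eventually.of_forall fun z => X_label hf hg ht z)

/-- Implicit differentiation: with y the label at time t, z - X s y equals the averaged Jacobian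
times label s z - y. Dividing by s - t and passing to the limit gives -vel / J. -/
theorem hasDerivAt_label_time (h : Data L ψ Ψ k ρ₀ u₀ θ) (hf : IsFlow Ψ k ρ₀ u₀ θ X G)
    (hb : 0 ≤ b) (hg : Good X b) {t : ℝ} (ht : t ∈ Ioo 0 b) (z : ℝ) :
    HasDerivAt (fun s => label X s z)
      (-(vel Ψ ρ₀ X G t (label X t z) / deriv (X t) (label X t z))) t := by
  have hj := hf.hasJacobian h hb hg
  obtain ⟨c, hc, hJ⟩ := hg.exists_le_deriv h hf hb
  have ht' := Ioo_subset_Icc_self ht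
  have hn := Icc_mem_nhds ht.1 ht.2
  set y := label X t z with hy
  have hlc : ContinuousAt (fun s => label X s z) t := by
    have h1 := (continuousOn_label hf hg).comp (f := fun s : ℝ => (s, z)) (s := Icc 0 b)
      (by fun_prop) fun s hs => ⟨hs, trivial⟩
    exact h1.continuousAt hn
  have hJc : Continuous fun p : ℝ × ℝ => deriv (X (clamp b p.1)) p.2 := by
    have h1 := hj.continuousOn_J.comp (f := fun p : ℝ × ℝ => (clamp b p.1, p.2)) (s := univ)
      (((continuous_clamp b).comp continuous_fst).prodMk continuous_snd).continuousOn
      fun p _ => ⟨clamp_mem hb _, trivial⟩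
    exact continuousOn_univ.1 h1
  have hsc : Continuous fun q : ℝ × ℝ => segAvg (deriv (X (clamp b q.1))) q.2 y :=
    continuous_segAvg (hJc.comp (continuous_fst.fst.prodMk continuous_snd)) continuous_snd
      continuous_const
  have hsub : ∀ s ∈ Icc 0 b, X s (label X s z) - X s y
      = segAvg (deriv (X (clamp b s))) (label X s z) y * (label X s z - y) := by
    intro s hs
    rw [clamp_eq hs]
    refine sub_eq_segAvg_mul (hj.hasDerivAt_X s hs) ?_ _ _
    have := hJc.comp (continuous_const (y := s).prodMk continuous_id)
    simpa [Function.comp_def, clamp_eq hs] using this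
  have hlim : ContinuousAt (fun s => segAvg (deriv (X (clamp b s))) (label X s z) y) t :=
    hsc.continuousAt.comp (f := fun s => (s, label X s z)) (continuousAt_id.prodMk hlc)
  have hval : segAvg (deriv (X (clamp b t))) (label X t z) y = deriv (X t) y := by
    rw [clamp_eq ht', ← hy, segAvg_self]
  have hpos : deriv (X t) y ≠ 0 := (hc.trans_le (hJ t ht' y)).ne'
  have hne : ∀ᶠ s in 𝓝 t, segAvg (deriv (X (clamp b s))) (label X s z) y ≠ 0 :=
    hlim.eventually_ne (by rwa [hval])
  have hX := hasDerivAt_iff_tendsto_slope.1 (hf.hasDerivAt_X t y)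
  rw [hasDerivAt_iff_tendsto_slope]
  have hlim' : Tendsto (fun s => segAvg (deriv (X (clamp b s))) (label X s z) y) (𝓝[≠] t)
      (𝓝 (deriv (X t) y)) := by
    have := hlim.tendsto.mono_left (nhdsWithin_le_nhds (s := {t}ᶜ))
    rwa [hval] at this
  refine (hX.div hlim' hpos).neg.congr' ?_
  filter_upwards [mem_nhdsWithin_of_mem_nhds hne, mem_nhdsWithin_of_mem_nhds hn] with s hs hs'
  have h1 := hsub s hs'
  rw [X_label hf hg hs'] at h1
  have h2 : X t y = z := X_label hf hg ht' z
  have h3 : label X s z - y = (z - X s y) / segAvg (deriv (X (clamp b s))) (label X s z) y := by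
    rw [h1, mul_div_cancel_left₀ _ hs]
  simp only [Pi.div_apply]
  rw [slope_def_field, slope_def_field, h2, ← hy, h3]
  ring

/-- The function ρ₀(label) / J is the derivative of z ↦ ∫ ρ₀ up to label z, so the mass between two
points is the initial mass between their labels. -/
theorem isPush_euler (h : Data L ψ Ψ k ρ₀ u₀ θ) (hf : IsFlow Ψ k ρ₀ u₀ θ X G) (hb : 0 ≤ b)
    (hg : Good X b) {t : ℝ} (ht : t ∈ Icc 0 b) : IsPush (X t) ρ₀ (eulerRho ρ₀ X t) ∧
      ∀ a c, ∫ z in a..c, eulerRho ρ₀ X t z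
        = (∫ y in (0 : ℝ)..label X t c, ρ₀ y) - ∫ y in (0 : ℝ)..label X t a, ρ₀ y := by
  have hj := hf.hasJacobian h hb hg
  obtain ⟨c, hc, hJ⟩ := hg.exists_le_deriv h hf hb
  have hrc : Continuous (eulerRho ρ₀ X t) := by
    have h1 : ContinuousOn (fun p : ℝ × ℝ => ρ₀ p.2 / deriv (X p.1) p.2) (Icc 0 b ×ˢ univ) :=
      (h.ρ_continuous.comp continuous_snd).continuousOn.div hj.continuousOn_J
        fun p hp => (hc.trans_le (hJ p.1 hp.1 p.2)).ne'
    have h2 := (continuousOn_comp_label hf hg (F := fun t x => ρ₀ x / deriv (X t) x) h1).comp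
      (f := fun z : ℝ => (t, z)) (s := univ) (by fun_prop) fun z _ => ⟨ht, trivial⟩
    exact continuousOn_univ.1 h2
  have hint : ∀ a c, ∫ z in a..c, eulerRho ρ₀ X t z
      = (∫ y in (0 : ℝ)..label X t c, ρ₀ y) - ∫ y in (0 : ℝ)..label X t a, ρ₀ y := by
    intro a c
    refine intervalIntegral.integral_eq_sub_of_hasDerivAt
      (f := fun z => ∫ y in (0 : ℝ)..label X t z, ρ₀ y) (fun z _ => ?_) (hrc.intervalIntegrable _ _)
    have h1 := intervalIntegral.integral_hasDerivAt_right
      (h.ρ_continuous.intervalIntegrable (μ := volume) 0 (label X t z))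
      (h.ρ_continuous.stronglyMeasurableAtFilter _ _) h.ρ_continuous.continuousAt
    exact h1.comp z (hasDerivAt_label_space h hf hb hg ht z)
  obtain ⟨e, he, hX⟩ := hg
  refine ⟨isPush_of_intervalIntegral (strictMono_of_expanding he (hX t ht))
    (surjective_of_expanding he (hf.nearId t).1 (hX t ht)) h.ρ_continuous h.ρ_nonneg hrc
    (fun x => div_nonneg (h.ρ_nonneg _) (hc.le.trans (hJ t ht _))) fun a c _ => ?_, hint⟩
  have hg : Good X b := ⟨e, he, hX⟩
  rw [hint, label_X hg ht, label_X hg ht]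
  exact intervalIntegral.integral_interval_sub_left (h.ρ_continuous.intervalIntegrable _ _)
    (h.ρ_continuous.intervalIntegrable _ _)

/-- The spatial derivative of the velocity in Lagrangian coordinates. -/
noncomputable def velX (ψ ρ₀ : ℝ → ℝ) (X G : ℝ → ℝ → ℝ) (t x : ℝ) : ℝ :=
  deriv (G t) x - pconv ψ ρ₀ (X t) (X t x) * deriv (X t) x

theorem hasDerivAt_eulerU_space (h : Data L ψ Ψ k ρ₀ u₀ θ) (hf : IsFlow Ψ k ρ₀ u₀ θ X G)
    (hb : 0 ≤ b) (hg : Good X b) {t : ℝ} (ht : t ∈ Icc 0 b) (z : ℝ) :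
    HasDerivAt (eulerU Ψ ρ₀ X G t)
      (velX ψ ρ₀ X G t (label X t z) / deriv (X t) (label X t z)) z :=
  (hf.hasDerivAt_vel_space h hb hg ht _).comp z (hasDerivAt_label_space h hf hb hg ht z)

theorem continuousOn_velX (h : Data L ψ Ψ k ρ₀ u₀ θ) (hf : IsFlow Ψ k ρ₀ u₀ θ X G)
    (hb : 0 ≤ b) (hg : Good X b) :
    ContinuousOn (fun p : ℝ × ℝ => velX ψ ρ₀ X G p.1 p.2) (Icc 0 b ×ˢ univ) := by
  have hj := hf.hasJacobian h hb hg
  exact hj.continuousOn_g.sub ((continuousOn_pconv_X h hf hb hg h.ψ_continuous.measurable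
    h.norm_ψ_le).mul hj.continuousOn_J)

theorem continuousOn_vel (h : Data L ψ Ψ k ρ₀ u₀ θ) (hf : IsFlow Ψ k ρ₀ u₀ θ X G)
    (hb : 0 ≤ b) : ContinuousOn (fun p : ℝ × ℝ => vel Ψ ρ₀ X G p.1 p.2) (Icc 0 b ×ˢ univ) :=
  continuousOn_of_clamp (hf.continuous_vel h hb)

theorem continuousOn_acc (h : Data L ψ Ψ k ρ₀ u₀ θ) (hf : IsFlow Ψ k ρ₀ u₀ θ X G)
    (hb : 0 ≤ b) : ContinuousOn (fun p : ℝ × ℝ => acc ψ Ψ k ρ₀ X G p.1 p.2) (Icc 0 b ×ˢ univ) :=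
  continuousOn_of_clamp (hf.continuous_acc h hb)

theorem hasDerivAt_eulerU_time (h : Data L ψ Ψ k ρ₀ u₀ θ) (hf : IsFlow Ψ k ρ₀ u₀ θ X G)
    (hb : 0 ≤ b) (hg : Good X b) {t : ℝ} (ht : t ∈ Ioo 0 b) (z : ℝ) :
    HasDerivAt (fun s => eulerU Ψ ρ₀ X G s z)
      (acc ψ Ψ k ρ₀ X G t (label X t z) + velX ψ ρ₀ X G t (label X t z)
        * -(vel Ψ ρ₀ X G t (label X t z) / deriv (X t) (label X t z))) t := by
  have hsub : Ioo 0 b ×ˢ (univ : Set ℝ) ⊆ Icc 0 b ×ˢ univ := prod_mono_left Ioo_subset_Icc_self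
  exact hasDerivAt_comp_of_partial (f := vel Ψ ρ₀ X G) (isOpen_Ioo.prod isOpen_univ)
    (fun p hp => hf.hasDerivAt_vel h hp.1.1 p.2)
    (fun p hp => hf.hasDerivAt_vel_space h hb hg (Ioo_subset_Icc_self hp.1) p.2)
    ((continuousOn_acc h hf hb).mono hsub) ((continuousOn_velX h hf hb hg).mono hsub)
    (hasDerivAt_label_time h hf hb hg ht z) ⟨ht, trivial⟩

end Euler

/-! ### Exhaustion of space-time slabs -/

section Slab

variable {T : EReal}

theorem continuousOn_slab {f : ℝ × ℝ → ℝ}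
    (h : ∀ b : ℝ, 0 ≤ b → (b : EReal) < T → ContinuousOn f (Icc 0 b ×ˢ univ)) :
    ContinuousOn f (slab T) := by
  rintro ⟨t, x⟩ ⟨h0, hT⟩
  obtain ⟨b, htb, hbT⟩ := EReal.lt_iff_exists_real_btwn.1 hT
  have htb' : t < b := EReal.coe_lt_coe_iff.1 htb
  have h1 := h b (h0.trans htb'.le) hbT (t, x) ⟨⟨h0, htb'.le⟩, trivial⟩
  refine h1.mono_of_mem_nhdsWithin ?_
  have hU : {q : ℝ × ℝ | q.1 < b} ∈ 𝓝 (t, x) :=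
    (isOpen_lt continuous_fst continuous_const).mem_nhds htb'
  filter_upwards [self_mem_nhdsWithin, mem_nhdsWithin_of_mem_nhds hU] with q hq hq'
  exact ⟨⟨hq.1, le_of_lt hq'⟩, trivial⟩

theorem isOpen_openSlab : IsOpen (openSlab T) :=
  (isOpen_lt continuous_const continuous_fst).inter
    (isOpen_lt (continuous_coe_real_ereal.comp continuous_fst) continuous_const)

theorem openSlab_subset_slab : openSlab T ⊆ slab T := fun _ hp => ⟨hp.1.le, hp.2⟩

theorem exists_mem_Ioo {t : ℝ} (ht : 0 ≤ t) (hT : (t : EReal) < T) :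
    ∃ b : ℝ, 0 ≤ b ∧ (b : EReal) < T ∧ t < b := by
  obtain ⟨b, htb, hbT⟩ := EReal.lt_iff_exists_real_btwn.1 hT
  have htb' : t < b := EReal.coe_lt_coe_iff.1 htb
  exact ⟨b, ht.trans htb'.le, hbT, htb'⟩

end Slab

/-! ### The flow yields a solution while it is nondegenerate -/

section Solution

variable {L : ℝ≥0} {ψ Ψ K ρ₀ u₀ θ : ℝ → ℝ} {X G : ℝ → ℝ → ℝ} {T : EReal}

/-- The change of variables z = X t y turns all integrals against ρ into integrals against ρ₀.
Differentiating u = vel(t, label) in time gives the acceleration minus u ∂ₓu, which is the momentum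
equation. -/
theorem IsFlow.isSolution (h : Data L ψ Ψ (deriv K) ρ₀ u₀ θ)
    (hf : IsFlow Ψ (deriv K) ρ₀ u₀ θ X G) (hT : ∀ b : ℝ, (b : EReal) < T → Good X b) :
    IsSolution ψ K ρ₀ u₀ T (eulerRho ρ₀ X) (eulerU Ψ ρ₀ X G) := by
  have hlab0 : ∀ z, label X 0 z = z := fun z => by
    have hg : Good X 0 := ⟨1, one_pos, fun t ht x y _ => by
      rw [show t = 0 from le_antisymm ht.2 ht.1, hf.X_zero, hf.X_zero, one_mul]⟩
    have := label_X hg (left_mem_Icc.2 le_rfl) z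
    rwa [hf.X_zero] at this
  have hpush : ∀ t : ℝ, 0 ≤ t → (t : EReal) < T → IsPush (X t) ρ₀ (eulerRho ρ₀ X t) :=
    fun t ht htT => (isPush_euler h hf ht (hT t htT) (right_mem_Icc.2 ht)).1
  have hux : ∀ t : ℝ, 0 ≤ t → (t : EReal) < T → ∀ x, deriv (eulerU Ψ ρ₀ X G t) x
      = velX ψ ρ₀ X G t (label X t x) / deriv (X t) (label X t x) := fun t ht htT x =>
    (hasDerivAt_eulerU_space h hf ht (hT t htT) (right_mem_Icc.2 ht) x).deriv
  have huxc : ContinuousOn (fun p : ℝ × ℝ => velX ψ ρ₀ X G p.1 (label X p.1 p.2)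
      / deriv (X p.1) (label X p.1 p.2)) (slab T) := by
    refine continuousOn_slab fun b hb hbT => ?_
    obtain ⟨c, hc, hJ⟩ := (hT b hbT).exists_le_deriv h hf hb
    exact (continuousOn_comp_label hf (hT b hbT) (continuousOn_velX h hf hb (hT b hbT))).div
      (continuousOn_comp_label hf (hT b hbT) (F := fun t x => deriv (X t) x) (hf.hasJacobian h hb (hT b hbT)).continuousOn_J)
      fun p hp => (hc.trans_le (hJ p.1 hp.1 _)).ne'
  refine
    { init_rho := ?_
      init_u := ?_
      rho_continuousOn := ?_
      u_continuousOn := ?_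
      deriv_u_continuousOn := ?_
      u_contDiffOn := ?_
      rho_nonneg := ?_
      rho_integrable := ?_
      mass_one := ?_
      momentum_integrable := ?_
      force_integrable := ?_
      locally_bounded := ?_
      mass_eq := ?_
      momentum_eq := ?_ }
  · funext z
    rw [eulerRho, hlab0, hf.X_zero_eq]
    simp
  · funext z
    rw [eulerU, hlab0, vel, hf.X_zero, hf.G_zero, hf.X_zero_eq]
    simp
  · refine continuousOn_slab fun b hb hbT => ?_
    obtain ⟨c, hc, hJ⟩ := (hT b hbT).exists_le_deriv h hf hb
    exact continuousOn_comp_label hf (hT b hbT) (F := fun t x => ρ₀ x / deriv (X t) x)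
      ((h.ρ_continuous.comp continuous_snd).continuousOn.div
        (hf.hasJacobian h hb (hT b hbT)).continuousOn_J
        fun p hp => (hc.trans_le (hJ p.1 hp.1 p.2)).ne')
  · exact continuousOn_slab fun b hb hbT =>
      continuousOn_comp_label hf (hT b hbT) (continuousOn_vel h hf hb)
  · exact huxc.congr fun p hp => hux p.1 hp.1 hp.2 p.2
  · refine contDiffOn_one_of_partial (f := eulerU Ψ ρ₀ X G)
      (f₁ := fun t z => acc ψ Ψ (deriv K) ρ₀ X G t (label X t z) + velX ψ ρ₀ X G t (label X t z)
        * -(vel Ψ ρ₀ X G t (label X t z) / deriv (X t) (label X t z)))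
      (f₂ := fun t z => velX ψ ρ₀ X G t (label X t z) / deriv (X t) (label X t z))
      isOpen_openSlab (fun p hp => ?_) (fun p hp => ?_) ?_ (huxc.mono openSlab_subset_slab)
    · obtain ⟨b, hb, hbT, hpb⟩ := exists_mem_Ioo hp.1.le hp.2
      exact hasDerivAt_eulerU_time h hf hb (hT b hbT) ⟨hp.1, hpb⟩ p.2
    · exact hasDerivAt_eulerU_space h hf hp.1.le (hT _ hp.2) (right_mem_Icc.2 hp.1.le) p.2
    · refine ContinuousOn.mono (continuousOn_slab fun b hb hbT => ?_) openSlab_subset_slab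
      obtain ⟨c, hc, hJ⟩ := (hT b hbT).exists_le_deriv h hf hb
      exact continuousOn_comp_label hf (hT b hbT) (F := fun t x => acc ψ Ψ (deriv K) ρ₀ X G t x
        + velX ψ ρ₀ X G t x * -(vel Ψ ρ₀ X G t x / deriv (X t) x))
        ((continuousOn_acc h hf hb).add ((continuousOn_velX h hf hb (hT b hbT)).mul
          ((continuousOn_vel h hf hb).div (hf.hasJacobian h hb (hT b hbT)).continuousOn_J
          fun p hp => (hc.trans_le (hJ p.1 hp.1 p.2)).ne').neg))
  · intro t ht htT x
    obtain ⟨c, hc, hJ⟩ := (hT t htT).exists_le_deriv h hf ht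
    exact div_nonneg (h.ρ_nonneg _) (hc.le.trans (hJ t (right_mem_Icc.2 ht) _))
  · intro t ht htT
    have := ((hpush t ht htT).integrable_iff fun _ => 1).2 (by simpa using h.ρ_integrable)
    simpa using this
  · intro t ht htT
    have := (hpush t ht htT).integral_eq fun _ => 1
    simpa [h.mass_one] using this
  · intro t ht htT
    rw [(hpush t ht htT).integrable_iff]
    obtain ⟨C, hC⟩ := hf.vel_bound h t
    have e : ∀ y, eulerU Ψ ρ₀ X G t (X t y) = vel Ψ ρ₀ X G t y := fun y => by
      rw [eulerU, label_X (hT t htT) (right_mem_Icc.2 ht)]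
    simp_rw [e]
    have hc := (hf.continuous_vel h ht).comp (continuous_const (y := t).prodMk continuous_id)
    simp only [Function.comp_def, id, clamp_eq (right_mem_Icc.2 ht)] at hc
    exact h.integrable_of_le hc.aestronglyMeasurable fun y => hC t (right_mem_Icc.2 ht) y
  · intro t ht htT x
    exact ((hpush t ht htT).integrable_iff fun y => deriv K (x - y)).2
      (h.force_integrable (hf.nearId t) x)
  · intro τ hτ hτT
    have hg := hT τ hτT
    obtain ⟨c, hc, hJ⟩ := hg.exists_le_deriv h hf hτ
    obtain ⟨R, hR⟩ := h.ρ_bounded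
    obtain ⟨C, hC⟩ := hf.vel_bound h τ
    obtain ⟨M, hM⟩ := hf.lipschitz h τ
    have hR0 : 0 ≤ R := (h.ρ_nonneg 0).trans (hR 0)
    have hC0 : 0 ≤ C := by
      have h1 := (abs_nonneg _).trans (hC 0 (left_mem_Icc.2 hτ) 0)
      exact nonneg_of_mul_nonneg_left h1 (h.θ_pos 0)
    have hm := h.integral_θ_nonneg
    set m := ∫ y, θ y * ρ₀ y with hm_def
    refine ⟨R / c + (M + L * M) / c + C * m, fun t ht => ⟨fun x => ?_, fun x => ?_, ?_⟩⟩
    · have h1 : eulerRho ρ₀ X t x ≤ R / c := by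
        rw [eulerRho]
        exact div_le_div₀ hR0 (hR _) hc (hJ t ht _)
      have h2 : 0 ≤ (M + L * M) / c := by positivity
      have h3 : 0 ≤ C * m := by positivity
      linarith
    · have htT : (t : EReal) < T := lt_of_le_of_lt (EReal.coe_le_coe_iff.2 ht.2) hτT
      rw [hux t ht.1 htT]
      set y := label X t x
      have h1 : |deriv (X t) y| ≤ M := by
        have := norm_deriv_le_of_lipschitz (x₀ := y) (LipschitzWith.of_dist_le_mul (f := X t)
          (K := M) fun x y => (hM t ht x y).1)
        exact this
      have h2 : |deriv (G t) y| ≤ M := by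
        have := norm_deriv_le_of_lipschitz (x₀ := y) (LipschitzWith.of_dist_le_mul (f := G t)
          (K := M) fun x y => (hM t ht x y).2)
        exact this
      have h3 : |pconv ψ ρ₀ (X t) (X t y)| ≤ L := by
        have := norm_integral_mul_le (f := fun z => ψ (X t y - X t z)) (fun _ => h.norm_ψ_le _)
          h.ρ_integrable
        simp only [Real.norm_of_nonneg (h.ρ_nonneg _), h.mass_one, mul_one] at this
        exact this
      have h4 : |velX ψ ρ₀ X G t y| ≤ M + L * M := by
        rw [velX]
        refine (abs_sub _ _).trans (add_le_add h2 ?_)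
        rw [abs_mul]
        exact mul_le_mul h3 h1 (abs_nonneg _) L.coe_nonneg
      have h5 : |velX ψ ρ₀ X G t y / deriv (X t) y| ≤ (M + L * M) / c := by
        rw [abs_div, abs_of_pos (hc.trans_le (hJ t ht y))]
        exact div_le_div₀ (by positivity) h4 hc (hJ t ht y)
      have h6 : 0 ≤ R / c := by positivity
      have h7 : 0 ≤ C * m := by positivity
      linarith
    · have htT : (t : EReal) < T := lt_of_le_of_lt (EReal.coe_le_coe_iff.2 ht.2) hτT
      rw [(hpush t ht.1 htT).integral_eq fun x => |eulerU Ψ ρ₀ X G t x|]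
      have e : ∀ y, eulerU Ψ ρ₀ X G t (X t y) = vel Ψ ρ₀ X G t y := fun y => by
        rw [eulerU, label_X hg ht]
      simp_rw [e]
      have h1 : ∫ y, |vel Ψ ρ₀ X G t y| * ρ₀ y ≤ C * m := by
        have := h.integral_le_of_le (X := vel Ψ ρ₀ X G t) (X' := fun _ => 0) (D := C)
          (fun y => by rw [sub_zero]; exact hC t ht y)
        simpa using this
      have h2 : 0 ≤ R / c + (M + L * M) / c := by positivity
      linarith
  -- The mass in [a, c] is the integral of ρ₀ between two labels, and each label moves with velocity
  -- -vel / J.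
  · intro t ht htT a c
    obtain ⟨b, hb, hbT, htb⟩ := exists_mem_Ioo ht.le htT
    have hg := hT b hbT
    have hd : ∀ z, HasDerivAt (fun s => ∫ y in (0 : ℝ)..label X s z, ρ₀ y)
        (-(eulerRho ρ₀ X t z * eulerU Ψ ρ₀ X G t z)) t := by
      intro z
      have h1 := intervalIntegral.integral_hasDerivAt_right
        (h.ρ_continuous.intervalIntegrable (μ := volume) 0 (label X t z))
        (h.ρ_continuous.stronglyMeasurableAtFilter _ _) h.ρ_continuous.continuousAt
      refine (h1.comp t (hasDerivAt_label_time h hf hb hg ⟨ht, htb⟩ z)).congr_deriv ?_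
      rw [eulerRho, eulerU]
      ring
    refine (((hd c).sub (hd a)).congr_of_eventuallyEq ?_).congr_deriv (by ring)
    filter_upwards [Icc_mem_nhds ht htb] with s hs
    exact (isPush_euler h hf hb hg hs).2 a c
  · intro t ht htT x
    obtain ⟨b, hb, hbT, htb⟩ := exists_mem_Ioo ht.le htT
    have hg := hT b hbT
    have ht' : t ∈ Icc 0 b := ⟨ht.le, htb.le⟩
    have hp := hpush t ht.le htT
    rw [(hasDerivAt_eulerU_time h hf hb hg ⟨ht, htb⟩ x).deriv, hux t ht.le htT, conv]
    rw [hp.integral_eq fun y => ψ (x - y) * (eulerU Ψ ρ₀ X G t y - eulerU Ψ ρ₀ X G t x),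
      hp.integral_eq fun y => deriv K (x - y)]
    have e : ∀ y, eulerU Ψ ρ₀ X G t (X t y) = vel Ψ ρ₀ X G t y := fun y => by
      rw [eulerU, label_X hg ht']
    simp_rw [e]
    have hx := X_label hf hg ht' x
    set y₀ := label X t x with hy₀
    have e2 : eulerU Ψ ρ₀ X G t x = vel Ψ ρ₀ X G t y₀ := rfl
    rw [e2, ← hx, acc]
    ring

end Solution

/-- A Grönwall argument for bounds uniform over a family: some finite bound M₀ is known, each pass
replaces M by A + M/2, and the iteration converges to 2A. No regularity in time of a supremum is
required. -/
theorem le_of_halving {ι : Type*} {f g : ι → ℝ} (hg : ∀ i, 0 ≤ g i) {A M₀ : ℝ} (hA : 0 ≤ A)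
    (h0 : ∀ i, f i ≤ M₀ * g i)
    (h : ∀ M, 0 ≤ M → (∀ i, f i ≤ M * g i) → ∀ i, f i ≤ (A + M / 2) * g i) (i : ι) :
    f i ≤ 2 * A * g i := by
  have key : ∀ n : ℕ, ∀ i, f i ≤ (2 * A + |M₀| * (1 / 2) ^ n) * g i := by
    intro n
    induction n with
    | zero =>
      intro i
      refine (h0 i).trans (mul_le_mul_of_nonneg_right ?_ (hg i))
      rw [pow_zero, mul_one]
      linarith [le_abs_self M₀]
    | succ n ih =>
      intro i
      refine (h _ (by positivity) ih i).trans (le_of_eq ?_)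
      rw [pow_succ]
      ring
  have hlim : Tendsto (fun n : ℕ => (2 * A + |M₀| * (1 / 2) ^ n) * g i) atTop
      (𝓝 ((2 * A + |M₀| * 0) * g i)) :=
    ((tendsto_const_nhds.add ((tendsto_pow_atTop_nhds_zero_of_lt_one (by norm_num)
      (by norm_num)).const_mul _)).mul_const _)
  have := ge_of_tendsto' hlim fun n => key n i
  simpa using this

/-! ### Characteristics of a Lipschitz velocity field -/

section Characteristics

variable {u : ℝ → ℝ → ℝ} {K : ℝ≥0} {Z : ℝ → ℝ → ℝ}

theorem characteristic_lipschitz (hL : ∀ t, LipschitzWith K (u t))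
    (hZ0 : ∀ x, Z 0 x = x) (hZ : ∀ t x, HasDerivAt (fun s => Z s x) (u t (Z t x)) t) {b t : ℝ}
    (ht : t ∈ Icc 0 b) (x y : ℝ) : |Z t x - Z t y| ≤ Real.exp (K * b) * |x - y| := by
  have h1 := norm_le_gronwallBound_of_hasDerivAt (f := fun t => Z t x - Z t y) (K := K) (ε := 0)
    (b := b) (fun t _ => ((hZ t x).sub (hZ t y)).continuousAt.continuousWithinAt)
    (fun t _ => (hZ t x).sub (hZ t y))
    (fun t _ => by rw [add_zero]; exact (hL t).norm_sub_le _ _) t ht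
  rw [gronwallBound_ε0, hZ0, hZ0, mul_comm] at h1
  refine h1.trans (mul_le_mul_of_nonneg_right (Real.exp_le_exp.2 ?_) (norm_nonneg _))
  exact mul_le_mul_of_nonneg_left ht.2 K.coe_nonneg

/-- Grönwall backwards in time bounds |x - y| by the later distance, so distinct characteristics
never meet and, by the intermediate value theorem, keep their order. -/
theorem characteristic_expanding (hL : ∀ t, LipschitzWith K (u t))
    (hZ0 : ∀ x, Z 0 x = x) (hZ : ∀ t x, HasDerivAt (fun s => Z s x) (u t (Z t x)) t) {b t : ℝ}
    (ht : t ∈ Icc 0 b) (x y : ℝ) (hyx : y ≤ x) :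
    (Real.exp (K * b))⁻¹ * (x - y) ≤ Z t x - Z t y := by
  have key : ∀ t ∈ Icc 0 b, |x - y| ≤ Real.exp (K * b) * |Z t x - Z t y| := by
    intro t ht
    have hd : ∀ s, HasDerivAt (fun s => Z (t - s) x - Z (t - s) y)
        (-(u (t - s) (Z (t - s) x) - u (t - s) (Z (t - s) y))) s := by
      intro s
      have h0 : HasDerivAt (fun s => t - s) (-1) s := by
        simpa using (hasDerivAt_id s).const_sub t
      have := ((hZ (t - s) x).sub (hZ (t - s) y)).scomp s h0
      exact this.congr_deriv (by simp)
    have h1 := norm_le_gronwallBound_of_hasDerivAt (K := K) (ε := 0)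
      (b := t) (fun t _ => (hd t).continuousAt.continuousWithinAt) (fun t _ => hd t)
      (fun s _ => by rw [add_zero, norm_neg]; exact (hL _).norm_sub_le _ _) t
      (right_mem_Icc.2 ht.1)
    rw [gronwallBound_ε0, sub_self, hZ0, hZ0, sub_zero, mul_comm] at h1
    refine h1.trans (mul_le_mul_of_nonneg_right (Real.exp_le_exp.2 ?_) (norm_nonneg _))
    exact mul_le_mul_of_nonneg_left ht.2 K.coe_nonneg
  rcases hyx.eq_or_lt with rfl | hlt
  · simp
  have hpos : 0 < Z t x - Z t y := by
    by_contra! hneg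
    have hc : ContinuousOn (fun s => Z s x - Z s y) (Icc 0 t) :=
      fun s _ => ((hZ s x).sub (hZ s y)).continuousAt.continuousWithinAt
    have h0 : (0 : ℝ) ∈ Icc (Z t x - Z t y) (Z 0 x - Z 0 y) := by
      rw [hZ0, hZ0]
      exact ⟨hneg, by linarith⟩
    obtain ⟨s, hs, hs0⟩ := intermediate_value_Icc' ht.1 hc h0
    have := key s ⟨hs.1, hs.2.trans ht.2⟩
    simp only at hs0
    rw [hs0, abs_zero, mul_zero, abs_of_pos (sub_pos.2 hlt)] at this
    linarith
  have := key t ht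
  rw [abs_of_pos hpos, abs_of_pos (sub_pos.2 hlt)] at this
  rwa [inv_mul_le_iff₀ (Real.exp_pos _)]

end Characteristics

/-! ### Characteristics of an arbitrary solution -/

section Uniqueness

variable {L : ℝ≥0} {ψ Ψ K ρ₀ u₀ θ : ℝ → ℝ} {T : EReal} {ρ u : ℝ → ℝ → ℝ}

theorem IsSolution.differentiable (h : Data L ψ Ψ (deriv K) ρ₀ u₀ θ)
    (hs : IsSolution ψ K ρ₀ u₀ T ρ u) {t : ℝ} (ht : 0 ≤ t) (htT : (t : EReal) < T) :
    Differentiable ℝ (u t) := by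
  rcases ht.eq_or_lt with rfl | h0
  · rw [hs.init_u]
    exact h.u_contDiff.differentiable one_ne_zero
  · intro x
    have h1 := (hs.u_contDiffOn.differentiableOn one_ne_zero).differentiableAt
      (isOpen_openSlab.mem_nhds (show ((t, x) : ℝ × ℝ) ∈ openSlab T from ⟨h0, htT⟩))
    exact h1.comp x (f := fun x => (t, x)) (by fun_prop)

/-- The characteristics of a solution up to the time `τ`. -/
structure IsChar (τ : ℝ) (u Z : ℝ → ℝ → ℝ) (C : ℝ≥0) : Prop where
  zero : ∀ x, Z 0 x = x
  hasDerivAt : ∀ t x, HasDerivAt (fun s => Z s x) (u (clamp τ t) (Z t x)) t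
  lip : ∀ t, LipschitzWith C (u (clamp τ t))
  continuous_u : Continuous fun p : ℝ × ℝ => u (clamp τ p.1) p.2

theorem mem_slab_of_mem_Icc {τ t : ℝ} (hτT : (τ : EReal) < T) (ht : t ∈ Icc 0 τ) (x : ℝ) :
    (t, x) ∈ slab T := ⟨ht.1, lt_of_le_of_lt (EReal.coe_le_coe_iff.2 ht.2) hτT⟩

theorem continuous_comp_clamp {τ : ℝ} (hτ : 0 ≤ τ) (hτT : (τ : EReal) < T) {f : ℝ → ℝ → ℝ}
    (hf : ContinuousOn (fun p : ℝ × ℝ => f p.1 p.2) (slab T)) :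
    Continuous fun p : ℝ × ℝ => f (clamp τ p.1) p.2 := by
  have h1 := hf.comp (f := fun p : ℝ × ℝ => (clamp τ p.1, p.2)) (s := univ)
    (((continuous_clamp τ).comp continuous_fst).prodMk continuous_snd).continuousOn
    fun p _ => mem_slab_of_mem_Icc hτT (clamp_mem hτ _) _
  exact continuousOn_univ.1 h1

/-- Local boundedness of ∂ₓu makes u uniformly Lipschitz on [0, τ], and clamping time extends it to
all times. -/
theorem IsSolution.exists_isChar (h : Data L ψ Ψ (deriv K) ρ₀ u₀ θ)
    (hs : IsSolution ψ K ρ₀ u₀ T ρ u) {τ : ℝ} (hτ : 0 ≤ τ) (hτT : (τ : EReal) < T) :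
    ∃ Z C, IsChar τ u Z C := by
  obtain ⟨C, hC⟩ := hs.locally_bounded τ hτ hτT
  have hC0 : 0 ≤ C := (abs_nonneg _).trans ((hC 0 (left_mem_Icc.2 hτ)).2.1 0)
  have hlip : ∀ t, LipschitzWith C.toNNReal (u (clamp τ t)) := by
    intro t
    have hm := mem_slab_of_mem_Icc hτT (clamp_mem hτ t) 0
    refine lipschitzWith_of_nnnorm_deriv_le (hs.differentiable h hm.1 hm.2) fun x => ?_
    rw [← NNReal.coe_le_coe, Real.coe_toNNReal _ hC0]
    exact (hC _ (clamp_mem hτ t)).2.1 x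
  have hc := continuous_comp_clamp hτ hτT hs.u_continuousOn
  obtain ⟨B, hB⟩ := (isCompact_Icc (a := (0 : ℝ)) (b := τ)).exists_bound_of_continuousOn
    (hc.comp (continuous_id.prodMk (continuous_const (y := (0 : ℝ))))).continuousOn
  have hB' : ∀ t, ‖u (clamp τ t) 0‖ ≤ B := by
    intro t
    have := hB _ (clamp_mem hτ t)
    simpa [clamp_eq (clamp_mem hτ t)] using this
  choose Z hZ0 hZ using fun x => exists_global_solution (f := fun t => u (clamp τ t)) hc hlip hB' x
  exact ⟨fun t x => Z x t, _, ⟨hZ0, fun t x => hZ x t, hlip, hc⟩⟩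

variable {τ : ℝ} {Z : ℝ → ℝ → ℝ} {C : ℝ≥0}

theorem IsChar.continuous (hZ : IsChar τ u Z C) (hτ : 0 ≤ τ) :
    Continuous fun p : ℝ × ℝ => Z (clamp τ p.1) p.2 := by
  refine continuous_prod_of_continuous_lipschitzWith' _ (Real.exp (C * τ)).toNNReal
    (fun t => ?_) (fun x => ?_)
  · refine LipschitzWith.of_dist_le_mul fun x y => ?_
    rw [Real.coe_toNNReal _ (Real.exp_pos _).le]
    exact characteristic_lipschitz hZ.lip hZ.zero hZ.hasDerivAt (clamp_mem hτ t) x y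
  · have : Continuous fun t => Z t x :=
      continuous_iff_continuousAt.2 fun t => (hZ.hasDerivAt t x).continuousAt
    exact this.comp (continuous_clamp τ)

theorem IsChar.continuous_left (hZ : IsChar τ u Z C) (x : ℝ) : Continuous fun t => Z t x :=
  continuous_iff_continuousAt.2 fun t => (hZ.hasDerivAt t x).continuousAt

/-- Let F(t, z) be the mass between 0 and z. Along any characteristic dF/dt is the flux through 0,
whatever the starting point, so the mass between two characteristics is constant. Only the integral
form of the mass equation enters. -/
theorem IsChar.integral_eq (hZ : IsChar τ u Z C) (hs : IsSolution ψ K ρ₀ u₀ T ρ u)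
    (hτ : 0 ≤ τ) (hτT : (τ : EReal) < T) {t : ℝ} (ht : t ∈ Icc 0 τ) (a b : ℝ) :
    ∫ z in Z t a..Z t b, ρ t z = ∫ y in a..b, ρ₀ y := by
  have hρc := continuous_comp_clamp hτ hτT hs.rho_continuousOn
  have hρc' : ∀ t, Continuous (ρ (clamp τ t)) := fun t =>
    hρc.comp (continuous_const.prodMk continuous_id)
  have hsub : Ioo 0 τ ×ˢ (univ : Set ℝ) ⊆ slab T := fun p hp =>
    mem_slab_of_mem_Icc hτT (Ioo_subset_Icc_self hp.1) p.2
  let F : ℝ → ℝ → ℝ := fun t z => ∫ y in (0 : ℝ)..z, ρ (clamp τ t) y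
  have hF : ∀ t ∈ Ioo 0 τ, ∀ x, HasDerivAt (fun s => F s (Z s x)) (ρ t 0 * u t 0) t := by
    intro t ht x
    have hd := hasDerivAt_comp_of_partial (f := F)
      (f₁ := fun t z => ρ t 0 * u t 0 - ρ t z * u t z) (f₂ := ρ)
      (isOpen_Ioo (a := (0 : ℝ)) (b := τ).prod isOpen_univ) ?_ ?_ ?_
      (hs.rho_continuousOn.mono hsub) (hZ.hasDerivAt t x) ⟨ht, trivial⟩
    · refine hd.congr_deriv ?_
      rw [clamp_eq (Ioo_subset_Icc_self ht)]
      ring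
    · rintro ⟨s, z⟩ ⟨hs', -⟩
      have hm := hsub (show ((s, z) : ℝ × ℝ) ∈ Ioo 0 τ ×ˢ univ from ⟨hs', trivial⟩)
      refine (hs.mass_eq s hs'.1 hm.2 0 z).congr_of_eventuallyEq ?_
      filter_upwards [Ioo_mem_nhds hs'.1 hs'.2] with r hr
      simp only [F]
      rw [clamp_eq (Ioo_subset_Icc_self hr)]
    · rintro ⟨s, z⟩ ⟨hs', -⟩
      have := intervalIntegral.integral_hasDerivAt_right ((hρc' s).intervalIntegrable 0 z)
        ((hρc' s).stronglyMeasurableAtFilter _ _) (hρc' s).continuousAt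
      rw [clamp_eq (Ioo_subset_Icc_self hs')] at this
      simp only [F]
      rwa [clamp_eq (Ioo_subset_Icc_self hs')]
    · have h1 := (hs.rho_continuousOn.mul hs.u_continuousOn).mono hsub
      have h2 : ContinuousOn (fun p : ℝ × ℝ => ρ p.1 0 * u p.1 0) (Ioo 0 τ ×ˢ univ) :=
        h1.comp (f := fun p : ℝ × ℝ => (p.1, (0 : ℝ))) (by fun_prop) fun p hp => ⟨hp.1, trivial⟩
      exact h2.sub h1
  have hFc : ∀ x, Continuous fun s => F s (Z s x) := fun x =>
    intervalIntegral.continuous_parametric_intervalIntegral_of_continuous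
      (f := fun s y => ρ (clamp τ s) y) hρc (hZ.continuous_left x)
  have h0 := eq_zero_of_norm_deriv_le (K := 0)
    (f := fun s => F s (Z s b) - F s (Z s a) - (F 0 (Z 0 b) - F 0 (Z 0 a))) (b := τ)
    (Continuous.continuousOn (((hFc b).sub (hFc a)).sub continuous_const))
    (fun t ht => ((hF t ht b).sub (hF t ht a)).sub_const _) (by simp) (by simp) t ht
  have hi : ∀ t a b, (∫ y in (0 : ℝ)..b, ρ (clamp τ t) y) - (∫ y in (0 : ℝ)..a, ρ (clamp τ t) y)
      = ∫ y in a..b, ρ (clamp τ t) y := fun t a b =>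
    intervalIntegral.integral_interval_sub_left ((hρc' t).intervalIntegrable _ _)
      ((hρc' t).intervalIntegrable _ _)
  have h1 := sub_eq_zero.1 h0
  simp only [F, hi, hZ.zero] at h1
  rwa [clamp_eq ht, clamp_eq (left_mem_Icc.2 hτ), hs.init_rho] at h1

theorem IsChar.isPush (h : Data L ψ Ψ (deriv K) ρ₀ u₀ θ) (hZ : IsChar τ u Z C)
    (hs : IsSolution ψ K ρ₀ u₀ T ρ u)
    (hτ : 0 ≤ τ) (hτT : (τ : EReal) < T) {t : ℝ} (ht : t ∈ Icc 0 τ) :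
    IsPush (Z t) ρ₀ (ρ t) := by
  have he := characteristic_expanding hZ.lip hZ.zero hZ.hasDerivAt ht
  have hpos : 0 < (Real.exp (C * τ))⁻¹ := inv_pos.2 (Real.exp_pos _)
  have hm := mem_slab_of_mem_Icc hτT ht 0
  have hZc : Continuous (Z t) := by
    have := (hZ.continuous hτ).comp (continuous_const (y := t).prodMk continuous_id)
    simpa [Function.comp_def, clamp_eq ht] using this
  have hρc : Continuous (ρ t) := by
    have := (continuous_comp_clamp hτ hτT hs.rho_continuousOn).comp
      (continuous_const (y := t).prodMk continuous_id)
    simpa [Function.comp_def, clamp_eq ht] using this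
  exact isPush_of_intervalIntegral (strictMono_of_expanding hpos he)
    (surjective_of_expanding hpos hZc he) h.ρ_continuous h.ρ_nonneg hρc
    (hs.rho_nonneg t hm.1 hm.2) fun a b _ => hZ.integral_eq hs hτ hτT ht a b

/-- The momentum equation read along a characteristic, with integrals against ρ rewritten by mass
transport as integrals against ρ₀. -/
theorem IsChar.hasDerivAt_velocity (h : Data L ψ Ψ (deriv K) ρ₀ u₀ θ) (hZ : IsChar τ u Z C)
    (hs : IsSolution ψ K ρ₀ u₀ T ρ u) (hτT : (τ : EReal) < T) {t : ℝ} (ht : t ∈ Ioo 0 τ) (x : ℝ) :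
    HasDerivAt (fun s => u s (Z s x))
      ((∫ y, ψ (Z t x - Z t y) * (u t (Z t y) - u t (Z t x)) * ρ₀ y)
        - ∫ y, deriv K (Z t x - Z t y) * ρ₀ y) t := by
  have ht' := Ioo_subset_Icc_self ht
  have hm := mem_slab_of_mem_Icc hτT ht' (Z t x)
  have hp := hZ.isPush h hs (ht.1.trans ht.2).le hτT ht'
  have hd := ((hs.u_contDiffOn.differentiableOn one_ne_zero).differentiableAt
    (isOpen_openSlab.mem_nhds (show ((t, Z t x) : ℝ × ℝ) ∈ openSlab T from
      ⟨ht.1, hm.2⟩))).hasFDerivAt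
  set D := fderiv ℝ (fun p : ℝ × ℝ => u p.1 p.2) (t, Z t x)
  have h1 : HasDerivAt (fun s => u s (Z t x)) (D (1, 0)) t :=
    hd.comp_hasDerivAt (f := fun s => (s, Z t x)) t ((hasDerivAt_id t).prodMk (hasDerivAt_const t _))
  have h2 : HasDerivAt (u t) (D (0, 1)) (Z t x) :=
    hd.comp_hasDerivAt (f := fun z => (t, z)) (Z t x)
      ((hasDerivAt_const _ t).prodMk (hasDerivAt_id _))
  have h3 := hd.comp_hasDerivAt (f := fun s => (s, Z s x)) t
    ((hasDerivAt_id t).prodMk (hZ.hasDerivAt t x))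
  refine h3.congr_deriv ?_
  have he := hs.momentum_eq t ht.1 hm.2 (Z t x)
  rw [h1.deriv, h2.deriv, conv, hp.integral_eq fun y => deriv K (Z t x - y),
    hp.integral_eq fun y => ψ (Z t x - y) * (u t y - u t (Z t x))] at he
  rw [← he, clamp_eq ht']
  have e : ((1 : ℝ), u t (Z t x)) = (1, 0) + u t (Z t x) • ((0 : ℝ), (1 : ℝ)) := by
    ext <;> simp
  rw [e, map_add, map_smul, smul_eq_mul]

end Uniqueness

/-! ### Every solution is the Lagrangian one -/

section Uniqueness

variable {L : ℝ≥0} {ψ Ψ K ρ₀ u₀ θ : ℝ → ℝ} {T : EReal} {ρ u : ℝ → ℝ → ℝ} {τ : ℝ}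
  {Z : ℝ → ℝ → ℝ} {C : ℝ≥0}

theorem IsChar.continuous_velocity (hZ : IsChar τ u Z C) (hτ : 0 ≤ τ) :
    Continuous fun p : ℝ × ℝ => u (clamp τ p.1) (Z (clamp τ p.1) p.2) :=
  hZ.continuous_u.comp (continuous_fst.prodMk (hZ.continuous hτ))

theorem IsChar.continuous_space (hZ : IsChar τ u Z C) {t : ℝ} (ht : t ∈ Icc 0 τ) :
    Continuous (Z t) ∧ Continuous fun x => u t (Z t x) := by
  have hτ : 0 ≤ τ := ht.1.trans ht.2
  have h1 := (hZ.continuous hτ).comp (continuous_const (y := t).prodMk continuous_id)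
  have h2 := (hZ.continuous_velocity hτ).comp (continuous_const (y := t).prodMk continuous_id)
  simp only [Function.comp_def, id, clamp_eq ht] at h1 h2
  exact ⟨h1, h2⟩

/-- Along a solution the displacement of the particles is bounded by a function which is
integrable against `ρ₀`. -/
theorem IsChar.exists_displacement_bound (h : Data L ψ Ψ (deriv K) ρ₀ u₀ θ) (hZ : IsChar τ u Z C)
    (hs : IsSolution ψ K ρ₀ u₀ T ρ u) (hτ : 0 ≤ τ) (hτT : (τ : EReal) < T) :
    ∃ I : ℝ → ℝ, Integrable (fun y => I y * ρ₀ y) ∧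
      ∀ t ∈ Icc 0 τ, ∀ y, |Z t y - y| ≤ I y := by
  obtain ⟨C₀, hC₀⟩ := hs.locally_bounded τ hτ hτT
  have hw := hZ.continuous_velocity hτ
  have hint : Integrable (fun p : ℝ × ℝ => |u (clamp τ p.1) (Z (clamp τ p.1) p.2)| * ρ₀ p.2)
      ((volume.restrict (Icc 0 τ)).prod volume) := by
    have hm : AEStronglyMeasurable
        (fun p : ℝ × ℝ => |u (clamp τ p.1) (Z (clamp τ p.1) p.2)| * ρ₀ p.2)
        ((volume.restrict (Icc 0 τ)).prod volume) :=
      (hw.abs.mul (h.ρ_continuous.comp continuous_snd)).aestronglyMeasurable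
    have hn : ∀ t y, ‖|u (clamp τ t) (Z (clamp τ t) y)| * ρ₀ y‖
        = |u (clamp τ t) (Z (clamp τ t) y)| * ρ₀ y := fun t y =>
      Real.norm_of_nonneg (mul_nonneg (abs_nonneg _) (h.ρ_nonneg y))
    rw [integrable_prod_iff hm]
    refine ⟨Eventually.of_forall fun t => ?_, ?_⟩
    · have ht := clamp_mem hτ t
      have hsl := mem_slab_of_mem_Icc hτT ht 0
      refine ((hZ.isPush h hs hτ hτT ht).integrable_iff fun z => |u (clamp τ t) z|).1 ?_
      refine (hs.momentum_integrable _ hsl.1 hsl.2).abs.congr (Eventually.of_forall fun z => ?_)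
      simp only [abs_mul, abs_of_nonneg (hs.rho_nonneg _ hsl.1 hsl.2 z)]
    · refine Integrable.of_bound hm.norm.integral_prod_right' C₀
        (Eventually.of_forall fun t => ?_)
      have ht := clamp_mem hτ t
      simp only [hn]
      rw [Real.norm_of_nonneg (integral_nonneg fun y => mul_nonneg (abs_nonneg _) (h.ρ_nonneg y)),
        ← (hZ.isPush h hs hτ hτT ht).integral_eq fun z => |u (clamp τ t) z|]
      exact (hC₀ _ ht).2.2
  -- The bound is the length of the particle's path over [0, τ]. It is integrable against ρ₀ by
  -- Fubini and the uniform bound on ∫ |u| ρ.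
  refine ⟨fun y => ∫ s in Icc 0 τ, |u (clamp τ s) (Z (clamp τ s) y)|, ?_, fun t ht y => ?_⟩
  · refine hint.integral_prod_right.congr (Eventually.of_forall fun y => ?_)
    simp only
    rw [integral_mul_const]
  · have hc : Continuous fun s => u (clamp τ s) (Z s y) :=
      hZ.continuous_u.comp (continuous_id.prodMk (hZ.continuous_left y))
    have hwy : Continuous fun s => |u (clamp τ s) (Z (clamp τ s) y)| :=
      (hw.comp (continuous_id.prodMk continuous_const)).abs
    have h1 := intervalIntegral.integral_eq_sub_of_hasDerivAt (fun s _ => hZ.hasDerivAt s y)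
      (hc.intervalIntegrable 0 t)
    rw [hZ.zero] at h1
    rw [← h1]
    refine (intervalIntegral.abs_integral_le_integral_abs ht.1).trans ?_
    rw [intervalIntegral.integral_of_le ht.1]
    have h2 : ∫ s in Ioc 0 t, |u (clamp τ s) (Z s y)|
        = ∫ s in Ioc 0 t, |u (clamp τ s) (Z (clamp τ s) y)| := by
      refine setIntegral_congr_fun measurableSet_Ioc fun s hs => ?_
      simp only [clamp_eq (show s ∈ Icc 0 τ from ⟨hs.1.le, hs.2.trans ht.2⟩)]
    rw [h2]
    exact setIntegral_mono_set hwy.integrableOn_Icc (Eventually.of_forall fun s => abs_nonneg _)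
      (Eventually.of_forall fun s hs => ⟨hs.1.le, hs.2.trans ht.2⟩)

/-- Solutions are defined by integral bounds only. This places them in the θ-weighted class in which
the flow equation is Lipschitz: the nonlocal terms are controlled by ∫ |u| ρ and the mean
displacement, and Grönwall applies to (Z t x - x, u) at each label. -/
theorem IsChar.exists_weighted_bound (h : Data L ψ Ψ (deriv K) ρ₀ u₀ θ) (hZ : IsChar τ u Z C)
    (hs : IsSolution ψ K ρ₀ u₀ T ρ u) (hτ : 0 ≤ τ) (hτT : (τ : EReal) < T) :
    ∃ M : ℝ, ∀ t ∈ Icc 0 τ, ∀ x, |Z t x - x| ≤ M * θ x ∧ |u t (Z t x)| ≤ M * θ x := by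
  obtain ⟨C₀, hC₀⟩ := hs.locally_bounded τ hτ hτT
  obtain ⟨I, hI, hZI⟩ := hZ.exists_displacement_bound h hs hτ hτT
  set B := ∫ y, I y * ρ₀ y with hB
  have hI0 : ∀ y, 0 ≤ I y := fun y => (abs_nonneg _).trans (hZI 0 (left_mem_Icc.2 hτ) y)
  have hB0 : 0 ≤ B := integral_nonneg fun y => mul_nonneg (hI0 y) (h.ρ_nonneg y)
  have hpush := fun t (ht : t ∈ Icc 0 τ) => hZ.isPush h hs hτ hτT ht
  have hVi : ∀ t ∈ Icc 0 τ, Integrable fun y => |u t (Z t y)| * ρ₀ y := by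
    intro t ht
    have hsl := mem_slab_of_mem_Icc hτT ht 0
    refine ((hpush t ht).integrable_iff fun z => |u t z|).1 ?_
    refine (hs.momentum_integrable _ hsl.1 hsl.2).abs.congr (Eventually.of_forall fun z => ?_)
    simp only [abs_mul, abs_of_nonneg (hs.rho_nonneg _ hsl.1 hsl.2 z)]
  have hV : ∀ t ∈ Icc 0 τ, ∫ y, |u t (Z t y)| * ρ₀ y ≤ C₀ := by
    intro t ht
    rw [← (hpush t ht).integral_eq fun z => |u t z|]
    exact (hC₀ _ ht).2.2
  have hC₀0 : 0 ≤ C₀ := by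
    refine le_trans ?_ (hV 0 (left_mem_Icc.2 hτ))
    exact integral_nonneg fun y => mul_nonneg (abs_nonneg _) (h.ρ_nonneg y)
  have hL := L.coe_nonneg
  have hψ : ∀ t ∈ Icc 0 τ, ∀ x, |∫ y, ψ (Z t x - Z t y) * (u t (Z t y) - u t (Z t x)) * ρ₀ y|
      ≤ L * (C₀ + |u t (Z t x)|) := by
    intro t ht x
    have h1 : |∫ y, ψ (Z t x - Z t y) * (u t (Z t y) - u t (Z t x)) * ρ₀ y|
        ≤ ∫ y, L * (|u t (Z t y)| * ρ₀ y + |u t (Z t x)| * ρ₀ y) := by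
      rw [← Real.norm_eq_abs]
      refine norm_integral_le_of_norm_le (((hVi t ht).add (h.ρ_integrable.const_mul _)).const_mul _)
        (Eventually.of_forall fun y => ?_)
      rw [norm_mul, norm_mul, Real.norm_of_nonneg (h.ρ_nonneg y), ← add_mul, ← mul_assoc]
      refine mul_le_mul_of_nonneg_right ?_ (h.ρ_nonneg y)
      exact mul_le_mul (h.norm_ψ_le _) (abs_sub _ _) (norm_nonneg _) hL
    rw [integral_const_mul, integral_add (hVi t ht) (h.ρ_integrable.const_mul _),
      integral_const_mul, h.mass_one, mul_one] at h1
    refine h1.trans ?_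
    gcongr
    exact hV t ht
  have hk : ∀ t ∈ Icc 0 τ, ∀ x, |∫ y, deriv K (Z t x - Z t y) * ρ₀ y|
      ≤ θ x + L * (|Z t x - x| + B) := by
    intro t ht x
    have hsl := mem_slab_of_mem_Icc hτT ht 0
    have i1 := ((hpush t ht).integrable_iff fun y => deriv K (Z t x - y)).1
      (hs.force_integrable _ hsl.1 hsl.2 _)
    have i2 := h.force_integrable (nearId_id θ) x
    have h1 : |(∫ y, deriv K (Z t x - Z t y) * ρ₀ y) - ∫ y, deriv K (x - id y) * ρ₀ y|
        ≤ ∫ y, L * (|Z t x - x| * ρ₀ y + I y * ρ₀ y) := by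
      rw [← integral_sub i1 i2, ← Real.norm_eq_abs]
      refine norm_integral_le_of_norm_le (((h.ρ_integrable.const_mul _).add hI).const_mul _)
        (Eventually.of_forall fun y => ?_)
      rw [← sub_mul, norm_mul, Real.norm_of_nonneg (h.ρ_nonneg y), ← add_mul, ← mul_assoc]
      refine mul_le_mul_of_nonneg_right ((h.k_lip.norm_sub_le _ _).trans ?_) (h.ρ_nonneg y)
      refine mul_le_mul_of_nonneg_left ?_ hL
      rw [Real.norm_eq_abs, show Z t x - Z t y - (x - id y) = (Z t x - x) - (Z t y - y) by
        simp only [id]; ring]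
      exact (abs_sub _ _).trans (add_le_add le_rfl (hZI t ht y))
    rw [integral_const_mul, integral_add (h.ρ_integrable.const_mul _) hI,
      integral_const_mul, h.mass_one, mul_one] at h1
    have h2 := h.k_le x
    have h3 := abs_sub_abs_le_abs_sub (∫ y, deriv K (Z t x - Z t y) * ρ₀ y)
      (∫ y, deriv K (x - id y) * ρ₀ y)
    simp only [id] at h1 h3
    linarith
  -- The source term per unit of θ: the initial force, the mean momentum in the alignment term, and
  -- the mean displacement in the force.
  set A := 1 + L * C₀ + L * B with hA
  have hA0 : 0 ≤ A := by positivity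
  refine ⟨(1 + A) * Real.exp ((1 + 2 * L) * τ), fun t ht x => ?_⟩
  have hθ := h.θ_pos x
  have hθ1 := h.one_le_θ x
  let F : ℝ → ℝ × ℝ := fun t => (Z t x - x, u t (Z t x))
  have hFc : ContinuousOn F (Icc 0 τ) := by
    refine ((hZ.continuous_left x).sub continuous_const).continuousOn.prodMk ?_
    refine ((hZ.continuous_u.comp (continuous_id.prodMk (hZ.continuous_left x))).continuousOn).congr
      fun s hs => ?_
    simp only [Function.comp_def, id, clamp_eq hs]
  have hF := norm_le_gronwallBound_of_hasDerivAt (f := F) (K := 1 + 2 * L) (ε := A * θ x)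
    (b := τ) hFc
    (fun s hs' => ((hZ.hasDerivAt s x).sub_const x).prodMk (hZ.hasDerivAt_velocity h hs hτT hs' x))
    ?_ t ht
  · have h0 : ‖F 0‖ ≤ θ x := by
      refine norm_prod_le_iff.2 ⟨?_, ?_⟩
      · simp only [F, hZ.zero, sub_self, norm_zero]
        exact hθ.le
      · simp only [F, hZ.zero, hs.init_u]
        exact h.u_le x
    rw [gronwallBound_of_K_ne_0 (by positivity)] at hF
    have h2 : Real.exp ((1 + 2 * L) * t) ≤ Real.exp ((1 + 2 * L) * τ) := by
      gcongr
      exact ht.2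
    have h3 : A * θ x / (1 + 2 * L) ≤ A * θ x := div_le_self (by positivity) (by linarith)
    have h4 : 0 ≤ A * θ x / (1 + 2 * L) := by positivity
    have h5 : 1 ≤ Real.exp ((1 + 2 * L) * t) :=
      Real.one_le_exp (mul_nonneg (by positivity) ht.1)
    have h1 : ‖F t‖ ≤ (1 + A) * Real.exp ((1 + 2 * L) * τ) * θ x := by
      calc ‖F t‖ ≤ ‖F 0‖ * Real.exp ((1 + 2 * L) * t)
            + A * θ x / (1 + 2 * L) * (Real.exp ((1 + 2 * L) * t) - 1) := hF
        _ ≤ θ x * Real.exp ((1 + 2 * L) * τ) + A * θ x * (Real.exp ((1 + 2 * L) * τ)) := by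
          gcongr
          · linarith
        _ = _ := by ring
    exact norm_prod_le_iff.1 h1
  · intro s hs'
    have hs'' := Ioo_subset_Icc_self hs'
    have h3 : |Z s x - x| ≤ ‖F s‖ := norm_fst_le (F s)
    have h4 : |u s (Z s x)| ≤ ‖F s‖ := norm_snd_le (F s)
    have hF0 := norm_nonneg (F s)
    refine norm_prod_le_iff.2 ⟨?_, ?_⟩
    · simp only [clamp_eq hs'']
      refine h4.trans ?_
      nlinarith [mul_nonneg hL hF0, mul_nonneg hA0 hθ.le]
    · refine (abs_sub _ _).trans ((add_le_add (hψ s hs'' x) (hk s hs'' x)).trans ?_)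
      have e1 : L * |u s (Z s x)| ≤ L * ‖F s‖ := by gcongr
      have e2 : L * |Z s x - x| ≤ L * ‖F s‖ := by gcongr
      have e3 : L * C₀ ≤ L * C₀ * θ x := le_mul_of_one_le_right (by positivity) hθ1
      have e4 : L * B ≤ L * B * θ x := le_mul_of_one_le_right (by positivity) hθ1
      rw [hA]
      linarith

/-- The alignment force cancels against the derivative of Ψ ⋆ ρ, so this quantity obeys the same
equation as G. -/
theorem IsChar.hasDerivAt_momentum (h : Data L ψ Ψ (deriv K) ρ₀ u₀ θ) (hZ : IsChar τ u Z C)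
    (hs : IsSolution ψ K ρ₀ u₀ T ρ u) (hτT : (τ : EReal) < T) {t : ℝ} (ht : t ∈ Ioo 0 τ) (x : ℝ) :
    HasDerivAt (fun s => u s (Z s x) + pot Ψ ρ₀ (Z s) (Z s x))
      (-∫ y, deriv K (Z t x - Z t y) * ρ₀ y) t := by
  have hτ := (ht.1.trans ht.2).le
  obtain ⟨M, hM⟩ := hZ.exists_weighted_bound h hs hτ hτT
  have h1 := hasDerivAt_pot_comp h (X := Z) (V := fun s y => u s (Z s y)) (C := M)
    (Ioo_mem_nhds ht.1 ht.2)
    (fun s hs' y => by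
      have := hZ.hasDerivAt s y
      rwa [clamp_eq (Ioo_subset_Icc_self hs')] at this)
    (fun s hs' => ⟨(hZ.continuous_space (Ioo_subset_Icc_self hs')).1, M,
      fun y => (hM s (Ioo_subset_Icc_self hs') y).1⟩)
    (hZ.continuous_space (Ioo_subset_Icc_self ht)).2
    (fun s hs' y => (hM s (Ioo_subset_Icc_self hs') y).2) x
  refine ((hZ.hasDerivAt_velocity h hs hτT ht x).add h1).congr_deriv ?_
  have e : ∫ y, ψ (Z t x - Z t y) * (u t (Z t y) - u t (Z t x)) * ρ₀ y
      = -∫ y, ψ (Z t x - Z t y) * (u t (Z t x) - u t (Z t y)) * ρ₀ y := by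
    rw [← integral_neg]
    refine integral_congr_ae (Eventually.of_forall fun y => ?_)
    simp only
    ring
  rw [e]
  ring

variable {X G : ℝ → ℝ → ℝ}

/-- The characteristics of a solution are the trajectories of the Lagrangian flow. -/
theorem IsChar.eq_flow (h : Data L ψ Ψ (deriv K) ρ₀ u₀ θ) (hZ : IsChar τ u Z C)
    (hs : IsSolution ψ K ρ₀ u₀ T ρ u) (hτ : 0 ≤ τ) (hτT : (τ : EReal) < T)
    (hf : IsFlow Ψ (deriv K) ρ₀ u₀ θ X G) {t : ℝ} (ht : t ∈ Icc 0 τ) (x : ℝ) :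
    Z t x = X t x ∧ u t (Z t x) = vel Ψ ρ₀ X G t x := by
  obtain ⟨M, hM⟩ := hZ.exists_weighted_bound h hs hτ hτT
  obtain ⟨N, hN⟩ := hf.bound τ
  have hnZ : ∀ t ∈ Icc 0 τ, NearId θ (Z t) := fun t ht =>
    ⟨(hZ.continuous_space ht).1, M, fun y => (hM t ht y).1⟩
  set m := ∫ y, θ y * ρ₀ y with hm
  have hm0 : 0 ≤ m := h.integral_θ_nonneg
  have hL := L.coe_nonneg
  set Q : ℝ := 1 + L * (1 + m) with hQ
  have hQ0 : 0 < Q := by positivity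
  -- The difference between the solution's pair and (X, G) in Lagrangian coordinates. It vanishes at
  -- time zero.
  let F : ℝ → ℝ → ℝ × ℝ := fun t x => (Z t x - X t x,
    u t (Z t x) + pot Ψ ρ₀ (Z t) (Z t x) - G t x)
  have hF0 : ∀ x, F 0 x = 0 := fun x => by
    have : Z 0 = id := funext hZ.zero
    simp [F, hf.X_zero, hf.G_zero, this, hs.init_u]
  have hFc : ∀ x, ContinuousOn (fun t => F t x) (Icc 0 τ) := by
    intro x
    refine ((hZ.continuous_left x).sub (hf.continuous_X_left x)).continuousOn.prodMk
      (ContinuousOn.sub ?_ (hf.continuous_G_left x).continuousOn)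
    have h1 : Continuous fun t => u (clamp τ t) (Z (clamp τ t) x) :=
      (hZ.continuous_velocity hτ).comp (continuous_id.prodMk continuous_const)
    have h2 := h.continuous_pot (X := fun t => Z (clamp τ t)) (C := M)
      (fun y => (hZ.continuous hτ).comp (continuous_id.prodMk continuous_const))
      (fun t => hnZ _ (clamp_mem hτ t)) (fun t y => (hM _ (clamp_mem hτ t) y).1) h.Ψ_lip
    have h3 : Continuous fun t => pot Ψ ρ₀ (Z (clamp τ t)) (Z (clamp τ t) x) :=
      h2.comp (continuous_id.prodMk ((hZ.continuous hτ).comp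
        (continuous_id.prodMk continuous_const)))
    refine (h1.add h3).continuousOn.congr fun s hs => ?_
    simp only [Pi.add_apply, clamp_eq hs]
  have hFd : ∀ x, ∀ t ∈ Ioo 0 τ, HasDerivAt (fun t => F t x)
      ((F t x).2 - (pot Ψ ρ₀ (Z t) (Z t x) - pot Ψ ρ₀ (X t) (X t x)),
        -(pot (deriv K) ρ₀ (Z t) (Z t x) - pot (deriv K) ρ₀ (X t) (X t x))) t := by
    intro x t ht
    have ht' := Ioo_subset_Icc_self ht
    have h1 := hZ.hasDerivAt t x
    rw [clamp_eq ht'] at h1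
    refine ((h1.sub (hf.hasDerivAt_X t x)).prodMk
      ((hZ.hasDerivAt_momentum h hs hτT ht x).sub (hf.hasDerivAt_G t x))).congr_deriv ?_
    rw [h.force_eq (hnZ t ht'), h.force_eq (hf.nearId t)]
    ext
    · simp only [F]; ring
    · simp only; ring
  -- Q bounds the Lipschitz constant of the system, so the weight exp(2Qt) halves any bound. With A
  -- = 0 the difference vanishes.
  have hhalf : ∀ i : Icc 0 τ × ℝ, ‖F i.1 i.2‖ ≤ 2 * 0 * (Real.exp (2 * Q * i.1) * θ i.2) := by
    refine le_of_halving (fun i => mul_nonneg (Real.exp_pos _).le (h.θ_pos _).le)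
      (M₀ := 1 + N + M + L * (1 + m) * M) le_rfl ?_ ?_
    · rintro ⟨⟨t, ht⟩, x⟩
      have hθ := h.θ_pos x
      have a1 := hM t ht x
      have a2 := hN t ht x
      have a3 := h.pot_comp_sub_le h.Ψ_lip (hnZ t ht) (nearId_id θ) (fun y => (hM t ht y).1) x
      have a4 := h.u_le x
      have hM0 : 0 ≤ M * θ x := (abs_nonneg _).trans a1.1
      have hN0 : 0 ≤ N * θ x := (abs_nonneg _).trans a2.1
      rw [← hm] at a3
      have e1 : 1 ≤ Real.exp (2 * Q * t) := Real.one_le_exp (mul_nonneg (by positivity) ht.1)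
      have hLM : 0 ≤ L * (1 + m) * M * θ x := (abs_nonneg _).trans a3
      have hb : ‖F t x‖ ≤ (1 + N + M + L * (1 + m) * M) * θ x := by
        refine norm_prod_le_iff.2 ⟨?_, ?_⟩
        · have := abs_sub (Z t x - x) (X t x - x)
          rw [sub_sub_sub_cancel_right] at this
          refine this.trans ?_
          linarith [a1.1, a2.1]
        · have e : (F t x).2 = u t (Z t x) + (pot Ψ ρ₀ (Z t) (Z t x) - pot Ψ ρ₀ id (id x))
              - (G t x - G 0 x) - u₀ x := by
            simp only [F, hf.G_zero, id]
            ring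
          rw [e]
          refine (abs_sub _ _).trans ((add_le_add ((abs_sub _ _).trans
            (add_le_add (abs_add_le _ _) le_rfl)) le_rfl).trans ?_)
          linarith [a1.2, a2.2]
      refine hb.trans (mul_le_mul_of_nonneg_left (le_mul_of_one_le_left hθ.le e1) ?_)
      refine nonneg_of_mul_nonneg_left ?_ hθ
      linarith
    · rintro M₁ hM₁ hle ⟨⟨t, ht⟩, x⟩
      have hle' : ∀ t ∈ Icc 0 τ, ∀ x, ‖F t x‖ ≤ M₁ * (Real.exp (2 * Q * t) * θ x) :=
        fun t ht x => hle (⟨t, ht⟩, x)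
      have hb := norm_le_of_norm_deriv_le_exp (l := 2 * Q) (A := 0) (B := Q * M₁ * θ x)
        (by positivity) (hFc x) (hFd x) ?_ (mul_nonneg (by positivity) (h.θ_pos x).le) t ht
      · refine hb.trans (le_of_eq ?_)
        rw [hF0, norm_zero]
        field_simp
        ring
      · intro s hs'
        have hs'' := Ioo_subset_Icc_self hs'
        have hD : ∀ y, |Z s y - X s y| ≤ M₁ * Real.exp (2 * Q * s) * θ y := fun y => by
          rw [mul_assoc]
          exact (norm_fst_le (F s y)).trans (hle' s hs'' y)
        have h1 := h.pot_comp_sub_le h.Ψ_lip (hnZ s hs'') (hf.nearId s) hD x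
        have h2 := h.pot_comp_sub_le h.k_lip (hnZ s hs'') (hf.nearId s) hD x
        have h3 := (norm_snd_le (F s x)).trans (hle' s hs'' x)
        have h4 : 0 ≤ M₁ * (Real.exp (2 * Q * s) * θ x) := (norm_nonneg _).trans h3
        rw [← hm] at h1 h2
        refine norm_prod_le_iff.2 ⟨?_, ?_⟩
        · refine (norm_sub_le _ _).trans ((add_le_add h3 h1).trans (le_of_eq ?_))
          rw [hQ]
          ring
        · rw [norm_neg]
          refine h2.trans ?_
          rw [hQ]
          linarith
  have key : ∀ t ∈ Icc 0 τ, ∀ x, F t x = 0 := fun t ht x => by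
    rw [← norm_le_zero_iff]
    simpa using hhalf (⟨t, ht⟩, x)
  have hXZ : Z t = X t := funext fun y => sub_eq_zero.1 (congrArg Prod.fst (key t ht y))
  have h2 : u t (Z t x) + pot Ψ ρ₀ (Z t) (Z t x) = G t x :=
    sub_eq_zero.1 (congrArg Prod.snd (key t ht x))
  refine ⟨congrFun hXZ x, ?_⟩
  rw [vel, ← h2, hXZ]
  ring

/-- The characteristics of a solution are expanding up to a factor and are the trajectories of X.
Hence no solution can live past the degeneration of the flow. -/
theorem IsSolution.good (h : Data L ψ Ψ (deriv K) ρ₀ u₀ θ) (hs : IsSolution ψ K ρ₀ u₀ T ρ u)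
    (hf : IsFlow Ψ (deriv K) ρ₀ u₀ θ X G) (hτT : (τ : EReal) < T) : Good X τ := by
  rcases lt_or_ge τ 0 with hτ | hτ
  · exact ⟨1, one_pos, fun t ht => absurd (ht.1.trans ht.2) (not_le.2 hτ)⟩
  obtain ⟨Z, C, hZ⟩ := hs.exists_isChar h hτ hτT
  refine ⟨_, inv_pos.2 (Real.exp_pos (C * τ)), fun t ht x y hyx => ?_⟩
  rw [← (hZ.eq_flow h hs hτ hτT hf ht x).1, ← (hZ.eq_flow h hs hτ hτT hf ht y).1]
  exact characteristic_expanding hZ.lip hZ.zero hZ.hasDerivAt ht x y hyx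

theorem eq_of_integral_eq {f g : ℝ → ℝ} (hf : Continuous f) (hg : Continuous g)
    (h : ∀ a b, ∫ x in a..b, f x = ∫ x in a..b, g x) : f = g := by
  funext x
  have h1 := intervalIntegral.integral_hasDerivAt_right (hf.intervalIntegrable (μ := volume) 0 x)
    (hf.stronglyMeasurableAtFilter _ _) hf.continuousAt
  have h2 := intervalIntegral.integral_hasDerivAt_right (hg.intervalIntegrable (μ := volume) 0 x)
    (hg.stronglyMeasurableAtFilter _ _) hg.continuousAt
  rw [funext fun b => h 0 b] at h1
  exact h1.unique h2

theorem IsSolution.continuous_rho (hs : IsSolution ψ K ρ₀ u₀ T ρ u) {t : ℝ} (ht : 0 ≤ t)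
    (htT : (t : EReal) < T) : Continuous (ρ t) := by
  have := (continuous_comp_clamp ht htT hs.rho_continuousOn).comp
    (continuous_const (y := t).prodMk continuous_id)
  simpa [Function.comp_def, clamp_eq (right_mem_Icc.2 ht)] using this

/-- Every solution is given by the Lagrangian flow. -/
theorem IsSolution.eq_euler (h : Data L ψ Ψ (deriv K) ρ₀ u₀ θ) (hs : IsSolution ψ K ρ₀ u₀ T ρ u)
    (hf : IsFlow Ψ (deriv K) ρ₀ u₀ θ X G) {t : ℝ} (ht : 0 ≤ t) (htT : (t : EReal) < T) :
    ρ t = eulerRho ρ₀ X t ∧ u t = eulerU Ψ ρ₀ X G t := by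
  have hgood := fun (τ : ℝ) (hτ : (τ : EReal) < T) => hs.good h hf (τ := τ) hτ
  have he := hf.isSolution h hgood
  have ht' : t ∈ Icc 0 t := right_mem_Icc.2 ht
  obtain ⟨Z, C, hZ⟩ := hs.exists_isChar h ht htT
  have hXZ : Z t = X t := funext fun y => (hZ.eq_flow h hs ht htT hf ht' y).1
  constructor
  · refine eq_of_integral_eq (hs.continuous_rho ht htT) (he.continuous_rho ht htT) fun a b => ?_
    rw [← X_label hf (hgood t htT) ht' a, ← X_label hf (hgood t htT) ht' b,
      (isPush_euler h hf ht (hgood t htT) ht').2, label_X (hgood t htT) ht',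
      label_X (hgood t htT) ht', ← hXZ, hZ.integral_eq hs ht htT ht',
      intervalIntegral.integral_interval_sub_left (h.ρ_continuous.intervalIntegrable _ _)
        (h.ρ_continuous.intervalIntegrable _ _)]
  · funext z
    rw [eulerU, ← (hZ.eq_flow h hs ht htT hf ht' _).2, hXZ, X_label hf (hgood t htT) ht']

end Uniqueness

/-! ### Translations of functions with integrable derivative -/

section Translation

theorem integrable_shift_prod {v : ℝ → ℝ} (hv : Integrable v) (a b : ℝ) :
    Integrable (fun p : ℝ × ℝ => v (p.2 - p.1)) (volume.prod (volume.restrict (uIoc a b))) := by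
  have : IsFiniteMeasure (volume.restrict (uIoc a b)) := by
    rw [uIoc]
    infer_instance
  have := (integrable_const (μ := volume.restrict (uIoc a b)) (1 : ℝ)).convolution_integrand
    (ContinuousLinearMap.mul ℝ ℝ) hv.comp_neg
  simpa using this

theorem integrable_shift_interval {v : ℝ → ℝ} (hv : Integrable v) (a b : ℝ) :
    Integrable fun x => ∫ s in b..a, v (s - x) := by
  simp_rw [intervalIntegral.intervalIntegral_eq_integral_uIoc]
  exact (integrable_shift_prod hv b a).integral_prod_left.const_mul _

/-- Fubini and translation invariance. With v = f', this bounds the L¹ norm of the difference of two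
translates of f. -/
theorem integral_norm_shift_interval_le {v : ℝ → ℝ} (hv : Integrable v) (a b : ℝ) :
    ∫ x, ‖∫ s in b..a, v (s - x)‖ ≤ |a - b| * ∫ x, ‖v x‖ := by
  have hp := (integrable_shift_prod hv b a).norm
  calc ∫ x, ‖∫ s in b..a, v (s - x)‖
      ≤ ∫ x, ∫ s in uIoc b a, ‖v (s - x)‖ :=
        integral_mono_of_nonneg (Eventually.of_forall fun x => norm_nonneg _)
          hp.integral_prod_left (Eventually.of_forall fun x =>
            intervalIntegral.norm_integral_le_integral_norm_uIoc)
    _ = ∫ s in uIoc b a, ∫ x, ‖v (s - x)‖ := integral_integral_swap hp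
    _ = |a - b| * ∫ x, ‖v x‖ := by
      have : ∀ s : ℝ, ∫ x, ‖v (s - x)‖ = ∫ x, ‖v x‖ := fun s =>
        integral_sub_left_eq_self (fun x => ‖v x‖) volume s
      simp_rw [this]
      simp [uIoc, Measure.real, max_sub_min_eq_abs]

/-- If v = f', this says that φ ⋆ f is a primitive of φ ⋆ v: the derivative falls on f, and φ need
only be bounded and measurable. -/
theorem integral_mul_shift_interval {v φ : ℝ → ℝ} (hv : Integrable v) (hφ : Measurable φ) {M : ℝ}
    (hM : ∀ x, ‖φ x‖ ≤ M) (a b : ℝ) :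
    ∫ x, φ x * ∫ s in b..a, v (s - x) = ∫ s in b..a, ∫ x, φ (s - x) * v x := by
  have hp : Integrable (fun p : ℝ × ℝ => φ p.1 * v (p.2 - p.1))
      (volume.prod (volume.restrict (uIoc b a))) :=
    (integrable_shift_prod hv b a).bdd_mul (hφ.comp measurable_fst).aestronglyMeasurable
      (Eventually.of_forall fun p => hM p.1)
  have hs : ∀ s : ℝ, ∫ x, φ (s - x) * v x = ∫ x, φ x * v (s - x) := fun s => by
    rw [← integral_sub_left_eq_self (fun x => φ (s - x) * v x) volume s]
    simp
  simp_rw [hs, intervalIntegral.intervalIntegral_eq_integral_uIoc]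
  rw [← integral_integral_swap hp]
  simp_rw [smul_eq_mul, mul_left_comm (φ _), integral_const_mul]

theorem sub_eq_shift_interval {f v : ℝ → ℝ} (hf : ∀ a b, f a - f b = ∫ s in b..a, v s)
    (a b x : ℝ) : f (a - x) - f (b - x) = ∫ s in b..a, v (s - x) := by
  rw [hf, intervalIntegral.integral_comp_sub_right]

end Translation

/-! ### Smooth data: modulus of continuity of convolutions -/

section Smooth

variable {L : ℝ≥0} {ψ Ψ k ρ₀ u₀ θ : ℝ → ℝ} {X G : ℝ → ℝ → ℝ} {b : ℝ}

theorem pconv_eq_euler (h : Data L ψ Ψ k ρ₀ u₀ θ) (hf : IsFlow Ψ k ρ₀ u₀ θ X G) (hb : 0 ≤ b)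
    (hg : Good X b) {t : ℝ} (ht : t ∈ Icc 0 b) (φ : ℝ → ℝ) (z : ℝ) :
    pconv φ ρ₀ (X t) z = ∫ x, φ x * eulerRho ρ₀ X t (z - x) := by
  rw [pconv, ← (isPush_euler h hf hb hg ht).1.integral_eq fun x => φ (z - x),
    ← integral_sub_left_eq_self (fun x => φ (z - x) * eulerRho ρ₀ X t x) volume z]
  simp

theorem integrable_eulerRho (h : Data L ψ Ψ k ρ₀ u₀ θ) (hf : IsFlow Ψ k ρ₀ u₀ θ X G) (hb : 0 ≤ b)
    (hg : Good X b) {t : ℝ} (ht : t ∈ Icc 0 b) :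
    Integrable (eulerRho ρ₀ X t) ∧ ∫ z, eulerRho ρ₀ X t z = 1 := by
  have hp := (isPush_euler h hf hb hg ht).1
  have h1 := (hp.integrable_iff fun _ => 1).2 (by simpa using h.ρ_integrable)
  have h2 := hp.integral_eq fun _ => 1
  simp only [one_mul] at h1 h2
  exact ⟨h1, h2.trans h.mass_one⟩

/-- Modulus of continuity of convolutions with the transported density, in terms of a modulus of
continuity of the Jacobian. -/
theorem exists_pconv_sub_le (h : Data L ψ Ψ k ρ₀ u₀ θ) (hf : IsFlow Ψ k ρ₀ u₀ θ X G) (hb : 0 ≤ b)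
    (hg : Good X b) (hρ : ContDiff ℝ 1 ρ₀) (hρi : Integrable (deriv ρ₀)) :
    ∃ A : ℝ, 0 ≤ A ∧ ∀ t ∈ Icc 0 b, ∀ D ε : ℝ, 0 ≤ D → 0 ≤ ε →
      (∀ x y, |deriv (X t) x - deriv (X t) y| ≤ D * (|x - y| + ε)) →
      ∀ φ : ℝ → ℝ, Measurable φ → (∀ x, ‖φ x‖ ≤ L) → ∀ z z',
        |pconv φ ρ₀ (X t) z - pconv φ ρ₀ (X t) z'| ≤ A * (1 + D) * (|z - z'| + ε) := by
  obtain ⟨c, hc, hJ⟩ := hg.exists_le_deriv h hf hb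
  obtain ⟨κ, hκ⟩ := hg.exists_antilipschitz
  obtain ⟨M, hM⟩ := hf.lipschitz h b
  set N := ∫ x, ‖deriv ρ₀ x‖ with hN
  have hN0 : 0 ≤ N := integral_nonneg fun x => norm_nonneg _
  have hL := L.coe_nonneg
  refine ⟨L * (M * N / c / c + (κ + 1) / c), by positivity, fun t ht D ε hD hε hmod φ hφ hφL z z' => ?_⟩
  have hlab := fun z => X_label hf hg ht z
  have hY := fun z => hasDerivAt_label_space h hf hb hg ht z
  have hJt := hJ t ht
  have hYlip : ∀ a b, |label X t a - label X t b| ≤ κ * |a - b| := fun a b => by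
    have := (hκ t ht).le_mul_dist (label X t a) (label X t b)
    rwa [hlab, hlab, Real.dist_eq, Real.dist_eq] at this
  have hYanti : AntilipschitzWith M (label X t) := by
    refine AntilipschitzWith.of_le_mul_dist fun x y => ?_
    have := (hM t ht (label X t x) (label X t y)).1
    rwa [hlab, hlab] at this
  have hYc : Continuous (label X t) :=
    continuous_iff_continuousAt.2 fun z => (hY z).continuousAt
  have hJc : Continuous (deriv (X t)) := by
    have := (hf.hasJacobian h hb hg).continuousOn_J.comp (f := fun x : ℝ => (t, x)) (s := univ)
      (by fun_prop) fun x _ => ⟨ht, trivial⟩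
    exact continuousOn_univ.1 this
  -- The derivative of ρ₀ ∘ label. The factor 1/J is not yet known to be differentiable and enters
  -- only through its modulus of continuity.
  set v : ℝ → ℝ := fun z => deriv ρ₀ (label X t z) * (deriv (X t) (label X t z))⁻¹ with hv
  have hρd : ∀ x, HasDerivAt ρ₀ (deriv ρ₀ x) x := fun x =>
    (hρ.differentiable one_ne_zero x).hasDerivAt
  have hvc : Continuous v := ((hρ.continuous_deriv le_rfl).comp hYc).mul
    ((hJc.comp hYc).inv₀ fun z => (hc.trans_le (hJt _)).ne')
  have hvle : ∀ z, ‖v z‖ ≤ c⁻¹ * ‖deriv ρ₀ (label X t z)‖ := fun z => by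
    rw [hv, norm_mul, mul_comm, norm_inv, Real.norm_of_nonneg (hc.le.trans (hJt _))]
    gcongr
    exact hJt _
  have hi := integrable_comp_of_antilipschitz hYanti hYc.measurable hρi
  have hvi : Integrable v := (hi.norm.const_mul c⁻¹).mono' hvc.aestronglyMeasurable
    (Eventually.of_forall hvle)
  have hvN : ∫ x, ‖v x‖ ≤ M * N / c := by
    calc ∫ x, ‖v x‖ ≤ ∫ x, c⁻¹ * ‖deriv ρ₀ (label X t x)‖ :=
          integral_mono hvi.norm (hi.norm.const_mul _) hvle
      _ ≤ c⁻¹ * (M * N) := by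
          rw [integral_const_mul]
          gcongr
          exact integral_norm_comp_le hYanti hYc.measurable hρi
      _ = _ := by ring
  have hprim : ∀ a b, ρ₀ (label X t a) - ρ₀ (label X t b) = ∫ s in b..a, v s := fun a b =>
    (intervalIntegral.integral_eq_sub_of_hasDerivAt
      (f := fun z => ρ₀ (label X t z)) (fun z _ => (hρd _).comp z (hY z))
      (hvc.intervalIntegrable _ _)).symm
  obtain ⟨hri, hr1⟩ := integrable_eulerRho h hf hb hg ht
  have hrs : ∀ z, Integrable fun x => eulerRho ρ₀ X t (z - x) := fun z => hri.comp_sub_left z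
  have hrn : ∀ z, 0 ≤ eulerRho ρ₀ X t z := fun z =>
    div_nonneg (h.ρ_nonneg _) (hc.le.trans (hJt _))
  have hφi : ∀ z, Integrable fun x => φ x * eulerRho ρ₀ X t (z - x) := fun z =>
    integrable_bdd_mul hφ.aestronglyMeasurable hφL (hrs z)
  rw [pconv_eq_euler h hf hb hg ht, pconv_eq_euler h hf hb hg ht,
    ← integral_sub (hφi z) (hφi z')]
  simp_rw [← mul_sub]
  have hdi : Integrable fun x => ρ₀ (label X t (z - x)) - ρ₀ (label X t (z' - x)) := by
    simp_rw [sub_eq_shift_interval (f := fun z => ρ₀ (label X t z)) hprim]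
    exact integrable_shift_interval hvi z z'
  -- Product rule for differences applied to ρ₀(label) · (1/J): the first term is estimated by
  -- translation in L¹, the second by the modulus of J and unit mass.
  have hpt : ∀ x, ‖eulerRho ρ₀ X t (z - x) - eulerRho ρ₀ X t (z' - x)‖
      ≤ c⁻¹ * ‖ρ₀ (label X t (z - x)) - ρ₀ (label X t (z' - x))‖
        + c⁻¹ * (D * (κ * |z - z'| + ε)) * eulerRho ρ₀ X t (z' - x) := by
    intro x
    have j1 := hJt (label X t (z - x))
    have j2 := hJt (label X t (z' - x))
    have e : eulerRho ρ₀ X t (z - x) - eulerRho ρ₀ X t (z' - x)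
        = (deriv (X t) (label X t (z - x)))⁻¹
            * (ρ₀ (label X t (z - x)) - ρ₀ (label X t (z' - x)))
          + (deriv (X t) (label X t (z - x)))⁻¹
            * (deriv (X t) (label X t (z' - x)) - deriv (X t) (label X t (z - x)))
            * eulerRho ρ₀ X t (z' - x) := by
      have n1 := (hc.trans_le j1).ne'
      have n2 := (hc.trans_le j2).ne'
      rw [eulerRho, eulerRho]
      field_simp
      ring
    have hi : ‖(deriv (X t) (label X t (z - x)))⁻¹‖ ≤ c⁻¹ := by
      rw [norm_inv, Real.norm_of_nonneg (hc.le.trans j1)]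
      gcongr
    rw [e]
    refine (norm_add_le _ _).trans (add_le_add ?_ ?_)
    · rw [norm_mul]
      gcongr
    · rw [norm_mul, norm_mul, Real.norm_of_nonneg (hrn _)]
      refine mul_le_mul_of_nonneg_right ?_ (hrn _)
      refine mul_le_mul hi ?_ (norm_nonneg _) (by positivity)
      refine (hmod _ _).trans ?_
      gcongr
      refine (hYlip _ _).trans (le_of_eq ?_)
      rw [sub_sub_sub_cancel_right, abs_sub_comm]
  have hfin : ∫ x, ‖eulerRho ρ₀ X t (z - x) - eulerRho ρ₀ X t (z' - x)‖
      ≤ c⁻¹ * (|z - z'| * (M * N / c)) + c⁻¹ * (D * (κ * |z - z'| + ε)) := by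
    refine (integral_mono (g := fun x => c⁻¹ * ‖ρ₀ (label X t (z - x)) - ρ₀ (label X t (z' - x))‖
        + c⁻¹ * (D * (κ * |z - z'| + ε)) * eulerRho ρ₀ X t (z' - x)) ((hrs z).sub (hrs z')).norm
      ((hdi.norm.const_mul _).add ((hrs z').const_mul _)) hpt).trans ?_
    rw [integral_add (hdi.norm.const_mul _) ((hrs z').const_mul _), integral_const_mul,
      integral_const_mul, integral_sub_left_eq_self (eulerRho ρ₀ X t) volume z', hr1, mul_one]
    gcongr
    simp_rw [sub_eq_shift_interval (f := fun z => ρ₀ (label X t z)) hprim]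
    refine (integral_norm_shift_interval_le hvi z z').trans ?_
    gcongr
  refine (norm_integral_mul_le hφL ((hrs z).sub (hrs z'))).trans ?_
  refine (mul_le_mul_of_nonneg_left hfin hL).trans ?_
  have hz := abs_nonneg (z - z')
  have hκ0 := κ.coe_nonneg
  have hM0 := M.coe_nonneg
  have e1 : |z - z'| ≤ (1 + D) * (|z - z'| + ε) := by
    nlinarith [mul_nonneg hD hz, mul_nonneg hD hε]
  have e2 : D * (κ * |z - z'| + ε) ≤ (κ + 1) * ((1 + D) * (|z - z'| + ε)) := by
    nlinarith [mul_nonneg hD hz, mul_nonneg hD hε, mul_nonneg hκ0 hz, mul_nonneg hκ0 hε,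
      mul_nonneg hκ0 (mul_nonneg hD hε)]
  calc L * (c⁻¹ * (|z - z'| * (M * N / c)) + c⁻¹ * (D * (κ * |z - z'| + ε)))
      ≤ L * (c⁻¹ * (((1 + D) * (|z - z'| + ε)) * (M * N / c))
          + c⁻¹ * ((κ + 1) * ((1 + D) * (|z - z'| + ε)))) := by gcongr
    _ = _ := by ring

end Smooth

/-! ### Smooth data: Lipschitz bounds for the Jacobian -/

section Smooth

variable {L : ℝ≥0} {ψ Ψ k ρ₀ u₀ θ : ℝ → ℝ} {X G : ℝ → ℝ → ℝ} {b : ℝ}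

theorem Data.norm_pconv_le (h : Data L ψ Ψ k ρ₀ u₀ θ) {φ : ℝ → ℝ} (hφ : ∀ x, ‖φ x‖ ≤ L)
    (Y : ℝ → ℝ) (z : ℝ) : |pconv φ ρ₀ Y z| ≤ L := by
  have := norm_integral_mul_le (f := fun y => φ (z - Y y)) (fun _ => hφ _) h.ρ_integrable
  simp only [Real.norm_of_nonneg (h.ρ_nonneg _), h.mass_one, mul_one] at this
  exact this

theorem IsFlow.exists_deriv_bound (h : Data L ψ Ψ k ρ₀ u₀ θ) (hf : IsFlow Ψ k ρ₀ u₀ θ X G)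
    (b : ℝ) : ∃ M : ℝ≥0, ∀ t ∈ Icc 0 b, (∀ x y, |X t x - X t y| ≤ M * |x - y|) ∧
      ∀ x, |deriv (X t) x| ≤ M ∧ |deriv (G t) x| ≤ M := by
  obtain ⟨M, hM⟩ := hf.lipschitz h b
  refine ⟨M, fun t ht => ⟨fun x y => (hM t ht x y).1, fun x => ⟨?_, ?_⟩⟩⟩
  · exact norm_deriv_le_of_lipschitz (LipschitzWith.of_dist_le_mul (f := X t)
      fun x y => (hM t ht x y).1)
  · exact norm_deriv_le_of_lipschitz (LipschitzWith.of_dist_le_mul (f := G t)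
      fun x y => (hM t ht x y).2)

theorem abs_mul_sub_mul_le (a b c d : ℝ) : |a * b - c * d| ≤ |a| * |b - d| + |a - c| * |d| := by
  rw [show a * b - c * d = a * (b - d) + (a - c) * d by ring, ← abs_mul, ← abs_mul]
  exact abs_add_le _ _

/-- For smooth data the Jacobian is Lipschitz in space. -/
theorem exists_jacobian_lipschitz (h : Data L ψ Ψ k ρ₀ u₀ θ) (hf : IsFlow Ψ k ρ₀ u₀ θ X G)
    (hb : 0 ≤ b) (hg : Good X b) (hρ : ContDiff ℝ 1 ρ₀) (hρi : Integrable (deriv ρ₀))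
    {A₀ : ℝ} (hA₀ : 0 ≤ A₀) (hG : ∀ x y, |deriv (G 0) x - deriv (G 0) y| ≤ A₀ * |x - y|) :
    ∃ D : ℝ, 0 ≤ D ∧ ∀ t ∈ Icc 0 b, ∀ x y, |deriv (X t) x - deriv (X t) y| ≤ D * |x - y| ∧
      |deriv (G t) x - deriv (G t) y| ≤ D * |x - y| := by
  obtain ⟨A, hA0, hA⟩ := exists_pconv_sub_le h hf hb hg hρ hρi
  obtain ⟨M, hM⟩ := hf.exists_deriv_bound h b
  have hj := hf.hasJacobian h hb hg
  have hL := L.coe_nonneg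
  have hM0 := M.coe_nonneg
  set A' : ℝ := M * (A * (M + 1)) with hA'
  have hA'0 : 0 ≤ A' := by positivity
  set Q : ℝ := 1 + L + A' with hQ
  have hQ0 : 0 < Q := by positivity
  have hφ : ∀ φ : ℝ → ℝ, Measurable φ → (∀ x, ‖φ x‖ ≤ L) → ∀ t ∈ Icc 0 b, ∀ D ε : ℝ, 0 ≤ D →
      0 ≤ ε → (∀ x y, |deriv (X t) x - deriv (X t) y| ≤ D * (|x - y| + ε)) → ∀ x y,
      |pconv φ ρ₀ (X t) (X t x) * deriv (X t) x - pconv φ ρ₀ (X t) (X t y) * deriv (X t) y|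
        ≤ (L * D + A' * (1 + D)) * (|x - y| + ε) := by
    intro φ hφm hφL t ht D ε hD hε hmod x y
    have h1 := hA t ht D ε hD hε hmod φ hφm hφL (X t x) (X t y)
    have h2 : |X t x - X t y| + ε ≤ (M + 1) * (|x - y| + ε) := by
      have := (hM t ht).1 x y
      nlinarith [abs_nonneg (x - y), mul_nonneg hM0 hε]
    refine (abs_mul_sub_mul_le _ _ _ _).trans ?_
    calc _ ≤ L * (D * (|x - y| + ε)) + (A * (1 + D) * ((M + 1) * (|x - y| + ε))) * M := by
          gcongr
          · exact h.norm_pconv_le hφL _ _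
          · exact hmod x y
          · exact h1.trans (by gcongr)
          · exact ((hM t ht).2 y).1
      _ = _ := by rw [hA']; ring
  let F : ℝ → ℝ → ℝ → ℝ × ℝ := fun t x y =>
    (deriv (X t) x - deriv (X t) y, deriv (G t) x - deriv (G t) y)
  have hFc : ∀ x y, ContinuousOn (fun t => F t x y) (Icc 0 b) := fun x y => by
    have c1 : ∀ x, ContinuousOn (fun t => deriv (X t) x) (Icc 0 b) := fun x =>
      hj.continuousOn_J.comp (f := fun t : ℝ => (t, x)) (by fun_prop) fun t ht => ⟨ht, trivial⟩
    have c2 : ∀ x, ContinuousOn (fun t => deriv (G t) x) (Icc 0 b) := fun x =>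
      hj.continuousOn_g.comp (f := fun t : ℝ => (t, x)) (by fun_prop) fun t ht => ⟨ht, trivial⟩
    exact ((c1 x).sub (c1 y)).prodMk ((c2 x).sub (c2 y))
  have hF0 : ∀ x y, ‖F 0 x y‖ ≤ A₀ * |x - y| := fun x y => by
    refine norm_prod_le_iff.2 ⟨?_, hG x y⟩
    simp only [F, hf.X_zero_eq, deriv_id, sub_self, norm_zero]
    positivity
  -- The halving argument needs a finite bound to begin with, but J is so far only bounded.
  -- Replacing |x - y| by |x - y| + ε gives the initial constant 2M / ε, which disappears from the
  -- conclusion, so ε can tend to 0.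
  have key : ∀ ε > 0, ∀ t ∈ Icc 0 b, ∀ x y,
      ‖F t x y‖ ≤ 2 * (A₀ + A' * b) * (Real.exp (2 * Q * t) * (|x - y| + ε)) := by
    intro ε hε t ht x y
    have := le_of_halving (ι := Icc 0 b × ℝ × ℝ) (f := fun i => ‖F i.1 i.2.1 i.2.2‖)
      (g := fun i => Real.exp (2 * Q * i.1) * (|i.2.1 - i.2.2| + ε)) (fun i => by positivity)
      (A := A₀ + A' * b) (M₀ := (2 * M) / ε) (by positivity) ?_ ?_ (⟨t, ht⟩, x, y)
    · exact this
    · rintro ⟨⟨t, ht⟩, x, y⟩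
      have h1 : ‖F t x y‖ ≤ 2 * M := by
        refine norm_prod_le_iff.2 ⟨?_, ?_⟩
        · exact (abs_sub _ _).trans (by linarith [((hM t ht).2 x).1, ((hM t ht).2 y).1])
        · exact (abs_sub _ _).trans (by linarith [((hM t ht).2 x).2, ((hM t ht).2 y).2])
      have h2 : ε ≤ Real.exp (2 * Q * t) * (|x - y| + ε) := by
        have e1 : 1 ≤ Real.exp (2 * Q * t) := Real.one_le_exp (mul_nonneg (by positivity) ht.1)
        nlinarith [abs_nonneg (x - y)]
      calc ‖F t x y‖ ≤ 2 * M := h1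
        _ = 2 * M / ε * ε := by field_simp
        _ ≤ _ := by
          simp only
          gcongr
    · rintro N hN hle ⟨⟨t, ht⟩, x, y⟩
      have hle' : ∀ t ∈ Icc 0 b, ∀ x y,
          ‖F t x y‖ ≤ N * Real.exp (2 * Q * t) * (|x - y| + ε) := fun t ht x y => by
        rw [mul_assoc]
        exact hle (⟨t, ht⟩, x, y)
      set w := |x - y| + ε with hw
      have hw0 : 0 < w := by positivity
      have hb' := norm_le_of_norm_deriv_le_exp (l := 2 * Q) (A := A' * w) (B := Q * N * w)
        (by positivity) (hFc x y) (fun t ht => ((hj.hasDerivAt_J t ht x).sub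
          (hj.hasDerivAt_J t ht y)).prodMk ((hj.hasDerivAt_g t ht x).sub (hj.hasDerivAt_g t ht y)))
        ?_ (by positivity) t ht
      · have e1 : 1 ≤ Real.exp (2 * Q * t) := Real.one_le_exp (mul_nonneg (by positivity) ht.1)
        have e2 : ‖F 0 x y‖ ≤ A₀ * w := (hF0 x y).trans (by gcongr; simp [hw, hε.le])
        have e3 : A' * w * t ≤ A' * w * b := by
          gcongr
          exact ht.2
        have e4 : Q * N * w / (2 * Q) = N / 2 * w := by field_simp
        have e5 : (A₀ + A' * b) * w ≤ (A₀ + A' * b) * w * Real.exp (2 * Q * t) :=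
          le_mul_of_one_le_right (by positivity) e1
        rw [e4] at hb'
        refine hb'.trans ?_
        simp only
        linarith
      · intro s hs
        have hs' := Ioo_subset_Icc_self hs
        set D := N * Real.exp (2 * Q * s) with hD
        have hD0 : 0 ≤ D := by positivity
        have hmod : ∀ x y, |deriv (X s) x - deriv (X s) y| ≤ D * (|x - y| + ε) := fun x y =>
          (norm_fst_le (F s x y)).trans (hle' s hs' x y)
        have h1 := hφ ψ h.ψ_continuous.measurable h.norm_ψ_le s hs' D ε hD0 hε.le hmod x y
        have h2 := hφ (deriv k) (measurable_deriv k) (fun x => norm_deriv_le_of_lipschitz h.k_lip)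
          s hs' D ε hD0 hε.le hmod x y
        have h3 := (norm_snd_le (F s x y)).trans (hle' s hs' x y)
        rw [← hw] at h1 h2 h3
        have e : A' * w + Q * N * w * Real.exp (2 * Q * s)
            = D * w + (L * D + A' * (1 + D)) * w := by
          rw [hQ, hD]; ring
        rw [e]
        refine norm_prod_le_iff.2 ⟨?_, ?_⟩
        · simp only [Real.norm_eq_abs]
          rw [sub_sub_sub_comm]
          exact (abs_sub _ _).trans (add_le_add h3 h1)
        · simp only [Real.norm_eq_abs]
          rw [neg_sub_neg, abs_sub_comm]
          exact h2.trans (le_add_of_nonneg_left (by positivity))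
  refine ⟨2 * (A₀ + A' * b) * Real.exp (2 * Q * b), by positivity, fun t ht x y => ?_⟩
  have hfin : ‖F t x y‖ ≤ 2 * (A₀ + A' * b) * Real.exp (2 * Q * b) * |x - y| := by
    set D := 2 * (A₀ + A' * b) * Real.exp (2 * Q * b) with hD
    have hD0 : 0 ≤ D := by positivity
    have hlim : Tendsto (fun ε : ℝ => D * (|x - y| + ε)) (𝓝[>] 0) (𝓝 (D * (|x - y| + 0))) :=
      (Continuous.tendsto (by fun_prop) _).mono_left nhdsWithin_le_nhds
    rw [add_zero] at hlim
    refine ge_of_tendsto hlim ?_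
    filter_upwards [self_mem_nhdsWithin] with ε hε
    have hε' : (0 : ℝ) < ε := hε
    refine (key ε hε t ht x y).trans ?_
    rw [hD, mul_assoc _ _ (|x - y| + ε)]
    gcongr
    exact ht.2
  exact norm_prod_le_iff.1 hfin

theorem abs_sub_le_of_hasDerivAt {f f' : ℝ → ℝ} {C : ℝ} (hf : ContinuousOn f (Icc 0 b))
    (hd : ∀ t ∈ Ioo 0 b, HasDerivAt f (f' t) t) (hC : ∀ t ∈ Ioo 0 b, |f' t| ≤ C) {s t : ℝ}
    (hs : s ∈ Icc 0 b) (ht : t ∈ Icc 0 b) : |f t - f s| ≤ C * |t - s| := by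
  have key : ∀ s ∈ Icc 0 b, ∀ t ∈ Icc 0 b, s < t → |f t - f s| ≤ C * |t - s| := by
    intro s hs t ht hst
    obtain ⟨r, hr, hr'⟩ := exists_hasDerivAt_eq_slope f f' hst (hf.mono (Icc_subset_Icc hs.1 ht.2))
      fun x hx => hd x ⟨hs.1.trans_lt hx.1, hx.2.trans_le ht.2⟩
    rw [eq_div_iff (sub_pos.2 hst).ne'] at hr'
    rw [← hr', abs_mul]
    gcongr
    exact hC r ⟨hs.1.trans_lt hr.1, hr.2.trans_le ht.2⟩
  rcases lt_trichotomy s t with hst | rfl | hst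
  · exact key s hs t ht hst
  · simp
  · rw [abs_sub_comm, abs_sub_comm t]
    exact key t ht s hs hst

theorem abs_inv_sub_inv_le {c x y : ℝ} (hc : 0 < c) (hx : c ≤ x) (hy : c ≤ y) :
    |x⁻¹ - y⁻¹| ≤ c⁻¹ * c⁻¹ * |x - y| := by
  have hx0 := hc.trans_le hx
  have hy0 := hc.trans_le hy
  rw [show x⁻¹ - y⁻¹ = x⁻¹ * y⁻¹ * (y - x) by field_simp, abs_mul, abs_sub_comm y,
    abs_of_pos (by positivity)]
  gcongr

/-- For smooth data the inverse Jacobian is Lipschitz in space and time, and so are its increments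
in time. -/
theorem exists_inv_jacobian_lipschitz (h : Data L ψ Ψ k ρ₀ u₀ θ) (hf : IsFlow Ψ k ρ₀ u₀ θ X G)
    (hb : 0 ≤ b) (hg : Good X b) (hρ : ContDiff ℝ 1 ρ₀) (hρi : Integrable (deriv ρ₀))
    {A₀ : ℝ} (hA₀ : 0 ≤ A₀) (hG : ∀ x y, |deriv (G 0) x - deriv (G 0) y| ≤ A₀ * |x - y|) :
    ∃ C : ℝ, 0 ≤ C ∧ ∀ t ∈ Icc 0 b, (∀ x, |(deriv (X t) x)⁻¹| ≤ C) ∧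
      (∀ x y, |(deriv (X t) x)⁻¹ - (deriv (X t) y)⁻¹| ≤ C * |x - y|) ∧
      ∀ s ∈ Icc 0 b, (∀ x, |(deriv (X t) x)⁻¹ - (deriv (X s) x)⁻¹| ≤ C * |t - s|) ∧
        ∀ x y, |((deriv (X t) x)⁻¹ - (deriv (X s) x)⁻¹) - ((deriv (X t) y)⁻¹ - (deriv (X s) y)⁻¹)|
          ≤ C * |t - s| * |x - y| := by
  obtain ⟨A, hA0, hA⟩ := exists_pconv_sub_le h hf hb hg hρ hρi
  obtain ⟨D, hD0, hD⟩ := exists_jacobian_lipschitz h hf hb hg hρ hρi hA₀ hG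
  obtain ⟨M, hM⟩ := hf.exists_deriv_bound h b
  obtain ⟨c, hc, hJ⟩ := hg.exists_le_deriv h hf hb
  have hj := hf.hasJacobian h hb hg
  have hL := L.coe_nonneg
  have hM0 := M.coe_nonneg
  have hJp : ∀ t ∈ Icc 0 b, ∀ x, 0 < deriv (X t) x := fun t ht x => hc.trans_le (hJ t ht x)
  have hι : ∀ t ∈ Icc 0 b, ∀ x, |(deriv (X t) x)⁻¹| ≤ c⁻¹ := fun t ht x => by
    rw [abs_of_pos (inv_pos.2 (hJp t ht x))]
    exact inv_anti₀ hc (hJ t ht x)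
  have hιx : ∀ t ∈ Icc 0 b, ∀ x y, |(deriv (X t) x)⁻¹ - (deriv (X t) y)⁻¹|
      ≤ c⁻¹ * c⁻¹ * D * |x - y| := fun t ht x y => by
    refine (abs_inv_sub_inv_le hc (hJ t ht x) (hJ t ht y)).trans ?_
    rw [mul_assoc _ D]
    gcongr
    exact (hD t ht x y).1
  have hιc : ∀ x, ContinuousOn (fun t => (deriv (X t) x)⁻¹) (Icc 0 b) := fun x =>
    (hj.continuousOn_J.comp (f := fun t : ℝ => (t, x)) (by fun_prop)
      fun t ht => ⟨ht, trivial⟩).inv₀ fun t ht => (hJp t ht x).ne'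
  have hιd : ∀ x, ∀ t ∈ Ioo 0 b, HasDerivAt (fun s => (deriv (X s) x)⁻¹)
      (-(velX ψ ρ₀ X G t x * ((deriv (X t) x)⁻¹ * (deriv (X t) x)⁻¹))) t := fun x t ht => by
    refine ((hj.hasDerivAt_J t ht x).inv (hJp t (Ioo_subset_Icc_self ht) x).ne').congr_deriv ?_
    rw [velX]
    ring
  have hH : ∀ t ∈ Icc 0 b, ∀ x, |velX ψ ρ₀ X G t x| ≤ M + L * M := fun t ht x => by
    refine (abs_sub _ _).trans (add_le_add ((hM t ht).2 x).2 ?_)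
    rw [abs_mul]
    exact mul_le_mul (h.norm_pconv_le h.norm_ψ_le _ _) ((hM t ht).2 x).1 (abs_nonneg _) hL
  set E : ℝ := D + (L * D + A * (1 + D) * M * M) with hE
  have hE0 : 0 ≤ E := by positivity
  have hHx : ∀ t ∈ Icc 0 b, ∀ x y, |velX ψ ρ₀ X G t x - velX ψ ρ₀ X G t y| ≤ E * |x - y| := by
    intro t ht x y
    have h1 := hA t ht D 0 hD0 le_rfl (fun x y => by rw [add_zero]; exact (hD t ht x y).1) ψ
      h.ψ_continuous.measurable h.norm_ψ_le (X t x) (X t y)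
    rw [add_zero] at h1
    rw [velX, velX, sub_sub_sub_comm]
    refine (abs_sub _ _).trans ((add_le_add (hD t ht x y).2 (abs_mul_sub_mul_le _ _ _ _)).trans ?_)
    calc _ ≤ D * |x - y| + (L * (D * |x - y|) + (A * (1 + D) * (M * |x - y|)) * M) := by
          gcongr
          · exact h.norm_pconv_le h.norm_ψ_le _ _
          · exact (hD t ht x y).1
          · exact h1.trans (by gcongr; exact (hM t ht).1 x y)
          · exact ((hM t ht).2 y).1
      _ = _ := by rw [hE]; ring
  set C₁ := (M + L * M) * (c⁻¹ * c⁻¹) with hC₁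
  set C₂ := (M + L * M) * (c⁻¹ * (c⁻¹ * c⁻¹ * D) + c⁻¹ * c⁻¹ * D * c⁻¹) + E * (c⁻¹ * c⁻¹) with hC₂
  have h1 : 0 ≤ c⁻¹ := by positivity
  have h2 : 0 ≤ c⁻¹ * c⁻¹ * D := by positivity
  have h3 : 0 ≤ C₁ := by positivity
  have h4 : 0 ≤ C₂ := by positivity
  refine ⟨c⁻¹ + c⁻¹ * c⁻¹ * D + C₁ + C₂, by positivity, fun t ht => ⟨fun x => ?_, fun x y => ?_,
    fun s hs => ⟨fun x => ?_, fun x y => ?_⟩⟩⟩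
  · exact (hι t ht x).trans (by linarith)
  · exact (hιx t ht x y).trans (by gcongr; linarith)
  · refine (abs_sub_le_of_hasDerivAt (C := C₁) (hιc x) (hιd x) (fun r hr => ?_) hs ht).trans
      (by gcongr; linarith)
    have hr' := Ioo_subset_Icc_self hr
    rw [abs_neg, abs_mul, abs_mul]
    have := hι r hr' x
    exact mul_le_mul (hH r hr' x) (mul_le_mul this this (abs_nonneg _) h1) (by positivity)
      (by positivity)
  · have e : ((deriv (X t) x)⁻¹ - (deriv (X s) x)⁻¹) - ((deriv (X t) y)⁻¹ - (deriv (X s) y)⁻¹)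
        = ((deriv (X t) x)⁻¹ - (deriv (X t) y)⁻¹) - ((deriv (X s) x)⁻¹ - (deriv (X s) y)⁻¹) := by
      ring
    rw [e]
    refine (abs_sub_le_of_hasDerivAt (f := fun t => (deriv (X t) x)⁻¹ - (deriv (X t) y)⁻¹)
      (C := C₂ * |x - y|) ((hιc x).sub (hιc y))
      (fun r hr => (hιd x r hr).sub (hιd y r hr)) (fun r hr => ?_) hs ht).trans ?_
    · have hr' := Ioo_subset_Icc_self hr
      rw [neg_sub_neg, abs_sub_comm]
      refine (abs_mul_sub_mul_le _ _ _ _).trans ?_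
      have i1 : |(deriv (X r) x)⁻¹ * (deriv (X r) x)⁻¹ - (deriv (X r) y)⁻¹ * (deriv (X r) y)⁻¹|
          ≤ c⁻¹ * (c⁻¹ * c⁻¹ * D * |x - y|) + (c⁻¹ * c⁻¹ * D * |x - y|) * c⁻¹ := by
        refine (abs_mul_sub_mul_le _ _ _ _).trans ?_
        gcongr
        · exact hι r hr' x
        · exact hιx r hr' x y
        · exact hιx r hr' x y
        · exact hι r hr' y
      have i2 : |(deriv (X r) y)⁻¹ * (deriv (X r) y)⁻¹| ≤ c⁻¹ * c⁻¹ := by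
        rw [abs_mul]
        exact mul_le_mul (hι r hr' y) (hι r hr' y) (abs_nonneg _) h1
      calc _ ≤ (M + L * M) * (c⁻¹ * (c⁻¹ * c⁻¹ * D * |x - y|) + (c⁻¹ * c⁻¹ * D * |x - y|) * c⁻¹)
            + (E * |x - y|) * (c⁻¹ * c⁻¹) := by
            gcongr
            · exact hH r hr' x
            · exact hHx r hr' x y
        _ = _ := by rw [hC₂]; ring
    · rw [mul_right_comm]
      gcongr
      linarith

end Smooth

/-! ### Products of smooth and Lipschitz functions -/

section Product

variable {f j : ℝ → ℝ} {C : ℝ}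

theorem lipschitzWith_toNNReal (hC : 0 ≤ C) (hl : ∀ x y, |j x - j y| ≤ C * |x - y|) :
    LipschitzWith C.toNNReal j :=
  LipschitzWith.of_dist_le_mul fun x y => by
    rw [Real.coe_toNNReal _ hC]
    exact hl x y

theorem ae_deriv_mul (hf : ContDiff ℝ 1 f) (hC : 0 ≤ C) (hl : ∀ x y, |j x - j y| ≤ C * |x - y|) :
    ∀ᵐ x, DifferentiableAt ℝ j x ∧
      deriv (fun x => f x * j x) x = deriv f x * j x + f x * deriv j x := by
  filter_upwards [(lipschitzWith_toNNReal hC hl).ae_differentiableAt_real] with x hx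
  exact ⟨hx, ((hf.differentiable one_ne_zero x).hasDerivAt.mul hx.hasDerivAt).deriv⟩

/-- The product of a function in `C¹ ∩ W^{1,1}` and a bounded Lipschitz function is in `W^{1,1}`. -/
theorem integrable_deriv_mul (hf : ContDiff ℝ 1 f) (hi : Integrable f) (hi' : Integrable (deriv f))
    (hC : 0 ≤ C) (hb : ∀ x, |j x| ≤ C) (hl : ∀ x y, |j x - j y| ≤ C * |x - y|) :
    Integrable (deriv fun x => f x * j x) ∧
      ∫ x, ‖deriv (fun x => f x * j x) x‖ ≤ C * ((∫ x, ‖deriv f x‖) + ∫ x, ‖f x‖) := by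
  have hle : ∀ᵐ x, ‖deriv (fun x => f x * j x) x‖ ≤ C * (‖deriv f x‖ + ‖f x‖) := by
    filter_upwards [ae_deriv_mul hf hC hl] with x hx
    have h1 : ‖deriv j x‖ ≤ C := by
      have := norm_deriv_le_of_lipschitz (x₀ := x) (lipschitzWith_toNNReal hC hl)
      rwa [Real.coe_toNNReal _ hC] at this
    rw [hx.2]
    refine (norm_add_le _ _).trans ?_
    rw [norm_mul, norm_mul, mul_add]
    refine add_le_add ?_ ?_
    · rw [mul_comm]
      exact mul_le_mul_of_nonneg_right (hb x) (norm_nonneg _)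
    · rw [mul_comm]
      exact mul_le_mul_of_nonneg_right h1 (norm_nonneg _)
  have hg := (hi'.norm.add hi.norm).const_mul C
  have h0 : Integrable (deriv fun x => f x * j x) :=
    hg.mono' (measurable_deriv _).aestronglyMeasurable hle
  refine ⟨h0, (integral_mono_ae h0.norm hg hle).trans (le_of_eq ?_)⟩
  rw [← integral_add hi'.norm hi.norm, ← integral_const_mul]
  rfl

/-- Both factors are Lipschitz on the interval, so the product is absolutely continuous and is
recovered from its almost everywhere derivative. -/
theorem mul_sub_mul_eq_integral_deriv (hf : ContDiff ℝ 1 f) (hC : 0 ≤ C)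
    (hl : ∀ x y, |j x - j y| ≤ C * |x - y|) (a b : ℝ) :
    f a * j a - f b * j b = ∫ x in b..a, deriv (fun x => f x * j x) x := by
  have hd := hf.differentiable one_ne_zero
  obtain ⟨R, hR⟩ := (isCompact_uIcc (a := b) (b := a)).exists_bound_of_continuousOn
    (hf.continuous_deriv le_rfl).continuousOn
  have h1 : LipschitzOnWith R.toNNReal f (uIcc b a) := by
    refine (convex_uIcc b a).lipschitzOnWith_of_nnnorm_deriv_le (fun x _ => hd x) fun x hx => ?_
    rw [← NNReal.coe_le_coe]
    exact (hR x hx).trans (Real.le_coe_toNNReal R)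
  have h2 := h1.absolutelyContinuousOnInterval.fun_mul
    ((lipschitzWith_toNNReal hC hl).lipschitzOnWith (s := uIcc b a)).absolutelyContinuousOnInterval
  exact h2.integral_deriv_eq_sub.symm

end Product

/-! ### Smooth data: derivatives of convolutions -/

section Smooth

variable {L : ℝ≥0} {ψ Ψ k ρ₀ u₀ θ : ℝ → ℝ} {X G : ℝ → ℝ → ℝ} {b : ℝ}

theorem integral_comp_flow (h : Data L ψ Ψ k ρ₀ u₀ θ) (hf : IsFlow Ψ k ρ₀ u₀ θ X G) (hb : 0 ≤ b)
    (hg : Good X b) {t : ℝ} (ht : t ∈ Icc 0 b) (F : ℝ → ℝ) :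
    ∫ x, F x = ∫ y, F (X t y) * deriv (X t) y := by
  obtain ⟨c, hc, hJ⟩ := hg.exists_le_deriv h hf hb
  have h1 := integral_image_eq_integral_abs_deriv_smul (f := X t) (f' := deriv (X t))
    MeasurableSet.univ
    (fun x _ => ((hf.hasJacobian h hb hg).hasDerivAt_X t ht x).hasDerivWithinAt)
    (Function.LeftInverse.injective (label_X hg ht)).injOn F
  have h2 : X t '' univ = univ := by
    rw [image_univ]
    exact (Function.RightInverse.surjective (X_label hf hg ht)).range_eq
  rw [h2, setIntegral_univ, setIntegral_univ] at h1
  rw [h1]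
  refine integral_congr_ae (Eventually.of_forall fun y => ?_)
  simp only [smul_eq_mul]
  rw [abs_of_pos (hc.trans_le (hJ t ht y)), mul_comm]

/-- For smooth data, convolutions with the transported density are continuously differentiable. -/
theorem exists_deriv_pconv (h : Data L ψ Ψ k ρ₀ u₀ θ) (hf : IsFlow Ψ k ρ₀ u₀ θ X G)
    (hb : 0 ≤ b) (hg : Good X b) (hρ : ContDiff ℝ 1 ρ₀) (hρi : Integrable (deriv ρ₀))
    {A₀ : ℝ} (hA₀ : 0 ≤ A₀) (hG : ∀ x y, |deriv (G 0) x - deriv (G 0) y| ≤ A₀ * |x - y|)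
    {φ : ℝ → ℝ} (hφ : Measurable φ) (hφL : ∀ x, ‖φ x‖ ≤ L) :
    ∃ E : ℝ → ℝ → ℝ, (Continuous fun p : ℝ × ℝ => E p.1 p.2) ∧
      ∀ t ∈ Icc 0 b, ∀ z, HasDerivAt (pconv φ ρ₀ (X t)) (E t z) z := by
  obtain ⟨C, hC0, hC⟩ := exists_inv_jacobian_lipschitz h hf hb hg hρ hρi hA₀ hG
  obtain ⟨c, hc, hJ⟩ := hg.exists_le_deriv h hf hb
  obtain ⟨κ, hκ⟩ := hg.exists_antilipschitz
  obtain ⟨M, hM⟩ := hf.lipschitz h b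
  -- Since ρ(X y) = ρ₀ / J, the derivative of ρ at X y times J is ∂_y (ρ₀ / J). This weight carries
  -- ∂ρ to label coordinates.
  let w : ℝ → ℝ → ℝ := fun t => deriv fun y => ρ₀ y * (deriv (X (clamp b t)) y)⁻¹
  have hw := fun t => integrable_deriv_mul hρ h.ρ_integrable hρi hC0 (hC _ (clamp_mem hb t)).1
    (hC _ (clamp_mem hb t)).2.1
  -- The weight is Lipschitz in time with values in L¹. This is where the Lipschitz bound on time
  -- increments of 1/J is used.
  have hwc : ∀ t s, ∫ y, ‖w t y - w s y‖
      ≤ C * |clamp b t - clamp b s| * ((∫ x, ‖deriv ρ₀ x‖) + ∫ x, ‖ρ₀ x‖) := by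
    intro t s
    have ht := clamp_mem hb t
    have hs := clamp_mem hb s
    have h1 := (integrable_deriv_mul hρ h.ρ_integrable hρi (by positivity)
      ((hC _ ht).2.2 _ hs).1 ((hC _ ht).2.2 _ hs).2).2
    refine le_trans (le_of_eq (integral_congr_ae ?_)) h1
    filter_upwards [ae_deriv_mul hρ hC0 (hC _ ht).2.1, ae_deriv_mul hρ hC0 (hC _ hs).2.1]
      with y hy hy'
    have h2 := ((hρ.differentiable one_ne_zero y).hasDerivAt.mul
      (hy.1.hasDerivAt.sub hy'.1.hasDerivAt)).deriv
    simp only [w]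
    rw [hy.2, hy'.2]
    refine congrArg norm (Eq.trans ?_ h2.symm)
    simp only [Pi.sub_apply]
    ring
  refine ⟨fun t z => ∫ y, φ (z - X (clamp b t) y) * w t y,
    continuous_pconv_mul h hf hb hg hφ hφL (fun t => (hw t).1) (fun t₀ => ?_), fun t ht z => ?_⟩
  · have hlim : Tendsto (fun t => C * |clamp b t - clamp b t₀|
        * ((∫ x, ‖deriv ρ₀ x‖) + ∫ x, ‖ρ₀ x‖)) (𝓝 t₀)
        (𝓝 (C * |clamp b t₀ - clamp b t₀| * ((∫ x, ‖deriv ρ₀ x‖) + ∫ x, ‖ρ₀ x‖))) :=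
      Continuous.tendsto (continuous_const.mul
        (((continuous_clamp b).sub continuous_const).abs) |>.mul continuous_const) t₀
    rw [sub_self, abs_zero, mul_zero, zero_mul] at hlim
    exact squeeze_zero (fun t => integral_nonneg fun y => norm_nonneg _) (fun t => hwc t t₀) hlim
  · have hcont := continuous_pconv_mul h hf hb hg hφ hφL (w := fun _ => w t) (fun _ => (hw t).1)
      (fun _ => by simp)
    have hEc : Continuous fun s => ∫ y, φ (s - X t y) * w t y := by
      have := hcont.comp (continuous_const (y := t).prodMk continuous_id)
      simpa [Function.comp_def, clamp_eq ht] using this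
    have hY := fun z => hasDerivAt_label_space h hf hb hg ht z
    have hlab := fun z => X_label hf hg ht z
    have hYlip : ∀ a b, |label X t a - label X t b| ≤ κ * |a - b| := fun a b => by
      have := (hκ t ht).le_mul_dist (label X t a) (label X t b)
      rwa [hlab, hlab, Real.dist_eq, Real.dist_eq] at this
    have hYanti : AntilipschitzWith M (label X t) := by
      refine AntilipschitzWith.of_le_mul_dist fun x y => ?_
      have := (hM t ht (label X t x) (label X t y)).1
      rwa [hlab, hlab] at this
    have hYc : Continuous (label X t) :=
      continuous_iff_continuousAt.2 fun z => (hY z).continuousAt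
    have hρd : ∀ x, HasDerivAt ρ₀ (deriv ρ₀ x) x := fun x =>
      (hρ.differentiable one_ne_zero x).hasDerivAt
    have hJc : Continuous (deriv (X t)) := by
      have := (hf.hasJacobian h hb hg).continuousOn_J.comp (f := fun x : ℝ => (t, x)) (s := univ)
        (by fun_prop) fun x _ => ⟨ht, trivial⟩
      exact continuousOn_univ.1 this
    have hfd : ∀ z, HasDerivAt (fun z => ρ₀ (label X t z))
        (deriv ρ₀ (label X t z) * (deriv (X t) (label X t z))⁻¹) z := fun z =>
      (hρd _).comp z (hY z)
    have hfe : deriv (fun z => ρ₀ (label X t z))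
        = fun z => deriv ρ₀ (label X t z) * (deriv (X t) (label X t z))⁻¹ :=
      funext fun z => (hfd z).deriv
    have hinvc : Continuous fun z => (deriv (X t) (label X t z))⁻¹ :=
      (hJc.comp hYc).inv₀ fun z => (hc.trans_le (hJ t ht _)).ne'
    have hf1 : ContDiff ℝ 1 fun z => ρ₀ (label X t z) := by
      rw [contDiff_one_iff_deriv]
      refine ⟨fun z => (hfd z).differentiableAt, ?_⟩
      rw [hfe]
      exact ((hρ.continuous_deriv le_rfl).comp hYc).mul hinvc
    have hfi : Integrable fun z => ρ₀ (label X t z) :=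
      integrable_comp_of_antilipschitz hYanti hYc.measurable h.ρ_integrable
    have hfi' : Integrable (deriv fun z => ρ₀ (label X t z)) := by
      rw [hfe]
      exact (integrable_comp_of_antilipschitz hYanti hYc.measurable hρi).mul_bdd
        hinvc.aestronglyMeasurable (Eventually.of_forall fun z => (hC t ht).1 _)
    have hjl : ∀ x y, |(deriv (X t) (label X t x))⁻¹ - (deriv (X t) (label X t y))⁻¹|
        ≤ (C * (1 + κ)) * |x - y| := fun x y => by
      refine ((hC t ht).2.1 _ _).trans ?_
      rw [mul_assoc]
      refine mul_le_mul_of_nonneg_left ((hYlip x y).trans ?_) hC0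
      nlinarith [abs_nonneg (x - y)]
    have hjb : ∀ x, |(deriv (X t) (label X t x))⁻¹| ≤ C * (1 + κ) := fun x =>
      ((hC t ht).1 _).trans (le_mul_of_one_le_right hC0 (by simp))
    have hC1 : 0 ≤ C * (1 + κ) := by positivity
    have heq : eulerRho ρ₀ X t = fun z => ρ₀ (label X t z) * (deriv (X t) (label X t z))⁻¹ := by
      funext z
      rw [eulerRho, div_eq_mul_inv]
    have hv := (integrable_deriv_mul hf1 hfi hfi' hC1 hjb hjl).1
    have hvp := mul_sub_mul_eq_integral_deriv hf1 hC1 hjl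
    have hvd := ae_deriv_mul hf1 hC1 hjl
    have hlipE := lipschitzWith_toNNReal hC1 hjl
    rw [← heq] at hv hvp hvd
    set v := deriv (eulerRho ρ₀ X t) with hv_def
    -- Change of variables x = X t y. The density is differentiable at X t y for almost every y
    -- only.
    have hEv : ∀ s, ∫ x, φ (s - x) * v x = ∫ y, φ (s - X t y) * w t y := by
      intro s
      rw [integral_comp_flow h hf hb hg ht]
      refine integral_congr_ae ?_
      filter_upwards [ae_comp_of_antilipschitz (hκ t ht) hvd] with y hy
      have h1 : DifferentiableAt ℝ (eulerRho ρ₀ X t) (X t y) := by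
        rw [heq]
        exact (hf1.differentiable one_ne_zero _).mul hy.1
      have h2 := h1.hasDerivAt.comp y ((hf.hasJacobian h hb hg).hasDerivAt_X t ht y)
      have h3 : (eulerRho ρ₀ X t) ∘ X t = fun y => ρ₀ y * (deriv (X t) y)⁻¹ := by
        funext y
        simp only [Function.comp_apply, heq]
        rw [label_X hg ht]
      rw [h3] at h2
      simp only [w, clamp_eq ht]
      rw [h2.deriv, mul_assoc]
    -- φ ⋆ ρ is a primitive of φ ⋆ ∂ρ, which is continuous, so the fundamental theorem of calculus
    -- gives a classical derivative.
    have hpc : ∀ z z', pconv φ ρ₀ (X t) z - pconv φ ρ₀ (X t) z'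
        = ∫ s in z'..z, ∫ y, φ (s - X t y) * w t y := by
      intro z z'
      obtain ⟨hri, -⟩ := integrable_eulerRho h hf hb hg ht
      rw [pconv_eq_euler h hf hb hg ht, pconv_eq_euler h hf hb hg ht,
        ← integral_sub (integrable_bdd_mul hφ.aestronglyMeasurable hφL (hri.comp_sub_left z))
          (integrable_bdd_mul hφ.aestronglyMeasurable hφL (hri.comp_sub_left z'))]
      simp_rw [← mul_sub, ← hEv]
      rw [← integral_mul_shift_interval hv hφ hφL]
      refine integral_congr_ae (Eventually.of_forall fun x => ?_)
      simp only
      rw [sub_eq_shift_interval (f := eulerRho ρ₀ X t) (v := v) fun a b => ?_]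
      rw [← hvp a b, heq]
    have hd := intervalIntegral.integral_hasDerivAt_right (hEc.intervalIntegrable (μ := volume) 0 z)
      (hEc.stronglyMeasurableAtFilter _ _) hEc.continuousAt
    have hfun : pconv φ ρ₀ (X t)
        = fun z => (∫ s in (0 : ℝ)..z, ∫ y, φ (s - X t y) * w t y) + pconv φ ρ₀ (X t) 0 := by
      funext z
      rw [← hpc, sub_add_cancel]
    rw [hfun]
    simp only [clamp_eq ht]
    exact hd.add_const _

end Smooth

/-! ### Smooth data: classical continuity equation -/

section Smooth

variable {L : ℝ≥0} {ψ Ψ k ρ₀ u₀ θ : ℝ → ℝ} {X G : ℝ → ℝ → ℝ} {b : ℝ}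

theorem IsFlow.good_zero (hf : IsFlow Ψ k ρ₀ u₀ θ X G) : Good X 0 :=
  ⟨1, one_pos, fun t ht x y _ => by
    rw [show t = 0 from le_antisymm ht.2 ht.1, hf.X_zero, hf.X_zero, one_mul]⟩

/-- Identifies the quantity compared with the threshold in the theorem as the initial value of g =
∂ₓG. -/
theorem IsFlow.deriv_G_zero (h : Data L ψ Ψ k ρ₀ u₀ θ) (hf : IsFlow Ψ k ρ₀ u₀ θ X G) (x : ℝ) :
    deriv (G 0) x = deriv u₀ x + pconv ψ ρ₀ id x := by
  have h1 := hasDerivAt_pot h hf hf.good_zero h.Ψ_lip (left_mem_Icc.2 le_rfl) x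
  rw [hf.X_zero_eq, h.deriv_Ψ] at h1
  rw [funext hf.G_zero]
  exact ((h.u_contDiff.differentiable one_ne_zero x).hasDerivAt.add h1).deriv

theorem exists_deriv_G_zero_lipschitz (h : Data L ψ Ψ k ρ₀ u₀ θ) (hf : IsFlow Ψ k ρ₀ u₀ θ X G)
    (hs : IsSmoothData ρ₀ u₀) :
    ∃ A : ℝ, 0 ≤ A ∧ ∀ x y, |deriv (G 0) x - deriv (G 0) y| ≤ A * |x - y| := by
  obtain ⟨A, hA0, hA⟩ := exists_pconv_sub_le h hf le_rfl hf.good_zero hs.rho_contDiff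
    hs.deriv_rho_integrable
  obtain ⟨B, hB⟩ := hs.deriv_deriv_u_bounded
  have hB0 : 0 ≤ B := (abs_nonneg _).trans (hB 0)
  have hu : ContDiff ℝ 1 (deriv u₀) := (contDiff_succ_iff_deriv.1
    (show ContDiff ℝ (1 + 1) u₀ from hs.u_contDiff)).2.2
  refine ⟨B + A, by positivity, fun x y => ?_⟩
  have h1 := hA 0 (left_mem_Icc.2 le_rfl) 0 0 le_rfl le_rfl
    (fun x y => by simp [hf.X_zero_eq]) ψ h.ψ_continuous.measurable h.norm_ψ_le x y
  have h2 : |deriv u₀ x - deriv u₀ y| ≤ B * |x - y| :=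
    convex_univ.norm_image_sub_le_of_norm_deriv_le (fun x _ => hu.differentiable one_ne_zero x)
      (fun x _ => hB x) (mem_univ y) (mem_univ x)
  rw [hf.X_zero_eq] at h1
  rw [hf.deriv_G_zero h, hf.deriv_G_zero h, add_sub_add_comm]
  refine (abs_add_le _ _).trans ?_
  linarith

/-- For smooth data the Jacobian is continuously differentiable in space. -/
theorem jacobian_contDiff (h : Data L ψ Ψ k ρ₀ u₀ θ) (hf : IsFlow Ψ k ρ₀ u₀ θ X G)
    (hb : 0 ≤ b) (hg : Good X b) (hs : IsSmoothData ρ₀ u₀) :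
    ContinuousOn (fun p : ℝ × ℝ => deriv (deriv (X p.1)) p.2) (Icc 0 b ×ˢ univ) ∧
      ∀ t ∈ Icc 0 b, ∀ x, HasDerivAt (deriv (X t)) (deriv (deriv (X t)) x) x := by
  obtain ⟨A, hA0, hA⟩ := exists_deriv_G_zero_lipschitz h hf hs
  have hj := hf.hasJacobian h hb hg
  have hEφ := fun φ (hφ : Measurable φ) (hφL : ∀ x, ‖φ x‖ ≤ L) => exists_deriv_pconv h hf hb hg
    hs.rho_contDiff hs.deriv_rho_integrable hA0 hA hφ hφL
  have hkm := measurable_deriv k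
  have hkL : ∀ x, ‖deriv k x‖ ≤ L := fun x => norm_deriv_le_of_lipschitz h.k_lip
  obtain ⟨E₁, hE₁c, hE₁⟩ := hEφ ψ h.ψ_continuous.measurable h.norm_ψ_le
  obtain ⟨E₂, hE₂c, hE₂⟩ := hEφ (deriv k) hkm hkL
  have hXc₁ : Continuous fun p : ℝ × ℝ × ℝ => X (clamp b p.1) p.2.1 :=
    hf.continuous_clamp b continuous_fst (by fun_prop)
  have hXc₂ : Continuous fun p : ℝ × ℝ × ℝ => X (clamp b p.1) p.2.2 :=
    hf.continuous_clamp b continuous_fst (by fun_prop)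
  have hJc : Continuous fun p : ℝ × ℝ => deriv (X (clamp b p.1)) p.2 := by
    have h1 := hj.continuousOn_J.comp (f := fun p : ℝ × ℝ => (clamp b p.1, p.2)) (s := univ)
      (((continuous_clamp b).comp continuous_fst).prodMk continuous_snd).continuousOn
      fun p _ => ⟨clamp_mem hb _, trivial⟩
    exact continuousOn_univ.1 h1
  have hα : ∀ φ : ℝ → ℝ, Measurable φ → (∀ x, ‖φ x‖ ≤ L) →
      Continuous fun p : ℝ × ℝ × ℝ => pconv φ ρ₀ (X (clamp b p.1)) (X (clamp b p.1) p.2.1) :=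
    fun φ hφ hφL => (continuous_pconv h hf hb hg hφ hφL).comp (continuous_fst.prodMk hXc₁)
  have hσ : ∀ E : ℝ → ℝ → ℝ, (Continuous fun p : ℝ × ℝ => E p.1 p.2) →
      Continuous fun p : ℝ × ℝ × ℝ => segAvg (E p.1) (X (clamp b p.1) p.2.1)
        (X (clamp b p.1) p.2.2) * segAvg (deriv (X (clamp b p.1))) p.2.1 p.2.2
        * deriv (X (clamp b p.1)) p.2.2 := fun E hE => by
    refine ((continuous_segAvg (f := fun p : ℝ × ℝ × ℝ => E p.1) ?_ hXc₁ hXc₂).mul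
      (continuous_segAvg (f := fun p : ℝ × ℝ × ℝ => deriv (X (clamp b p.1))) ?_
        (by fun_prop) (by fun_prop))).mul ?_
    · exact hE.comp (continuous_fst.fst.prodMk continuous_snd)
    · exact hJc.comp (continuous_fst.fst.prodMk continuous_snd)
    · exact hJc.comp (continuous_fst.prodMk continuous_snd.snd)
  have hdiff : ∀ (φ : ℝ → ℝ) (E : ℝ → ℝ → ℝ), (Continuous fun p : ℝ × ℝ => E p.1 p.2) →
      (∀ t ∈ Icc 0 b, ∀ z, HasDerivAt (pconv φ ρ₀ (X t)) (E t z) z) → ∀ t ∈ Icc 0 b, ∀ x y,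
      pconv φ ρ₀ (X t) (X t x) - pconv φ ρ₀ (X t) (X t y)
        = segAvg (E t) (X t x) (X t y) * segAvg (deriv (X t)) x y * (x - y) := by
    intro φ E hEc hE t ht x y
    have c1 : Continuous (E t) := hEc.comp (continuous_const.prodMk continuous_id)
    have c2 : Continuous (deriv (X t)) := by
      have := hJc.comp (continuous_const (y := t).prodMk continuous_id)
      simpa [Function.comp_def, clamp_eq ht] using this
    rw [sub_eq_segAvg_mul (hE t ht) c1, sub_eq_segAvg_mul (hj.hasDerivAt_X t ht) c2, mul_assoc]
  have cJ : ∀ x, ContinuousOn (fun t => deriv (X t) x) (Icc 0 b) := fun x =>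
    hj.continuousOn_J.comp (f := fun t : ℝ => (t, x)) (by fun_prop) fun t ht => ⟨ht, trivial⟩
  have cg : ∀ x, ContinuousOn (fun t => deriv (G t) x) (Icc 0 b) := fun x =>
    hj.continuousOn_g.comp (f := fun t : ℝ => (t, x)) (by fun_prop) fun t ht => ⟨ht, trivial⟩
  -- Second use, now for J and g. With a(x) = (φ ⋆ ρ)(X x), write a(x) J(x) - a(y) J(y) = a(x)(J(x)
  -- - J(y)) + (a(x) - a(y)) J(y); the last difference is a divided difference times x - y, and this
  -- gives the source terms.
  obtain ⟨p, q, hp, -, hd, -⟩ := exists_spatial_deriv (P := fun t => deriv (X t))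
    (Q := fun t => deriv (G t)) hb
    (α := fun t z => pconv ψ ρ₀ (X (clamp b t)) (X (clamp b t) z.1))
    (β := fun t z => pconv (deriv k) ρ₀ (X (clamp b t)) (X (clamp b t) z.1))
    (σ := fun t z => segAvg (E₁ t) (X (clamp b t) z.1) (X (clamp b t) z.2)
      * segAvg (deriv (X (clamp b t))) z.1 z.2 * deriv (X (clamp b t)) z.2)
    (η := fun t z => segAvg (E₂ t) (X (clamp b t) z.1) (X (clamp b t) z.2)
      * segAvg (deriv (X (clamp b t))) z.1 z.2 * deriv (X (clamp b t)) z.2)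
    (hα ψ h.ψ_continuous.measurable h.norm_ψ_le) (hα (deriv k) hkm hkL) (hσ E₁ hE₁c) (hσ E₂ hE₂c)
    cJ cg
    (fun t ht x y => by
      have ht' := Ioo_subset_Icc_self ht
      refine ((hj.hasDerivAt_J t ht x).sub (hj.hasDerivAt_J t ht y)).congr_deriv ?_
      simp only [clamp_eq ht']
      have := hdiff ψ E₁ hE₁c hE₁ t ht' x y
      linear_combination -(deriv (X t) y) * this)
    (fun t ht x y => by
      have ht' := Ioo_subset_Icc_self ht
      refine ((hj.hasDerivAt_g t ht x).sub (hj.hasDerivAt_g t ht y)).congr_deriv ?_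
      simp only [clamp_eq ht']
      have := hdiff (deriv k) E₂ hE₂c hE₂ t ht' x y
      linear_combination -(deriv (X t) y) * this)
    (by simp only [hf.X_zero_eq, deriv_id']; exact contDiff_const)
    (by
      have hu : ContDiff ℝ 1 (deriv u₀) := (contDiff_succ_iff_deriv.1
        (show ContDiff ℝ (1 + 1) u₀ from hs.u_contDiff)).2.2
      simp only [funext (hf.deriv_G_zero h)]
      refine hu.add ?_
      have h0 := hE₁ 0 (left_mem_Icc.2 hb)
      rw [hf.X_zero_eq] at h0
      rw [contDiff_one_iff_deriv]
      refine ⟨fun z => (h0 z).differentiableAt, ?_⟩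
      rw [funext fun z => (h0 z).deriv]
      exact hE₁c.comp (continuous_const.prodMk continuous_id))
  exact ⟨hp.congr fun z hz => (hd z.1 hz.1 z.2).1.deriv,
    fun t ht x => (hd t ht x).1.differentiableAt.hasDerivAt⟩

variable {T : EReal}

/-- Along particles the density is r = ρ₀ / J, and J' is ∂ₓu times J, so r' = -r ∂ₓu, which is the
continuity equation. Once J is C¹ in space the Eulerian density inherits this. -/
theorem IsFlow.isMassClassical (h : Data L ψ Ψ k ρ₀ u₀ θ) (hf : IsFlow Ψ k ρ₀ u₀ θ X G)
    (hT : ∀ b : ℝ, (b : EReal) < T → Good X b) (hs : IsSmoothData ρ₀ u₀) :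
    IsMassClassical T (eulerRho ρ₀ X) (eulerU Ψ ρ₀ X G) := by
  let r : ℝ → ℝ → ℝ := fun t x => ρ₀ x / deriv (X t) x
  let rt : ℝ → ℝ → ℝ := fun t x => -(ρ₀ x * velX ψ ρ₀ X G t x) / deriv (X t) x ^ 2
  let rx : ℝ → ℝ → ℝ := fun t x =>
    (deriv ρ₀ x * deriv (X t) x - ρ₀ x * deriv (deriv (X t)) x) / deriv (X t) x ^ 2
  have hρd : ∀ x, HasDerivAt ρ₀ (deriv ρ₀ x) x := fun x =>
    (hs.rho_contDiff.differentiable one_ne_zero x).hasDerivAt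
  have hJ : ∀ b : ℝ, 0 ≤ b → (b : EReal) < T → ∀ t ∈ Icc 0 b, ∀ x, deriv (X t) x ≠ 0 := by
    intro b hb hbT t ht x
    obtain ⟨c, hc, hJ⟩ := (hT b hbT).exists_le_deriv h hf hb
    exact (hc.trans_le (hJ t ht x)).ne'
  have hrt : ∀ b : ℝ, 0 ≤ b → (b : EReal) < T →
      ContinuousOn (fun p : ℝ × ℝ => rt p.1 p.2) (Icc 0 b ×ˢ univ) := fun b hb hbT =>
    (((h.ρ_continuous.comp continuous_snd).continuousOn.mul
      (continuousOn_velX h hf hb (hT b hbT))).neg).div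
      ((hf.hasJacobian h hb (hT b hbT)).continuousOn_J.pow 2)
      fun p hp => pow_ne_zero 2 (hJ b hb hbT p.1 hp.1 p.2)
  have hrx : ∀ b : ℝ, 0 ≤ b → (b : EReal) < T →
      ContinuousOn (fun p : ℝ × ℝ => rx p.1 p.2) (Icc 0 b ×ˢ univ) := fun b hb hbT => by
    have hj := (hf.hasJacobian h hb (hT b hbT)).continuousOn_J
    have h1 := (jacobian_contDiff h hf hb (hT b hbT) hs).1
    have h2 : ContinuousOn (fun p : ℝ × ℝ => deriv ρ₀ p.2) (Icc 0 b ×ˢ univ) :=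
      ((hs.rho_contDiff.continuous_deriv le_rfl).comp continuous_snd).continuousOn
    have h3 : ContinuousOn (fun p : ℝ × ℝ => ρ₀ p.2) (Icc 0 b ×ˢ univ) :=
      (h.ρ_continuous.comp continuous_snd).continuousOn
    exact ((h2.mul hj).sub (h3.mul h1)).div (hj.pow 2)
      fun p hp => pow_ne_zero 2 (hJ b hb hbT p.1 hp.1 p.2)
  have hdx : ∀ b : ℝ, 0 ≤ b → (b : EReal) < T → ∀ t ∈ Icc 0 b, ∀ x,
      HasDerivAt (r t) (rx t x) x := fun b hb hbT t ht x =>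
    (hρd x).div ((jacobian_contDiff h hf hb (hT b hbT) hs).2 t ht x) (hJ b hb hbT t ht x)
  have hdt : ∀ b : ℝ, 0 ≤ b → (b : EReal) < T → ∀ t ∈ Ioo 0 b, ∀ x,
      HasDerivAt (fun s => r s x) (rt t x) t := fun b hb hbT t ht x => by
    refine ((hasDerivAt_const t (ρ₀ x)).div ((hf.hasJacobian h hb (hT b hbT)).hasDerivAt_J t ht x)
      (hJ b hb hbT t (Ioo_subset_Icc_self ht) x)).congr_deriv ?_
    simp only [rt, velX]
    ring
  have hEx : ∀ t : ℝ, 0 < t → (t : EReal) < T → ∀ z, HasDerivAt (eulerRho ρ₀ X t)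
      (rx t (label X t z) * (deriv (X t) (label X t z))⁻¹) z := fun t ht htT z =>
    (hdx t ht.le htT t (right_mem_Icc.2 ht.le) _).comp z
      (hasDerivAt_label_space h hf ht.le (hT t htT) (right_mem_Icc.2 ht.le) z)
  have hEt : ∀ t : ℝ, 0 < t → (t : EReal) < T → ∀ z, HasDerivAt (fun s => eulerRho ρ₀ X s z)
      (rt t (label X t z) + rx t (label X t z)
        * -(vel Ψ ρ₀ X G t (label X t z) / deriv (X t) (label X t z))) t := by
    intro t ht htT z
    obtain ⟨b, hb, hbT, htb⟩ := exists_mem_Ioo ht.le htT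
    have hsub : Ioo 0 b ×ˢ (univ : Set ℝ) ⊆ Icc 0 b ×ˢ univ := prod_mono_left Ioo_subset_Icc_self
    exact hasDerivAt_comp_of_partial (f := r) (isOpen_Ioo.prod isOpen_univ)
      (fun p hp => hdt b hb hbT p.1 hp.1 p.2)
      (fun p hp => hdx b hb hbT p.1 (Ioo_subset_Icc_self hp.1) p.2)
      ((hrt b hb hbT).mono hsub) ((hrx b hb hbT).mono hsub)
      (hasDerivAt_label_time h hf hb (hT b hbT) ⟨ht, htb⟩ z) ⟨⟨ht, htb⟩, trivial⟩
  refine ⟨contDiffOn_one_of_partial (f := eulerRho ρ₀ X)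
    (f₁ := fun t z => rt t (label X t z) + rx t (label X t z)
        * -(vel Ψ ρ₀ X G t (label X t z) / deriv (X t) (label X t z)))
    (f₂ := fun t z => rx t (label X t z) * (deriv (X t) (label X t z))⁻¹)
    isOpen_openSlab (fun p hp => hEt p.1 hp.1 hp.2 p.2) (fun p hp => hEx p.1 hp.1 hp.2 p.2)
    ((continuousOn_slab fun b hb hbT => ?_).mono openSlab_subset_slab)
    ((continuousOn_slab fun b hb hbT => ?_).mono openSlab_subset_slab), fun t ht htT z => ?_⟩
  · exact continuousOn_comp_label hf (hT b hbT)
      (F := fun t x => rt t x + rx t x * -(vel Ψ ρ₀ X G t x / deriv (X t) x))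
      ((hrt b hb hbT).add ((hrx b hb hbT).mul (((continuousOn_vel h hf hb).div
        (hf.hasJacobian h hb (hT b hbT)).continuousOn_J
        fun p hp => hJ b hb hbT p.1 hp.1 p.2).neg)))
  · exact continuousOn_comp_label hf (hT b hbT) (F := fun t x => rx t x * (deriv (X t) x)⁻¹)
      ((hrx b hb hbT).mul ((hf.hasJacobian h hb (hT b hbT)).continuousOn_J.inv₀
        fun p hp => hJ b hb hbT p.1 hp.1 p.2))
  · have h1 := (hEx t ht htT z).mul (hasDerivAt_eulerU_space h hf ht.le (hT t htT)
      (right_mem_Icc.2 ht.le) z)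
    have h2 : HasDerivAt (fun y => eulerRho ρ₀ X t y * eulerU Ψ ρ₀ X G t y) _ z := h1
    rw [(hEt t ht htT z).deriv, h2.deriv, eulerRho, eulerU]
    have hne := hJ t ht.le htT t (right_mem_Icc.2 ht.le) (label X t z)
    simp only [rt]
    field_simp
    ring

end Smooth

/-- Integrating factor: f exp(-A) is monotone. All the threshold estimates below are instances. -/
theorem mul_exp_le_of_deriv_ge {f f' A m : ℝ → ℝ} {a b : ℝ} (hab : a ≤ b)
    (hf : ContinuousOn f (Icc a b)) (hd : ∀ s ∈ Ioo a b, HasDerivAt f (f' s) s)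
    (hA : ∀ s, HasDerivAt A (m s) s) (hm : ∀ s ∈ Ioo a b, m s * f s ≤ f' s) :
    f a * Real.exp (A b - A a) ≤ f b := by
  have hAc : Continuous A := continuous_iff_continuousAt.2 fun s => (hA s).continuousAt
  have hmono : MonotoneOn (fun s => f s * Real.exp (-A s)) (Icc a b) := by
    have hd' : ∀ s ∈ Ioo a b, HasDerivAt (fun s => f s * Real.exp (-A s))
        ((f' s - m s * f s) * Real.exp (-A s)) s := fun s hs => by
      refine ((hd s hs).mul (hA s).neg.exp).congr_deriv ?_
      simp only [Pi.neg_apply]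
      ring
    refine monotoneOn_of_deriv_nonneg (convex_Icc a b)
      (hf.mul (Real.continuous_exp.comp hAc.neg).continuousOn) ?_ ?_
    · rw [interior_Icc]
      exact fun s hs => (hd' s hs).differentiableAt.differentiableWithinAt
    · rw [interior_Icc]
      intro s hs
      rw [(hd' s hs).deriv]
      exact mul_nonneg (sub_nonneg.2 (hm s hs)) (Real.exp_pos _).le
  have h1 := hmono (left_mem_Icc.2 hab) (right_mem_Icc.2 hab) hab
  have h2 := mul_le_mul_of_nonneg_right h1 (Real.exp_pos (A b)).le
  simp only at h2
  rw [mul_assoc, mul_assoc, ← Real.exp_add, ← Real.exp_add, neg_add_cancel, Real.exp_zero,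
    mul_one] at h2
  rwa [sub_eq_neg_add]

/-! ### Threshold dynamics of the Jacobian and the lifespan -/

section Lifespan

variable {L : ℝ≥0} {ψ Ψ k ρ₀ u₀ θ : ℝ → ℝ} {X G : ℝ → ℝ → ℝ} {b T : ℝ}

theorem IsFlow.exists_separation_lipschitz (h : Data L ψ Ψ k ρ₀ u₀ θ)
    (hf : IsFlow Ψ k ρ₀ u₀ θ X G) (B : ℝ) : ∃ R : ℝ, 0 ≤ R ∧ ∀ s ∈ Icc 0 B, ∀ t ∈ Icc 0 B,
      ∀ x y, |(X t x - X t y) - (X s x - X s y)| ≤ R * |x - y| * |t - s| := by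
  obtain ⟨M, hM⟩ := hf.lipschitz h B
  refine ⟨M + L * M, by positivity, fun s hs t ht x y => ?_⟩
  refine abs_sub_le_of_hasDerivAt (f := fun t => X t x - X t y)
    ((hf.continuous_X_left x).sub (hf.continuous_X_left y)).continuousOn
    (fun r _ => (hf.hasDerivAt_X r x).sub (hf.hasDerivAt_X r y)) (fun r hr => ?_) hs ht
  have hM' := hM r (Ioo_subset_Icc_self hr) x y
  rw [sub_sub_sub_comm, add_mul, mul_assoc (L : ℝ)]
  refine (abs_sub _ _).trans (add_le_add hM'.2 ?_)
  exact (h.pot_lipschitz h.Ψ_lip (hf.nearId r) _ _).trans (by gcongr; exact hM'.1)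

/-- Separations, relative to |x - y|, change at a bounded rate, so the expansion factor cannot drop
from c below c/2 at once. -/
theorem Good.exists_gt (h : Data L ψ Ψ k ρ₀ u₀ θ) (hf : IsFlow Ψ k ρ₀ u₀ θ X G) (hb : 0 ≤ b)
    (hg : Good X b) : ∃ b' > b, Good X b' := by
  obtain ⟨c, hc, hX⟩ := hg
  obtain ⟨R, hR0, hR⟩ := hf.exists_separation_lipschitz h (b + 1)
  -- Gives R δ ≤ c/2, and δ ≤ 1 keeps within [0, b + 1], where R is valid.
  set δ := min 1 (c / (2 * (R + 1))) with hδ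
  have hδ0 : 0 < δ := by positivity
  have hRδ : R * δ ≤ c / 2 := by
    have h1 : δ ≤ c / (2 * (R + 1)) := min_le_right _ _
    rw [le_div_iff₀ (by positivity)] at h1
    nlinarith
  refine ⟨b + δ, by linarith, c / 2, by positivity, fun t ht x y hyx => ?_⟩
  have hxy : 0 ≤ x - y := sub_nonneg.2 hyx
  rcases le_or_gt t b with htb | htb
  · refine le_trans ?_ (hX t ⟨ht.1, htb⟩ x y hyx)
    gcongr
    linarith
  · have hδ1 : δ ≤ 1 := min_le_left _ _
    have h1 := hR b ⟨hb, by linarith⟩ t ⟨ht.1, by linarith [ht.2]⟩ x y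
    have h2 := hX b ⟨hb, le_rfl⟩ x y hyx
    rw [abs_of_nonneg hxy, abs_of_pos (sub_pos.2 htb)] at h1
    have h3 : R * (x - y) * (t - b) ≤ c / 2 * (x - y) := by
      calc R * (x - y) * (t - b) ≤ R * (x - y) * δ := by
            gcongr
            linarith [ht.2]
        _ = R * δ * (x - y) := by ring
        _ ≤ _ := by gcongr
    have h4 := (abs_le.1 h1).1
    linarith

/-- If the flow degenerates at some time, then there is a first such time. -/
theorem exists_lifespan (h : Data L ψ Ψ k ρ₀ u₀ θ) (hf : IsFlow Ψ k ρ₀ u₀ θ X G)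
    (hbad : ∃ b, ¬ Good X b) : ∃ T > 0, (∀ b < T, Good X b) ∧ ¬ Good X T := by
  obtain ⟨b₁, hb₁⟩ := hbad
  set S := {b | Good X b} with hS
  have hne : S.Nonempty := ⟨0, hf.good_zero⟩
  have hbdd : BddAbove S := ⟨b₁, fun b hb => by
    by_contra! hlt
    exact hb₁ (Good.mono hb hlt.le)⟩
  obtain ⟨b', hb', hgb'⟩ := hf.good_zero.exists_gt h hf le_rfl
  have hpos : 0 < sSup S := lt_of_lt_of_le hb' (le_csSup hbdd hgb')
  refine ⟨sSup S, hpos, fun b hb => ?_, fun hg => ?_⟩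
  · obtain ⟨c, hc, hbc⟩ := exists_lt_of_lt_csSup hne hb
    exact Good.mono hc hbc.le
  · obtain ⟨b', hb', hgb'⟩ := hg.exists_gt h hf hpos.le
    exact absurd (le_csSup hbdd hgb') (not_le.2 hb')

/-- The mean value inequality turns a lower bound for J into uniform expansion before T, and this
closed condition passes to T by continuity of X. -/
theorem good_of_le_jacobian (h : Data L ψ Ψ k ρ₀ u₀ θ) (hf : IsFlow Ψ k ρ₀ u₀ θ X G)
    (hT : ∀ b < T, Good X b) {t₀ c : ℝ} (ht₀ : 0 ≤ t₀) (ht₀T : t₀ < T) (hc : 0 < c)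
    (hJ : ∀ t, t₀ ≤ t → t < T → ∀ x, c ≤ deriv (X t) x) : Good X T := by
  obtain ⟨c₀, hc₀, hX₀⟩ := hT t₀ ht₀T
  have hlt : ∀ t ∈ Ico t₀ T, ∀ x y, y ≤ x → c * (x - y) ≤ X t x - X t y := by
    intro t ht x y hyx
    have ht' : t ∈ Icc 0 t := right_mem_Icc.2 (ht₀.trans ht.1)
    have hd := (hf.hasJacobian h ht'.1 (hT t ht.2)).hasDerivAt_X t ht'
    exact convex_univ.mul_sub_le_image_sub_of_le_deriv
      (fun x _ => (hd x).continuousAt.continuousWithinAt)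
      (fun x _ => (hd x).differentiableAt.differentiableWithinAt)
      (fun x _ => hJ t ht.1 ht.2 x) y (mem_univ _) x (mem_univ _) hyx
  refine ⟨min c c₀, lt_min hc hc₀, fun t ht x y hyx => ?_⟩
  have hxy : 0 ≤ x - y := sub_nonneg.2 hyx
  rcases le_or_gt t t₀ with h1 | h1
  · exact (mul_le_mul_of_nonneg_right (min_le_right _ _) hxy).trans (hX₀ t ⟨ht.1, h1⟩ x y hyx)
  · refine (mul_le_mul_of_nonneg_right (min_le_left _ _) hxy).trans ?_
    have hcl : closure (Ico t₀ T) = Icc t₀ T := closure_Ico ht₀T.ne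
    have hcont : Continuous fun t => X t x - X t y :=
      (hf.continuous_X_left x).sub (hf.continuous_X_left y)
    exact closure_minimal (fun t ht => hlt t ht x y hyx)
      (isClosed_le continuous_const hcont) (hcl ▸ (⟨h1.le, ht.2⟩ : t ∈ Icc t₀ T))

/-- Convolution with ρ is an average, so almost everywhere bounds on K'' become bounds at every
point. The exceptional set is avoided because X is antilipschitz. -/
theorem le_pconv (h : Data L ψ Ψ k ρ₀ u₀ θ) (hf : IsFlow Ψ k ρ₀ u₀ θ X G) (hg : Good X b) {t : ℝ}
    (ht : t ∈ Icc 0 b) {φ : ℝ → ℝ} (hφ : Measurable φ) {M : ℝ} (hM : ∀ x, ‖φ x‖ ≤ M) {a : ℝ}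
    (ha : ∀ᵐ x, a ≤ φ x) (z : ℝ) : a ≤ pconv φ ρ₀ (X t) z := by
  obtain ⟨κ, hκ⟩ := hg.exists_antilipschitz
  have hanti : AntilipschitzWith κ fun y => z - X t y := by
    refine AntilipschitzWith.of_le_mul_dist fun x y => ?_
    have := (hκ t ht).le_mul_dist x y
    rwa [Real.dist_eq, Real.dist_eq, sub_sub_sub_cancel_left, abs_sub_comm (X t y),
      ← Real.dist_eq, ← Real.dist_eq]
  have hi : Integrable fun y => φ (z - X t y) * ρ₀ y :=
    integrable_bdd_mul (hφ.comp (measurable_const.sub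
      (hf.nearId t).1.measurable)).aestronglyMeasurable (fun _ => hM _) h.ρ_integrable
  calc a = ∫ y, a * ρ₀ y := by rw [integral_const_mul, h.mass_one, mul_one]
    _ ≤ _ := by
      refine integral_mono_ae (h.ρ_integrable.const_mul a) hi ?_
      filter_upwards [ae_comp_of_antilipschitz hanti ha] with y hy
      exact mul_le_mul_of_nonneg_right hy (h.ρ_nonneg y)

theorem Data.pconv_ψ_nonneg (h : Data L ψ Ψ k ρ₀ u₀ θ) (Y : ℝ → ℝ) (z : ℝ) :
    0 ≤ pconv ψ ρ₀ Y z :=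
  integral_nonneg fun y => mul_nonneg (h.ψ_nonneg _) (h.ρ_nonneg y)

theorem HasJacobian.continuousOn_left (hj : HasJacobian ψ k ρ₀ X G b) (x : ℝ) :
    ContinuousOn (fun t => deriv (X t) x) (Icc 0 b) ∧
      ContinuousOn (fun t => deriv (G t) x) (Icc 0 b) :=
  ⟨hj.continuousOn_J.comp (f := fun t : ℝ => (t, x)) (by fun_prop) fun _ ht => ⟨ht, trivial⟩,
    hj.continuousOn_g.comp (f := fun t : ℝ => (t, x)) (by fun_prop) fun _ ht => ⟨ht, trivial⟩⟩

/-- Supercritical data: the flow degenerates in finite time. -/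
theorem exists_not_good (h : Data L ψ Ψ k ρ₀ u₀ θ) (hf : IsFlow Ψ k ρ₀ u₀ θ X G) {q : ℝ}
    (hq : 0 ≤ q) (hk : ∀ᵐ x, -q ^ 2 ≤ deriv k x) {x : ℝ} (hx : deriv (G 0) x < -q) :
    ∃ b, ¬ Good X b := by
  by_contra! hgood
  set w₀ := deriv (G 0) x + q with hw₀
  have hw₀neg : w₀ < 0 := by linarith
  -- The time at which the upper bound 1 + w₀ t for J reaches zero.
  set b := (-w₀)⁻¹ with hb
  have hb0 : 0 ≤ b := (inv_pos.2 (neg_pos.2 hw₀neg)).le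
  have hg := hgood b
  have hj := hf.hasJacobian h hb0 hg
  obtain ⟨c, hc, hJ⟩ := hg.exists_le_deriv h hf hb0
  have hJ0 : deriv (X 0) x = 1 := by rw [hf.X_zero_eq, deriv_id]
  have hcl := hj.continuousOn_left x
  -- For w = g + qJ one finds (-w)' - q(-w) = (c + q²)J + qaJ ≥ 0, with a = (ψ ⋆ ρ)(X) and c = (K''
  -- ⋆ ρ)(X). So -w ≥ -w₀ > 0, and g ≤ w because qJ ≥ 0.
  have hw : ∀ t ∈ Icc 0 b, deriv (G t) x ≤ w₀ := by
    intro t ht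
    have hsub : Icc 0 t ⊆ Icc 0 b := Icc_subset_Icc_right ht.2
    have h1 := mul_exp_le_of_deriv_ge (f := fun t => -(deriv (G t) x + q * deriv (X t) x))
      (A := fun s => q * s) (m := fun _ => q) ht.1
      (((hcl.2.add (hcl.1.const_smul q)).neg).mono hsub)
      (fun s hs => ((hj.hasDerivAt_g s ⟨hs.1, hs.2.trans_le ht.2⟩ x).add
        ((hj.hasDerivAt_J s ⟨hs.1, hs.2.trans_le ht.2⟩ x).const_mul q)).neg)
      (fun s => by simpa using (hasDerivAt_id s).const_mul q) (fun s hs => ?_)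
    · have h2 : 1 ≤ Real.exp (q * t - q * 0) :=
        Real.one_le_exp (by rw [mul_zero, sub_zero]; exact mul_nonneg hq ht.1)
      have h3 : -w₀ ≤ -w₀ * Real.exp (q * t - q * 0) := le_mul_of_one_le_right (by linarith) h2
      have h4 : 0 ≤ q * deriv (X t) x := mul_nonneg hq (hc.le.trans (hJ t ht x))
      simp only [hJ0, mul_one] at h1
      rw [← hw₀] at h1
      linarith
    · have hs' : s ∈ Icc 0 b := ⟨hs.1.le, hs.2.le.trans ht.2⟩
      have hJs : 0 ≤ deriv (X s) x := hc.le.trans (hJ s hs' x)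
      have h2 := le_pconv h hf hg hs' (measurable_deriv k)
        (fun x => norm_deriv_le_of_lipschitz h.k_lip) hk (X s x)
      have h3 := mul_nonneg hq (mul_nonneg (h.pconv_ψ_nonneg (X s) (X s x)) hJs)
      have h4 := mul_le_mul_of_nonneg_right h2 hJs
      linarith
  have hfin : deriv (X b) x ≤ 1 + w₀ * b := by
    have h1 := mul_exp_le_of_deriv_ge (f := fun t => w₀ * t - deriv (X t) x) (A := fun _ => 0)
      (m := fun _ => 0) hb0 ((continuousOn_const.mul continuousOn_id).sub hcl.1)
      (fun s hs => ((hasDerivAt_id s).const_mul w₀).sub (hj.hasDerivAt_J s hs x))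
      (fun s => hasDerivAt_const s 0) (fun s hs => ?_)
    · simp only [hJ0, sub_zero, Real.exp_zero, mul_one, mul_zero, zero_sub] at h1
      linarith
    · have hs' := Ioo_subset_Icc_self hs
      have h2 := mul_nonneg (h.pconv_ψ_nonneg (X s) (X s x)) (hc.le.trans (hJ s hs' x))
      have h3 := hw s hs'
      linarith
  have h5 := hJ b (right_mem_Icc.2 hb0) x
  have h6 : w₀ * b = -1 := by
    rw [hb, inv_neg, mul_neg, mul_inv_cancel₀ hw₀neg.ne]
  linarith

/-- Subcritical data and repulsive forces: the flow never degenerates. -/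
theorem good_of_subcritical (h : Data L ψ Ψ k ρ₀ u₀ θ) (hf : IsFlow Ψ k ρ₀ u₀ θ X G)
    (hk : ∀ᵐ x, deriv k x ≤ 0) (hx : ∀ x, 0 ≤ deriv (G 0) x) (b : ℝ) : Good X b := by
  by_contra hbad
  obtain ⟨T, hT0, hT, hTbad⟩ := exists_lifespan h hf ⟨b, hbad⟩
  refine hTbad (good_of_le_jacobian h hf hT le_rfl hT0 (Real.exp_pos (-(L * T))) ?_)
  intro t ht0 htT x
  have hg := hT t htT
  have hj := hf.hasJacobian h ht0 hg
  obtain ⟨c, hc, hJ⟩ := hg.exists_le_deriv h hf ht0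
  have hcl := hj.continuousOn_left x
  have hJ0 : deriv (X 0) x = 1 := by rw [hf.X_zero_eq, deriv_id]
  -- Repulsion makes g nondecreasing as long as J ≥ 0, and then J' ≥ -LJ.
  have hgn : ∀ s ∈ Icc 0 t, 0 ≤ deriv (G s) x := by
    intro s hs
    have h1 := mul_exp_le_of_deriv_ge (f := fun t => deriv (G t) x) (A := fun _ => 0)
      (m := fun _ => 0) hs.1 (hcl.2.mono (Icc_subset_Icc_right hs.2))
      (fun r hr => hj.hasDerivAt_g r ⟨hr.1, hr.2.trans_le hs.2⟩ x)
      (fun s => hasDerivAt_const s 0) (fun r hr => ?_)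
    · simp only [sub_zero, Real.exp_zero, mul_one] at h1
      exact (hx x).trans h1
    · have hr' : r ∈ Icc 0 t := ⟨hr.1.le, hr.2.le.trans hs.2⟩
      have h2 := le_pconv h hf hg hr' (φ := fun x => -deriv k x) (measurable_deriv k).neg (a := 0)
        (M := L) (fun x => by rw [norm_neg]; exact norm_deriv_le_of_lipschitz h.k_lip)
        (hk.mono fun x hx => by simpa using hx) (X r x)
      have h3 : pconv (fun x => -deriv k x) ρ₀ (X r) (X r x)
          = -pconv (deriv k) ρ₀ (X r) (X r x) := by
        simp only [pconv, neg_mul, integral_neg]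
      have h4 : 0 ≤ -pconv (deriv k) ρ₀ (X r) (X r x) := h3 ▸ h2
      have h5 := mul_nonneg h4 (hc.le.trans (hJ r hr' x))
      linarith
  have h1 := mul_exp_le_of_deriv_ge (f := fun t => deriv (X t) x) (A := fun s => -L * s)
    (m := fun _ => -L) ht0 hcl.1 (fun r hr => hj.hasDerivAt_J r hr x)
    (fun s => by simpa using (hasDerivAt_id s).const_mul (-(L : ℝ))) (fun r hr => ?_)
  · rw [hJ0, one_mul, mul_zero, sub_zero] at h1
    refine le_trans (Real.exp_le_exp.2 ?_) h1
    have := mul_le_mul_of_nonneg_left htT.le L.coe_nonneg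
    linarith
  · have hr' := Ioo_subset_Icc_self hr
    have h2 := (abs_le.1 (h.norm_pconv_le h.norm_ψ_le (X r) (X r x))).2
    have h3 := mul_le_mul_of_nonneg_right h2 (hc.le.trans (hJ r hr' x))
    have h4 := hgn r hr'
    linarith

/-- A lower bound for `∂ₓ u` shortly before the end of the lifespan prevents the degeneration of the
flow. -/
theorem good_of_le_deriv (h : Data L ψ Ψ k ρ₀ u₀ θ) (hf : IsFlow Ψ k ρ₀ u₀ θ X G)
    (hT : ∀ b < T, Good X b) {M t₀ : ℝ} (hM : 0 ≤ M) (ht₀ : 0 ≤ t₀) (ht₀T : t₀ < T)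
    (hclose : (L + L * (M + 1) + (M + 1) ^ 2) * (T - t₀) ≤ 1)
    (hg₀ : ∀ x, -M * deriv (X t₀) x ≤ deriv (G t₀) x) : Good X T := by
  set N : ℝ := L + L * (M + 1) + (M + 1) ^ 2 with hN
  have hL := L.coe_nonneg
  have hN0 : 0 ≤ N := by positivity
  obtain ⟨c₀, hc₀, hJ₀⟩ := (hT t₀ ht₀T).exists_le_deriv h hf ht₀
  refine good_of_le_jacobian h hf hT ht₀ ht₀T
    (c := c₀ * Real.exp (-(M + 1 + L) * (T - t₀))) (by positivity) ?_
  intro t ht htT x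
  have ht0 := ht₀.trans ht
  have hg := hT t htT
  have hj := hf.hasJacobian h ht0 hg
  obtain ⟨c, hc, hJ⟩ := hg.exists_le_deriv h hf ht0
  have hcl := hj.continuousOn_left x
  have hsub : Icc t₀ t ⊆ Icc 0 t := Icc_subset_Icc_left ht₀
  -- The barrier m = M + N(r - t₀) grows from M and stays below M + 1 because N(T - t₀) ≤ 1. With a
  -- and c the convolutions of ψ and K'' with ρ at X, (g + mJ)' - m(g + mJ) = (N - c - ma - m²)J,
  -- and N is chosen to make this nonnegative.
  have hgn : ∀ s ∈ Icc t₀ t, -(M + 1) * deriv (X s) x ≤ deriv (G s) x := by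
    intro s hs
    have hsub' : Icc t₀ s ⊆ Icc 0 t := (Icc_subset_Icc_right hs.2).trans hsub
    have hm : ∀ r, HasDerivAt (fun r => M + N * (r - t₀)) N r := fun r => by
      simpa using (((hasDerivAt_id r).sub_const t₀).const_mul N).const_add M
    have h1 := mul_exp_le_of_deriv_ge
      (f := fun r => deriv (G r) x + (M + N * (r - t₀)) * deriv (X r) x)
      (A := fun r => M * r + N / 2 * (r - t₀) ^ 2) (m := fun r => M + N * (r - t₀)) hs.1
      ((hcl.2.mono hsub').add (ContinuousOn.mul (by fun_prop) (hcl.1.mono hsub')))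
      (fun r hr => (hj.hasDerivAt_g r ⟨ht₀.trans_lt hr.1, hr.2.trans_le hs.2⟩ x).add
        ((hm r).mul (hj.hasDerivAt_J r ⟨ht₀.trans_lt hr.1, hr.2.trans_le hs.2⟩ x)))
      (fun r => (((hasDerivAt_id r).const_mul M).add
        ((((hasDerivAt_id r).sub_const t₀).pow 2).const_mul (N / 2))).congr_deriv (by
          simp; ring)) (fun r hr => ?_)
    · have hs0 : 0 ≤ deriv (X s) x := hc.le.trans (hJ s (hsub hs) x)
      have h2 : 0 ≤ (deriv (G t₀) x + (M + N * (t₀ - t₀)) * deriv (X t₀) x) := by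
        rw [sub_self, mul_zero, add_zero]
        linarith [hg₀ x]
      have h3 := (mul_nonneg h2 (Real.exp_pos _).le).trans h1
      have h4 : M + N * (s - t₀) ≤ M + 1 := by
        have : N * (s - t₀) ≤ N * (T - t₀) := by
          gcongr
          exact hs.2.trans htT.le
        linarith
      have h5 := mul_le_mul_of_nonneg_right h4 hs0
      linarith
    · have hr' : r ∈ Icc 0 t := hsub' (Ioo_subset_Icc_self hr)
      have hr0 : 0 ≤ deriv (X r) x := hc.le.trans (hJ r hr' x)
      have a1 := (abs_le.1 (h.norm_pconv_le h.norm_ψ_le (X r) (X r x))).2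
      have a2 := (abs_le.1 (h.norm_pconv_le (φ := deriv k)
        (fun x => norm_deriv_le_of_lipschitz h.k_lip) (X r) (X r x))).2
      set m := M + N * (r - t₀) with hm_def
      have m0 : 0 ≤ m := by
        have := sub_nonneg.2 hr.1.le
        positivity
      have m1 : m ≤ M + 1 := by
        have : N * (r - t₀) ≤ N * (T - t₀) := by
          gcongr
          exact (hr.2.le.trans hs.2).trans htT.le
        linarith
      have a3 : m * pconv ψ ρ₀ (X r) (X r x) ≤ (M + 1) * L :=
        mul_le_mul m1 a1 (h.pconv_ψ_nonneg _ _) (by positivity)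
      have a4 : m ^ 2 ≤ (M + 1) ^ 2 := by gcongr
      have a5 : 0 ≤ (N - pconv (deriv k) ρ₀ (X r) (X r x)
          - m * pconv ψ ρ₀ (X r) (X r x) - m ^ 2) * deriv (X r) x := by
        refine mul_nonneg ?_ hr0
        rw [hN]
        linarith
      linarith
  -- From g ≥ -(M + 1)J and ψ ⋆ ρ ≤ L it follows that J' ≥ -(M + 1 + L)J.
  have h1 := mul_exp_le_of_deriv_ge (f := fun t => deriv (X t) x)
    (A := fun s => -(M + 1 + L) * s) (m := fun _ => -(M + 1 + L)) ht (hcl.1.mono hsub)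
    (fun r hr => hj.hasDerivAt_J r ⟨ht₀.trans_lt hr.1, hr.2⟩ x)
    (fun s => by simpa using (hasDerivAt_id s).const_mul (-(M + 1 + L : ℝ))) (fun r hr => ?_)
  · refine le_trans ?_ h1
    refine mul_le_mul (hJ₀ t₀ (right_mem_Icc.2 ht₀) x) (Real.exp_le_exp.2 ?_) (Real.exp_pos _).le
      (hc₀.le.trans (hJ₀ t₀ (right_mem_Icc.2 ht₀) x))
    have : 0 ≤ (M + 1 + L) * (T - t) := mul_nonneg (by positivity) (sub_nonneg.2 htT.le)
    linarith
  · have hr' : r ∈ Icc 0 t := hsub (Ioo_subset_Icc_self hr)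
    have h2 := (abs_le.1 (h.norm_pconv_le h.norm_ψ_le (X r) (X r x))).2
    have h3 := mul_le_mul_of_nonneg_right h2 (hc.le.trans (hJ r hr' x))
    have h4 := hgn r (Ioo_subset_Icc_self hr)
    linarith

end Lifespan

/-! ### Maximal solutions and the blow-up criterion -/

section Maximal

variable {L : ℝ≥0} {ψ Ψ K ρ₀ u₀ θ : ℝ → ℝ} {X G : ℝ → ℝ → ℝ}

theorem IsFlow.isMaximalSolution (h : Data L ψ Ψ (deriv K) ρ₀ u₀ θ)
    (hf : IsFlow Ψ (deriv K) ρ₀ u₀ θ X G) {T : EReal} (hT : ∀ b : ℝ, (b : EReal) < T → Good X b)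
    (hmax : ∀ b : ℝ, T ≤ b → ¬ Good X b) :
    IsMaximalSolution ψ K ρ₀ u₀ T (eulerRho ρ₀ X) (eulerU Ψ ρ₀ X G) := by
  refine ⟨hf.isSolution h hT, hf.isMassClassical h hT, fun T' ρ' u' hs => ⟨?_, fun t ht htT => ?_⟩⟩
  · by_contra! hlt
    obtain ⟨b, hb, hbT⟩ := EReal.lt_iff_exists_real_btwn.1 hlt
    exact hmax b hb.le (hs.good h hf hbT)
  · exact hs.eq_euler h hf ht htT

theorem hasGlobalSolution_of_good (h : Data L ψ Ψ (deriv K) ρ₀ u₀ θ)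
    (hf : IsFlow Ψ (deriv K) ρ₀ u₀ θ X G) (hT : ∀ b, Good X b) : HasGlobalSolution ψ K ρ₀ u₀ :=
  ⟨_, _, hf.isMaximalSolution h (fun b _ => hT b)
    fun b hb => absurd hb (not_le.2 (EReal.coe_lt_top b))⟩

/-- At the first degenerate time T, a bound ∂ₓu ≥ -M at a single time within 1/N of T would carry
nondegeneracy up to T. Hence the bound fails at every such time. -/
theorem blowsUpInFiniteTime_of_not_good (h : Data L ψ Ψ (deriv K) ρ₀ u₀ θ)
    (hf : IsFlow Ψ (deriv K) ρ₀ u₀ θ X G) (hbad : ∃ b, ¬ Good X b) :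
    BlowsUpInFiniteTime ψ K ρ₀ u₀ := by
  obtain ⟨T, hT0, hT, hTbad⟩ := exists_lifespan h hf hbad
  refine ⟨T, hT0, _, _, hf.isMaximalSolution h (fun b hb => hT b (EReal.coe_lt_coe_iff.1 hb))
    (fun b hb hg => hTbad (hg.mono (EReal.coe_le_coe_iff.1 hb))), fun M => ?_⟩
  set N : ℝ := L + L * (|M| + 1) + (|M| + 1) ^ 2 with hN
  have hN0 : 0 < N := by positivity
  filter_upwards [Ioo_mem_nhdsLT (show max 0 (T - N⁻¹) < T from
    max_lt hT0 (sub_lt_self _ (inv_pos.2 hN0)))] with t ht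
  have ht0 : 0 ≤ t := ((le_max_left _ _).trans_lt ht.1).le
  have htN : T - N⁻¹ < t := (le_max_right _ _).trans_lt ht.1
  have ht' : t ∈ Icc 0 t := right_mem_Icc.2 ht0
  have hg := hT t ht.2
  obtain ⟨c, hc, hJ⟩ := hg.exists_le_deriv h hf ht0
  by_contra! hge
  refine hTbad (good_of_le_deriv h hf hT (abs_nonneg M) ht0 ht.2 ?_ fun x => ?_)
  · rw [← hN]
    have h1 : N * (T - t) ≤ N * N⁻¹ := by
      gcongr
      linarith
    rwa [mul_inv_cancel₀ hN0.ne'] at h1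
  -- At X t x, ∂ₓu = (g - aJ) / J with a ≥ 0, so ∂ₓu ≥ -M implies g ≥ -MJ ≥ -|M| J.
  · have h1 := hge (X t x)
    have hJx : 0 < deriv (X t) x := hc.trans_le (hJ t ht' x)
    rw [(hasDerivAt_eulerU_space h hf ht0 hg ht' _).deriv, label_X hg ht', le_div_iff₀ hJx,
      velX] at h1
    have h2 := mul_nonneg (h.pconv_ψ_nonneg (X t) (X t x)) hJx.le
    have h3 := mul_le_mul_of_nonneg_right (le_abs_self M) hJx.le
    linarith

end Maximal

/-! ### From the hypotheses to the Lagrangian assumptions -/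

section Assumptions

variable {ψ K ρ₀ u₀ : ℝ → ℝ}

/-- By Fubini almost every slice of the double integral converges, and ρ₀ has mass one, so some
slice has ρ₀ x ≠ 0. Changing x to z alters K' by at most a constant, as K' is Lipschitz. -/
theorem IsInitialData.integrable_force (hK : IsPotential K) (hd : IsInitialData K ρ₀ u₀) (z : ℝ) :
    Integrable fun y => deriv K (z - y) * ρ₀ y := by
  obtain ⟨L, hL⟩ := hK.lipschitz
  obtain ⟨x, hx0, hx⟩ : ∃ x, ρ₀ x ≠ 0 ∧
      Integrable fun y => deriv K (x - y) * (ρ₀ x * ρ₀ y) := by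
    by_contra! hall
    have h0 : ∀ᵐ x, ρ₀ x = 0 := by
      filter_upwards [hd.force.prod_right_ae] with x hx
      by_contra hne
      exact hall x hne hx
    have h1 := integral_congr_ae h0
    rw [hd.mass_one, integral_zero] at h1
    exact one_ne_zero h1
  have h1 : Integrable fun y => deriv K (x - y) * ρ₀ y := by
    refine (hx.const_mul (ρ₀ x)⁻¹).congr (Eventually.of_forall fun y => ?_)
    simp only
    field_simp
  have h2 : Integrable fun y => (deriv K (z - y) - deriv K (x - y)) * ρ₀ y := by
    refine integrable_bdd_mul (M := L * |z - x|) ?_ (fun y => ?_) hd.rho_integrable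
    · have := hL.continuous
      exact Continuous.aestronglyMeasurable (by fun_prop)
    · have := hL.norm_sub_le (z - y) (x - y)
      rwa [sub_sub_sub_cancel_right] at this
  refine (h1.add h2).congr (Eventually.of_forall fun y => ?_)
  simp only [Pi.add_apply]
  ring

theorem exists_data (hψ : IsInfluence ψ) (hK : IsPotential K) (hd : IsInitialData K ρ₀ u₀) :
    ∃ L Ψ θ, Data L ψ Ψ (deriv K) ρ₀ u₀ θ := by
  obtain ⟨C, hC⟩ := hψ.bounded
  obtain ⟨Lψ, hLψ⟩ := hψ.lipschitz
  obtain ⟨Lk, hLk⟩ := hK.lipschitz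
  obtain ⟨Cu, hCu⟩ := hd.deriv_u_bounded
  have hC0 : 0 ≤ C := (hψ.nonneg 0).trans (hC 0)
  have hCu0 : 0 ≤ Cu := (abs_nonneg _).trans (hCu 0)
  have hΨ : ∀ z, HasDerivAt (fun z => ∫ s in (0 : ℝ)..z, ψ s) (ψ z) z := fun z =>
    intervalIntegral.integral_hasDerivAt_right (hLψ.continuous.intervalIntegrable _ _)
      (hLψ.continuous.stronglyMeasurableAtFilter _ _) hLψ.continuous.continuousAt
  have hΨl : LipschitzWith C.toNNReal fun z => ∫ s in (0 : ℝ)..z, ψ s := by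
    refine lipschitzWith_of_nnnorm_deriv_le (fun z => (hΨ z).differentiableAt) fun z => ?_
    rw [← NNReal.coe_le_coe, (hΨ z).deriv, Real.coe_toNNReal _ hC0, coe_nnnorm,
      Real.norm_of_nonneg (hψ.nonneg z)]
    exact hC z
  have hul : LipschitzWith Cu.toNNReal u₀ := by
    refine lipschitzWith_of_nnnorm_deriv_le (hd.u_contDiff.differentiable one_ne_zero) fun z => ?_
    rw [← NNReal.coe_le_coe, Real.coe_toNNReal _ hCu0]
    exact hCu z
  have hi := hd.integrable_force hK
  have hFl : ∀ x z, |(∫ y, deriv K (x - y) * ρ₀ y) - ∫ y, deriv K (z - y) * ρ₀ y|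
      ≤ Lk * |x - z| := by
    intro x z
    rw [← integral_sub (hi x) (hi z)]
    simp_rw [← sub_mul]
    have := norm_integral_mul_le (f := fun y => deriv K (x - y) - deriv K (z - y))
      (M := Lk * |x - z|) (fun y => by
        have := hLk.norm_sub_le (x - y) (z - y)
        rwa [sub_sub_sub_cancel_right] at this) hd.rho_integrable
    simp only [Real.norm_of_nonneg (hd.rho_nonneg _), hd.mass_one, mul_one] at this
    exact this
  have hFc : Continuous fun x => ∫ y, deriv K (x - y) * ρ₀ y :=
    (LipschitzWith.of_dist_le_mul (K := Lk) fun x z => hFl x z).continuous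
  have hFi : Integrable fun x => (∫ y, deriv K (x - y) * ρ₀ y) * ρ₀ x := by
    refine hd.force.integral_prod_left.congr (Eventually.of_forall fun x => ?_)
    simp only
    rw [← integral_mul_const]
    refine integral_congr_ae (Eventually.of_forall fun y => ?_)
    simp only
    ring
  -- θ is the least convenient weight: 1 plus the quantities it must dominate. It is integrable
  -- against ρ₀ by the momentum and force hypotheses.
  refine ⟨C.toNNReal + Lk + Cu.toNNReal, fun z => ∫ s in (0 : ℝ)..z, ψ s,
    fun x => 1 + |u₀ x| + |∫ y, deriv K (x - y) * ρ₀ y|,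
    { hasDerivAt_Ψ := hΨ
      ψ_continuous := hLψ.continuous
      ψ_nonneg := hψ.nonneg
      Ψ_lip := hΨl.weaken (by rw [add_assoc]; exact le_self_add)
      k_lip := hLk.weaken (le_add_right le_add_self)
      ρ_continuous := hd.rho_continuous
      ρ_nonneg := hd.rho_nonneg
      ρ_bounded := hd.rho_bounded
      ρ_integrable := hd.rho_integrable
      mass_one := hd.mass_one
      u_contDiff := hd.u_contDiff
      u_lip := hul.weaken le_add_self
      θ_continuous := (continuous_const.add hd.u_contDiff.continuous.abs).add hFc.abs
      one_le_θ := fun x => by linarith [abs_nonneg (u₀ x), abs_nonneg (∫ y, deriv K (x - y) * ρ₀ y)]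
      θ_integrable := ?_
      k_integrable := by simpa using hi 0
      u_le := fun x => by linarith [abs_nonneg (∫ y, deriv K (x - y) * ρ₀ y)]
      k_le := fun x => by linarith [abs_nonneg (u₀ x)] }⟩
  refine ((hd.rho_integrable.add hd.momentum.abs).add hFi.abs).congr
    (Eventually.of_forall fun x => ?_)
  simp only [Pi.add_apply, abs_mul, abs_of_nonneg (hd.rho_nonneg x)]
  ring

theorem ae_abs_le_supNormSecondDeriv (hK : IsPotential K) :
    ∀ᵐ x, |deriv (deriv K) x| ≤ supNormSecondDeriv K := by
  obtain ⟨L, hL⟩ := hK.lipschitz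
  -- Needed because `toReal` sends ⊤ to 0.
  have hfin : eLpNorm (deriv (deriv K)) ⊤ volume ≠ ⊤ := by
    rw [eLpNorm_exponent_top]
    refine ((eLpNormEssSup_le_of_ae_bound (C := L) (Eventually.of_forall fun x => ?_)).trans_lt
      ENNReal.ofReal_lt_top).ne
    exact norm_deriv_le_of_lipschitz hL
  filter_upwards [enorm_ae_le_eLpNormEssSup (deriv (deriv K)) volume] with x hx
  rw [← eLpNorm_exponent_top] at hx
  have := ENNReal.toReal_mono hfin hx
  rwa [toReal_enorm] at this

end Assumptions

end EulerAlign

theorem theorem1p3 (ψ K ρ₀ u₀ : ℝ → ℝ) (hψ : EulerAlign.IsInfluence ψ)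
    (hK : EulerAlign.IsPotential K) (hdata : EulerAlign.IsInitialData K ρ₀ u₀) :
    -- attractive forces
    ((∀ᵐ x, 0 ≤ deriv (deriv K) x) →
      (∃ x, deriv u₀ x < -EulerAlign.conv ψ ρ₀ x) →
        EulerAlign.BlowsUpInFiniteTime ψ K ρ₀ u₀) ∧
    -- repulsive forces
    ((∀ᵐ x, deriv (deriv K) x ≤ 0) →
      ((∀ x, -EulerAlign.conv ψ ρ₀ x ≤ deriv u₀ x) →
        EulerAlign.HasGlobalSolution ψ K ρ₀ u₀) ∧
      ((∃ x, deriv u₀ x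
          < -EulerAlign.conv ψ ρ₀ x - Real.sqrt (EulerAlign.supNormSecondDeriv K)) →
        EulerAlign.BlowsUpInFiniteTime ψ K ρ₀ u₀)) := by
  obtain ⟨L, Ψ, θ, h⟩ := EulerAlign.exists_data hψ hK hdata
  obtain ⟨X, G, hf⟩ := h.exists_flow
  have hG : ∀ x, deriv (G 0) x = deriv u₀ x + EulerAlign.conv ψ ρ₀ x := hf.deriv_G_zero h
  refine ⟨fun hatt ⟨x, hx⟩ => ?_, fun hrep => ⟨fun hsub => ?_, fun ⟨x, hx⟩ => ?_⟩⟩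
  -- Attraction: the supercritical criterion with q = 0.
  · refine EulerAlign.blowsUpInFiniteTime_of_not_good h hf
      (EulerAlign.exists_not_good h hf le_rfl (hatt.mono fun x hx => by simpa using hx) (x := x) ?_)
    rw [hG]
    linarith
  · refine EulerAlign.hasGlobalSolution_of_good h hf
      (EulerAlign.good_of_subcritical h hf hrep fun x => ?_)
    rw [hG]
    linarith [hsub x]
  -- Here q is the square root of the norm, so that K'' ≥ -q² almost everywhere.
  · refine EulerAlign.blowsUpInFiniteTime_of_not_good h hf
      (EulerAlign.exists_not_good h hf (Real.sqrt_nonneg (EulerAlign.supNormSecondDeriv K))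
        ((EulerAlign.ae_abs_le_supNormSecondDeriv hK).mono fun x hx => ?_) (x := x) ?_)
    · rw [Real.sq_sqrt ((abs_nonneg _).trans hx)]
      exact (abs_le.1 hx).1
    · rw [hG]
      linarith
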